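/- Fix a real number $k>\tfrac12$ and an integer $n\ge 0$. For $R,\eta>0$ put $$S_{R,\eta}=\Bigl\{z\in\mathbb C:\ 0<|z|<R,\ |\arg z|<\tfrac{\pi}{2k}+\eta\Bigr\},\qquad D_m=\bigl\{z\in\mathbb C:\ |z|<\tfrac12(m+1)^{-1/k}\bigr\}\quad(m\in\mathbb N),$$ where $\eta$ is small in the sense that $\frac{\pi}{2k}+\eta<\pi$. Let $\mathcal G_{k,R,\eta}$ be the set of functions $f$ that are holomorphic in $S_{R,\eta}$, continuous on $\overline{S_{R,\eta}}$, have an asymptotic expansion $\sum a_pz^p$ at $0$ (for every proper subsector $S'$ and every $N$ there is $C$ with $|f(z)-\sum_{p<N}a_pz^p|\le C|z|^N$ on $S'$), and are Gevrey of order $k$: for every proper subsector $S'$ there are $C,M>0$ with $\sup_{z\in S'}|f^{(m)}(z)/m!|\le C M^m(m!)^{1/k}$ for all $m\in\mathbb N$. Let $\mathcal G_k$ be the inductive limit of the $\mathcal G_{k,R,\eta}$ (germs at $0$ on sectors $S_{R,\eta}$). For $\alpha=(R,\rho,k,\eta)$ with $0<\rho<1$ and a function $f$ on $S_{R,\eta}$,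 let $$\|f\|_\alpha=\inf\sum_{m\ge 0}\rho^{-m}\sup_{D_m\cup S_{R,\eta}}|f_m|\ \in[0,\infty],$$ the infimum being over all representations $f=\sum_m f_m$ on $S_{R,\eta}$ with $f_m$ holomorphic on $D_m\cup S_{R,\eta}$. For $\mu>0$ let $\mathcal G_\alpha\{y_1,\dots,y_n\}_\mu$ be the set of power series $\sum_{\omega\in\mathbb N^n}f_\omega(z)y^\omega$ in $y=(y_1,\dots,y_n)$ with $f_\omega\in\mathcal G_k$ and $\sum_\omega\|f_\omega\|_\alpha\,\mu^{|\omega|}<\infty$. Let $\mathcal G\{y\}=\mathcal G\{y_1,\dots,y_n\}$, the ring of Gevrey-analytic germs of order $k$, be the inductive limit (directed union) of the rings $\mathcal G_\alpha\{y\}_\mu$ over all $R>0$, $0<\rho<1$, $\eta>0$ with $\frac{\pi}{2k}+\eta<\pi$, and $\mu>0$. Then $\mathcal G\{y\}$ is a Noetherian, local and regular ring of Krull dimension $n+1$. -/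

import Mathlib

namespace GevreyAnalytic

open Filter Topology
open scoped ENNReal

/-- The open sector `S^k_{R,η} = {z : 0 < |z| < R, |arg z| < π/(2k) + η}`. -/
def sector (k R η : ℝ) : Set ℂ :=
  {z | 0 < ‖z‖ ∧ ‖z‖ < R ∧ |z.arg| < Real.pi / (2 * k) + η}

/-- The radius `(1/2) (n+1)^{-1/k}` of the disc `D_n`. -/
noncomputable def radius (k : ℝ) (n : ℕ) : ℝ := 1 / 2 * ((n : ℝ) + 1) ^ (-(1 / k))

/-- The domain `S^n = D_n ∪ S^k_{R,η}`. -/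
def stage (k R η : ℝ) (n : ℕ) : Set ℂ := Metric.ball 0 (radius k n) ∪ sector k R η

/-- `∑ a_p z^p` is an asymptotic expansion at `0` of `f` on `S^k_{R,η}`: the remainder of order `N`
is `O(|z|^N)` on every proper subsector (each of them is contained in one of the sectors
`S^k_{R',η'}` with `R' < R`, `η' < η`). -/
def HasAsymptoticExpansion (k R η : ℝ) (f : ℂ → ℂ) (a : ℕ → ℂ) : Prop :=
  ∀ R' η' : ℝ, 0 < R' → R' < R → 0 < η' → η' < η → ∀ N : ℕ, ∃ C : ℝ,
    ∀ z ∈ sector k R' η', ‖f z - ∑ p ∈ Finset.range N, a p * z ^ p‖ ≤ C * ‖z‖ ^ N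

/-- `f` belongs to `𝒢_{k,R,η}`: it is holomorphic in `S^k_{R,η}`, continuous on the closure, has an
asymptotic expansion at `0`, and satisfies the Gevrey estimates of order `k` on proper
subsectors. -/
structure IsGevreyOn (k R η : ℝ) (f : ℂ → ℂ) : Prop where
  differentiableOn : DifferentiableOn ℂ f (sector k R η)
  continuousOn : ContinuousOn f (closure (sector k R η))
  asymptotic : ∃ a : ℕ → ℂ, HasAsymptoticExpansion k R η f a
  gevrey : ∀ R' η' : ℝ, 0 < R' → R' < R → 0 < η' → η' < η → ∃ C M : ℝ, 0 < C ∧ 0 < M ∧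
    ∀ m : ℕ, ∀ z ∈ sector k R' η',
      ‖iteratedDeriv m f z / (m.factorial : ℂ)‖ ≤ C * M ^ m * (m.factorial : ℝ) ^ (1 / k)

/-- The filter generated by the sectors `S^k_{R,η}`, `R, η > 0`: germs along it are functions on
some `S^k_{R,η}`, two of them being identified when they agree on a smaller `S^k_{R',η'}`. -/
def sectorFilter (k : ℝ) : Filter ℂ :=
  ⨅ (R : ℝ) (_ : 0 < R) (η : ℝ) (_ : 0 < η), 𝓟 (sector k R η)

/-- The ring of germs of all functions on sectors `S^k_{R,η}`. -/
abbrev SectorGerm (k : ℝ) : Type := Germ (sectorFilter k) ℂ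

/-- `𝒢_k`, the inductive limit of the `𝒢_{k,R,η}`, as a set of germs. -/
def gevreyGerms (k : ℝ) : Set (SectorGerm k) :=
  {g | ∃ (R η : ℝ) (f : ℂ → ℂ), 0 < R ∧ 0 < η ∧ Real.pi / (2 * k) + η < Real.pi ∧
    IsGevreyOn k R η f ∧ g = (f : SectorGerm k)}

/-- The supremum norm of `f` on `s`, possibly infinite. -/
noncomputable def supNorm (s : Set ℂ) (f : ℂ → ℂ) : ℝ≥0∞ := ⨆ z ∈ s, ‖f z‖ₑ

/-- `f = ∑ F_n` on `S^k_{R,η}`, with `F_n` holomorphic on `D_n ∪ S^k_{R,η}`. -/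
structure IsRepresentation (k R η : ℝ) (f : ℂ → ℂ) (F : ℕ → ℂ → ℂ) : Prop where
  differentiableOn : ∀ n, DifferentiableOn ℂ (F n) (stage k R η n)
  hasSum : ∀ z ∈ sector k R η, HasSum (fun n => F n z) (f z)

/-- `∑ ‖F_n‖_{S^n} ρ^{-n}`. -/
noncomputable def cost (k R ρ η : ℝ) (F : ℕ → ℂ → ℂ) : ℝ≥0∞ :=
  ∑' n, supNorm (stage k R η n) (F n) * ENNReal.ofReal (ρ⁻¹ ^ n)

/-- The norm `‖f‖_α`, `α = (R, ρ, k, η)`: the infimum of `∑ ‖F_n‖_{S^n} ρ^{-n}` over all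
representations `f = ∑ F_n`. It is `∞` if there is no representation with a finite sum; in a
representation with a finite sum one has `‖F_n‖_{S^n} ≤ c ρ^n`. -/
noncomputable def gevreyNorm (k R ρ η : ℝ) (f : ℂ → ℂ) : ℝ≥0∞ :=
  ⨅ (F : ℕ → ℂ → ℂ) (_ : IsRepresentation k R η f F), cost k R ρ η F

/-- The admissible parameters `α = (R, ρ, k, η)` (with `k` fixed). -/
structure IsAdmissible (k R ρ η : ℝ) : Prop where
  R_pos : 0 < R
  ρ_pos : 0 < ρ
  ρ_lt : ρ < 1
  η_pos : 0 < η
  angle_lt : Real.pi / (2 * k) + η < Real.pi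

/-- The norm `‖f‖_{α,μ} = ∑_ω ‖f_ω‖_α μ^{|ω|}` of a family of coefficients. -/
noncomputable def seriesNorm (k R ρ η μ : ℝ) {n : ℕ} (f : (Fin n →₀ ℕ) → ℂ → ℂ) : ℝ≥0∞ :=
  ∑' ω, gevreyNorm k R ρ η (f ω) * ENNReal.ofReal (μ ^ ω.degree)

/-- The Banach algebra `𝒢_α{y_1, …, y_n}_μ`, as a set of power series in `y` whose coefficients are
germs: a function on the connected set `S^k_{R,η}` with `‖·‖_α < ∞` is holomorphic, hence
determined by its germ. -/
def banachPiece (k R ρ η μ : ℝ) (n : ℕ) : Set (MvPowerSeries (Fin n) (SectorGerm k)) :=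
  {φ | ∃ f : (Fin n →₀ ℕ) → ℂ → ℂ,
    (∀ ω, MvPowerSeries.coeff ω φ = (f ω : SectorGerm k)) ∧
    (∀ ω, MvPowerSeries.coeff ω φ ∈ gevreyGerms k) ∧
    seriesNorm k R ρ η μ f < ∞}

/-! ### Closure properties of the norms -/

lemma enorm_le_supNorm {s : Set ℂ} (f : ℂ → ℂ) {z : ℂ} (hz : z ∈ s) : ‖f z‖ₑ ≤ supNorm s f :=
  le_iSup₂ (f := fun z (_ : z ∈ s) => ‖f z‖ₑ) z hz

lemma supNorm_mono {s t : Set ℂ} (h : s ⊆ t) (f : ℂ → ℂ) : supNorm s f ≤ supNorm t f :=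
  iSup₂_le fun _ hz => enorm_le_supNorm f (h hz)

lemma sector_mono {k R R' η η' : ℝ} (hR : R' ≤ R) (hη : η' ≤ η) :
    sector k R' η' ⊆ sector k R η := fun _ ⟨h1, h2, h3⟩ =>
  ⟨h1, h2.trans_le hR, h3.trans_le (by linarith)⟩

lemma sector_mem {k R η : ℝ} (hR : 0 < R) (hη : 0 < η) : sector k R η ∈ sectorFilter k :=
  mem_iInf_of_mem R <| mem_iInf_of_mem hR <| mem_iInf_of_mem η <| mem_iInf_of_mem hη <|
    mem_principal_self _

lemma stage_mono {k R R' η η' : ℝ} (hR : R' ≤ R) (hη : η' ≤ η) (n : ℕ) :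
    stage k R' η' n ⊆ stage k R η n :=
  Set.union_subset_union_right _ (sector_mono hR hη)

lemma gevreyNorm_mono {k R R' ρ ρ' η η' : ℝ} (hR : R' ≤ R) (hη : η' ≤ η) (hρ0 : 0 < ρ)
    (hρ : ρ ≤ ρ') (f : ℂ → ℂ) : gevreyNorm k R' ρ' η' f ≤ gevreyNorm k R ρ η f := by
  refine le_iInf₂ fun F hF => (iInf₂_le F ⟨fun n => (hF.1 n).mono (stage_mono hR hη n),
    fun z hz => hF.2 z (sector_mono hR hη hz)⟩).trans ?_
  refine ENNReal.tsum_le_tsum fun n => mul_le_mul' (supNorm_mono (stage_mono hR hη n) _) ?_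
  have : 0 < ρ' := hρ0.trans_le hρ
  gcongr

lemma seriesNorm_mono {k R R' ρ ρ' η η' μ μ' : ℝ} (hR : R' ≤ R) (hη : η' ≤ η) (hρ0 : 0 < ρ)
    (hρ : ρ ≤ ρ') (hμ0 : 0 < μ') (hμ : μ' ≤ μ) {n : ℕ} (f : (Fin n →₀ ℕ) → ℂ → ℂ) :
    seriesNorm k R' ρ' η' μ' f ≤ seriesNorm k R ρ η μ f :=
  ENNReal.tsum_le_tsum fun ω => mul_le_mul' (gevreyNorm_mono hR hη hρ0 hρ _) (by gcongr)

lemma gevreyNorm_const_le (k R ρ η : ℝ) (c : ℂ) : gevreyNorm k R ρ η (fun _ => c) ≤ ‖c‖ₑ := by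
  refine (iInf₂_le (fun n _ => if n = 0 then c else 0)
    ⟨fun n => differentiableOn_const _, fun z _ => hasSum_ite_eq 0 c⟩).trans ?_
  rw [cost, tsum_eq_single 0]
  · have : supNorm (stage k R η 0) (fun _ => c) ≤ ‖c‖ₑ := iSup₂_le fun z _ => le_rfl
    simpa using this
  · intro n hn
    simp [hn, supNorm]

lemma gevreyNorm_neg_le (k R ρ η : ℝ) (f : ℂ → ℂ) :
    gevreyNorm k R ρ η (-f) ≤ gevreyNorm k R ρ η f := by
  refine le_iInf₂ fun F hF => (iInf₂_le (fun n => -F n)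
    ⟨fun n => (hF.1 n).neg, fun z hz => (hF.2 z hz).neg⟩).trans ?_
  simp [cost, supNorm]

lemma gevreyNorm_add_le (k R ρ η : ℝ) (f g : ℂ → ℂ) :
    gevreyNorm k R ρ η (f + g) ≤ gevreyNorm k R ρ η f + gevreyNorm k R ρ η g := by
  refine ENNReal.le_iInf₂_add_iInf₂ fun F hF G hG => (iInf₂_le (fun n => F n + G n)
    ⟨fun n => (hF.1 n).add (hG.1 n), fun z hz => (hF.2 z hz).add (hG.2 z hz)⟩).trans ?_
  rw [cost, cost, cost, ← ENNReal.tsum_add]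
  refine ENNReal.tsum_le_tsum fun n => ?_
  rw [← add_mul]
  gcongr
  exact iSup₂_le fun z hz => (enorm_add_le _ _).trans
    (add_le_add (enorm_le_supNorm _ hz) (enorm_le_supNorm _ hz))

lemma gevreyNorm_sum_le (k R ρ η : ℝ) {ι : Type*} (s : Finset ι) (f : ι → ℂ → ℂ) :
    gevreyNorm k R ρ η (∑ i ∈ s, f i) ≤ ∑ i ∈ s, gevreyNorm k R ρ η (f i) := by
  classical
  induction s using Finset.induction_on with
  | empty =>
    have := gevreyNorm_const_le k R ρ η 0
    rw [enorm_zero] at this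
    exact this.trans (by simp)
  | insert i s hi ih =>
    rw [Finset.sum_insert hi, Finset.sum_insert hi]
    exact (gevreyNorm_add_le _ _ _ _ _ _).trans (add_le_add le_rfl ih)

lemma radius_pos (k : ℝ) (n : ℕ) : 0 < radius k n := by unfold radius; positivity

lemma radius_anti {k : ℝ} (hk : 0 < k) {m n : ℕ} (h : m ≤ n) : radius k n ≤ radius k m := by
  unfold radius
  have : ((n : ℝ) + 1) ^ (-(1 / k)) ≤ ((m : ℝ) + 1) ^ (-(1 / k)) := by
    apply Real.rpow_le_rpow_of_nonpos (by positivity) (by gcongr)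
    have : 0 < 1 / k := by positivity
    linarith
  linarith

lemma stage_anti {k R η : ℝ} (hk : 0 < k) {m n : ℕ} (h : m ≤ n) :
    stage k R η n ⊆ stage k R η m :=
  Set.union_subset_union_left _ (Metric.ball_subset_ball (radius_anti hk h))

/-- A finite cost gives geometric bounds. -/
lemma norm_le_of_cost {k R ρ η : ℝ} (hρ : 0 < ρ) {F : ℕ → ℂ → ℂ} (h : cost k R ρ η F ≠ ∞)
    (n : ℕ) {z : ℂ} (hz : z ∈ stage k R η n) : ‖F n z‖ ≤ (cost k R ρ η F).toReal * ρ ^ n := by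
  have h1 : ‖F n z‖ₑ * ENNReal.ofReal (ρ⁻¹ ^ n) ≤ cost k R ρ η F :=
    (mul_le_mul' (enorm_le_supNorm _ hz) le_rfl).trans (ENNReal.le_tsum n)
  have h2 := ENNReal.toReal_mono h h1
  rw [ENNReal.toReal_mul, toReal_enorm, ENNReal.toReal_ofReal (by positivity), inv_pow,
    mul_inv_le_iff₀ (by positivity)] at h2
  exact h2

lemma gevreyNorm_mul_le_cost {k R ρ η : ℝ} (hk : 0 < k) (hρ : 0 < ρ) (hρ1 : ρ < 1) {f g : ℂ → ℂ}
    {F G : ℕ → ℂ → ℂ} (hF : IsRepresentation k R η f F) (hG : IsRepresentation k R η g G)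
    (cF : cost k R ρ η F ≠ ∞) (cG : cost k R ρ η G ≠ ∞) :
    gevreyNorm k R ρ η (f * g) ≤ cost k R ρ η F * cost k R ρ η G := by
  classical
  have hsum : ∀ {H : ℕ → ℂ → ℂ}, cost k R ρ η H ≠ ∞ → ∀ z ∈ sector k R η,
      Summable fun n => ‖H n z‖ := fun {H} cH z hz =>
    Summable.of_nonneg_of_le (fun _ => norm_nonneg _)
      (fun n => norm_le_of_cost hρ cH n (Or.inr hz))
      ((summable_geometric_of_lt_one hρ.le hρ1).mul_left _)
  have hrep : IsRepresentation k R η (f * g)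
      (fun n z => ∑ p ∈ Finset.HasAntidiagonal.antidiagonal n, F p.1 z * G p.2 z) := by
    refine ⟨fun n => ?_, fun z hz => ?_⟩
    · refine DifferentiableOn.fun_sum fun p hp => ?_
      have := Finset.HasAntidiagonal.mem_antidiagonal.1 hp
      exact ((hF.1 p.1).mono (stage_anti hk (by omega))).mul
        ((hG.1 p.2).mono (stage_anti hk (by omega)))
    · have h1 := hsum cF z hz
      have h2 := hsum cG z hz
      have h3 := tsum_mul_tsum_eq_tsum_sum_antidiagonal_of_summable_norm h1 h2
      rw [(hF.2 z hz).tsum_eq, (hG.2 z hz).tsum_eq] at h3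
      rw [Pi.mul_apply, h3]
      exact (summable_norm_sum_mul_antidiagonal_of_summable_norm h1 h2).of_norm.hasSum
  refine (iInf₂_le _ hrep).trans ?_
  unfold cost
  rw [← ENNReal.tsum_mul_right]
  simp_rw [← ENNReal.tsum_mul_left]
  rw [← ENNReal.tsum_prod (f := fun a b => supNorm (stage k R η a) (F a) *
    ENNReal.ofReal (ρ⁻¹ ^ a) * (supNorm (stage k R η b) (G b) * ENNReal.ofReal (ρ⁻¹ ^ b))),
    ← Finset.HasAntidiagonal.sigmaAntidiagonalEquivProd.tsum_eq, ENNReal.tsum_sigma']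
  refine ENNReal.tsum_le_tsum fun n => ?_
  rw [tsum_fintype]
  refine le_trans ?_ (le_of_eq (Finset.sum_coe_sort (Finset.HasAntidiagonal.antidiagonal n)
    (fun p : ℕ × ℕ => supNorm (stage k R η p.1) (F p.1) *
    ENNReal.ofReal (ρ⁻¹ ^ p.1) * (supNorm (stage k R η p.2) (G p.2) *
    ENNReal.ofReal (ρ⁻¹ ^ p.2)))).symm)
  have h1 : supNorm (stage k R η n)
      (fun z => ∑ p ∈ Finset.HasAntidiagonal.antidiagonal n, F p.1 z * G p.2 z) ≤
      ∑ p ∈ Finset.HasAntidiagonal.antidiagonal n,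
        supNorm (stage k R η p.1) (F p.1) * supNorm (stage k R η p.2) (G p.2) := by
    refine iSup₂_le fun z hz => (enorm_sum_le _ _).trans (Finset.sum_le_sum fun p hp => ?_)
    have := Finset.HasAntidiagonal.mem_antidiagonal.1 hp
    rw [enorm_mul]
    exact mul_le_mul' (enorm_le_supNorm _ (stage_anti hk (by omega) hz))
      (enorm_le_supNorm _ (stage_anti hk (by omega) hz))
  refine (mul_le_mul' h1 le_rfl).trans ?_
  rw [Finset.sum_mul]
  refine Finset.sum_le_sum fun p hp => le_of_eq ?_
  rw [← Finset.HasAntidiagonal.mem_antidiagonal.1 hp, pow_add, ENNReal.ofReal_mul (by positivity)]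
  ring

lemma gevreyNorm_mul_le {k R ρ η : ℝ} (hk : 0 < k) (hρ : 0 < ρ) (hρ1 : ρ < 1) {f g : ℂ → ℂ}
    (hf : gevreyNorm k R ρ η f ≠ ∞) (hg : gevreyNorm k R ρ η g ≠ ∞) :
    gevreyNorm k R ρ η (f * g) ≤ gevreyNorm k R ρ η f * gevreyNorm k R ρ η g := by
  have key : ∀ a b : ℝ≥0∞, gevreyNorm k R ρ η f < a → gevreyNorm k R ρ η g < b →
      gevreyNorm k R ρ η (f * g) ≤ a * b := by
    intro a b ha hb
    obtain ⟨F, hF, hFa⟩ := by simpa only [gevreyNorm, iInf_lt_iff] using ha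
    obtain ⟨G, hG, hGb⟩ := by simpa only [gevreyNorm, iInf_lt_iff] using hb
    exact (gevreyNorm_mul_le_cost hk hρ hρ1 hF hG hFa.ne_top hGb.ne_top).trans
      (mul_le_mul' hFa.le hGb.le)
  refine ENNReal.le_mul_of_forall_lt ?_ ?_ fun a ha b hb => key a b ha hb
  · exact Or.inr hg
  · exact Or.inl hf

lemma seriesNorm_add_le (k R ρ η μ : ℝ) {n : ℕ} (f g : (Fin n →₀ ℕ) → ℂ → ℂ) :
    seriesNorm k R ρ η μ (fun ω => f ω + g ω) ≤
      seriesNorm k R ρ η μ f + seriesNorm k R ρ η μ g := by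
  rw [seriesNorm, seriesNorm, seriesNorm, ← ENNReal.tsum_add]
  refine ENNReal.tsum_le_tsum fun ω => ?_
  rw [← add_mul]
  exact mul_le_mul' (gevreyNorm_add_le _ _ _ _ _ _) le_rfl

lemma gevreyNorm_ne_top_of_series {k R ρ η μ : ℝ} (hμ : 0 < μ) {n : ℕ}
    {f : (Fin n →₀ ℕ) → ℂ → ℂ} (hf : seriesNorm k R ρ η μ f < ∞) (ω : Fin n →₀ ℕ) :
    gevreyNorm k R ρ η (f ω) ≠ ∞ := by
  intro h
  have h1 : gevreyNorm k R ρ η (f ω) * ENNReal.ofReal (μ ^ ω.degree) < ∞ :=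
    (ENNReal.le_tsum ω).trans_lt hf
  rw [h, ENNReal.top_mul (by simp; positivity)] at h1
  exact lt_irrefl _ h1

lemma seriesNorm_mul_le {k R ρ η μ : ℝ} (hk : 0 < k) (hρ : 0 < ρ) (hρ1 : ρ < 1) (hμ : 0 < μ)
    {n : ℕ} {f g : (Fin n →₀ ℕ) → ℂ → ℂ} (hf : seriesNorm k R ρ η μ f < ∞)
    (hg : seriesNorm k R ρ η μ g < ∞) :
    seriesNorm k R ρ η μ (fun ω => ∑ p ∈ Finset.HasAntidiagonal.antidiagonal ω, f p.1 * g p.2) ≤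
      seriesNorm k R ρ η μ f * seriesNorm k R ρ η μ g := by
  unfold seriesNorm
  rw [← ENNReal.tsum_mul_right]
  simp_rw [← ENNReal.tsum_mul_left]
  rw [← ENNReal.tsum_prod (f := fun a b => gevreyNorm k R ρ η (f a) *
    ENNReal.ofReal (μ ^ a.degree) * (gevreyNorm k R ρ η (g b) * ENNReal.ofReal (μ ^ b.degree))),
    ← Finset.HasAntidiagonal.sigmaAntidiagonalEquivProd.tsum_eq, ENNReal.tsum_sigma']
  refine ENNReal.tsum_le_tsum fun ω => ?_
  rw [tsum_fintype]
  refine le_trans ?_ (le_of_eq (Finset.sum_coe_sort (Finset.HasAntidiagonal.antidiagonal ω)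
    (fun p : (Fin n →₀ ℕ) × (Fin n →₀ ℕ) => gevreyNorm k R ρ η (f p.1) *
    ENNReal.ofReal (μ ^ p.1.degree) * (gevreyNorm k R ρ η (g p.2) *
    ENNReal.ofReal (μ ^ p.2.degree)))).symm)
  refine (mul_le_mul' (gevreyNorm_sum_le _ _ _ _ _ _) le_rfl).trans ?_
  rw [Finset.sum_mul]
  refine Finset.sum_le_sum fun p hp => ?_
  refine (mul_le_mul' (gevreyNorm_mul_le hk hρ hρ1 (gevreyNorm_ne_top_of_series hμ hf _)
    (gevreyNorm_ne_top_of_series hμ hg _)) le_rfl).trans (le_of_eq ?_)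
  rw [← Finset.HasAntidiagonal.mem_antidiagonal.1 hp, map_add, pow_add, ENNReal.ofReal_mul (by positivity)]
  ring

/-! ### Functions of finite norm are Gevrey of order `k` -/

lemma continuousAt_abs_arg {z : ℂ} (hz : z ≠ 0) : ContinuousAt (fun w : ℂ => |w.arg|) z := by
  have h1 : ContinuousAt (fun w : ℂ => InnerProductGeometry.angle (1 : ℂ) w) z :=
    (InnerProductGeometry.continuousAt_angle (x := ((1 : ℂ), z)) one_ne_zero hz).comp
      (f := fun w : ℂ => ((1 : ℂ), w)) (by fun_prop)
  refine h1.congr ?_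
  filter_upwards [isOpen_ne.mem_nhds hz] with w hw using Complex.angle_one_left hw

lemma isOpen_sector (k R η : ℝ) : IsOpen (sector k R η) := by
  rw [isOpen_iff_mem_nhds]
  intro z hz
  obtain ⟨h1, h2, h3⟩ := hz
  filter_upwards [continuous_norm.continuousAt.eventually (lt_mem_nhds h1),
    continuous_norm.continuousAt.eventually (gt_mem_nhds h2),
    (continuousAt_abs_arg (norm_pos_iff.1 h1)).eventually (gt_mem_nhds h3)] with w a b c
  exact ⟨a, b, c⟩

lemma isOpen_stage (k R η : ℝ) (n : ℕ) : IsOpen (stage k R η n) :=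
  Metric.isOpen_ball.union (isOpen_sector k R η)

lemma closure_sector_subset {k R R' η η' : ℝ} (hR : R' < R) (hη : η' < η) :
    closure (sector k R' η') ⊆ insert 0 (sector k R η) := by
  intro z hz
  by_cases h0 : z = 0
  · exact Or.inl h0
  refine Or.inr ⟨norm_pos_iff.2 h0, ?_, ?_⟩
  · refine lt_of_le_of_lt ?_ hR
    have : sector k R' η' ⊆ {w | ‖w‖ ≤ R'} := fun w hw => hw.2.1.le
    exact closure_minimal this (isClosed_le continuous_norm continuous_const) hz
  · by_contra hc
    have h3 : Real.pi / (2 * k) + η' < |z.arg| := by linarith [not_lt.1 hc]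
    obtain ⟨w, hw1, hw2⟩ := mem_closure_iff_nhds.1 hz _
      ((continuousAt_abs_arg h0).eventually (lt_mem_nhds h3))
    exact lt_irrefl _ (hw2.2.2.trans hw1)

/-- A smaller sector stays at distance at least `δ |z|` from the boundary of a larger one. -/
lemma exists_ball_subset_sector {k R R' η η' : ℝ} (hR' : 0 < R') (hR : R' < R) (hη : η' < η) :
    ∃ δ : ℝ, 0 < δ ∧ δ < 1 ∧ ∀ z ∈ sector k R' η', Metric.ball z (δ * ‖z‖) ⊆ sector k R η := by
  let U : Set ℂ := {w | 0 < ‖w‖ ∧ ‖w‖ < R / R' ∧ |w.arg| < Real.pi / (2 * k) + η}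
  have hU : IsOpen U := isOpen_sector k (R / R') η
  let K : Set ℂ := Metric.sphere 0 1 ∩ closure (sector k 2 η')
  have hK : IsCompact K := (isCompact_sphere 0 1).inter_right isClosed_closure
  have h1R : 1 < R / R' := (one_lt_div hR').2 hR
  have hKU : K ⊆ U := by
    rintro w ⟨hw1, hw2⟩
    have hw1 : ‖w‖ = 1 := by simpa using hw1
    rcases closure_sector_subset (R := 3) (by norm_num) hη hw2 with h | h
    · rw [h] at hw1; simp at hw1
    · exact ⟨h.1, by rw [hw1]; exact h1R, h.2.2⟩
  obtain ⟨δ, hδ, hδU⟩ := hK.exists_thickening_subset_open hU hKU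
  refine ⟨min δ (1 / 2), by positivity, (min_le_right _ _).trans_lt (by norm_num), ?_⟩
  intro z hz w hw
  have hz0 : 0 < ‖z‖ := hz.1
  have hargs : ∀ v : ℂ, (v / (‖z‖ : ℂ)).arg = v.arg := fun v => by
    rw [div_eq_inv_mul, ← Complex.ofReal_inv, Complex.arg_real_mul _ (by positivity)]
  have hzK : z / (‖z‖ : ℂ) ∈ K := by
    have hn : ‖z / (‖z‖ : ℂ)‖ = 1 := by simp [hz0.ne']
    refine ⟨by simpa using hn, subset_closure ⟨by rw [hn]; norm_num, by rw [hn]; norm_num, ?_⟩⟩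
    rw [hargs]; exact hz.2.2
  have hwU : w / (‖z‖ : ℂ) ∈ U := by
    apply hδU
    rw [Metric.mem_thickening_iff]
    refine ⟨_, hzK, ?_⟩
    rw [dist_eq_norm, ← sub_div, norm_div, Complex.norm_real, norm_norm, div_lt_iff₀ hz0]
    rw [Metric.mem_ball, dist_eq_norm] at hw
    exact hw.trans_le (by gcongr; exact min_le_left _ _)
  obtain ⟨a, b, c⟩ := hwU
  rw [hargs] at c
  rw [norm_div, Complex.norm_real, norm_norm] at a b
  refine ⟨by by_contra h; simp [le_antisymm (not_lt.1 h) (norm_nonneg _)] at a, ?_, c⟩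
  rw [div_lt_iff₀ hz0] at b
  calc ‖w‖ < R / R' * ‖z‖ := b
    _ ≤ R / R' * R' := by gcongr; exact hz.2.1.le
    _ = R := by field_simp

lemma inv_radius_pow (k : ℝ) (n m : ℕ) :
    (radius k n ^ m)⁻¹ = 2 ^ m * (((n : ℝ) + 1) ^ (m : ℝ)) ^ (1 / k) := by
  have h : (0 : ℝ) ≤ (n : ℝ) + 1 := by positivity
  rw [radius, mul_pow, mul_inv, ← Real.rpow_natCast (((n : ℝ) + 1) ^ (-(1 / k))) m,
    ← Real.rpow_mul h, ← Real.rpow_mul h, ← Real.rpow_neg h]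
  congr 1
  · rw [one_div, inv_pow, inv_inv]
  · congr 1; ring

/-- `ρ^n (n+1)^{m/k} ≤ C M^m (m!)^{1/k} q^n` with `q < 1`. -/
lemma exists_bound_radius {k ρ : ℝ} (hk : 0 < k) (hρ : 0 < ρ) (hρ1 : ρ < 1) :
    ∃ C M q : ℝ, 0 < C ∧ 0 < M ∧ 0 < q ∧ q < 1 ∧ ∀ n m : ℕ,
      ρ ^ n * (radius k n ^ m)⁻¹ ≤ C * M ^ m * (m.factorial : ℝ) ^ (1 / k) * q ^ n := by
  set q := Real.sqrt ρ with hq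
  have hq0 : 0 < q := Real.sqrt_pos.2 hρ
  have hq1 : q < 1 := by rw [hq, Real.sqrt_lt' one_pos]; simpa using hρ1
  have hqq : q * q = ρ := Real.mul_self_sqrt hρ.le
  set l := -(k * Real.log q) with hl
  have hl0 : 0 < l := by
    have := Real.log_neg hq0 hq1
    rw [hl]; nlinarith
  refine ⟨Real.exp l ^ (1 / k), 2 * (1 / l) ^ (1 / k), q, by positivity, by positivity, hq0, hq1,
    fun n m => ?_⟩
  have hqn : q ^ n = Real.exp (-(l * n)) ^ (1 / k) := by
    rw [← Real.exp_mul, hl, ← Real.rpow_natCast, Real.rpow_def_of_pos hq0]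
    congr 1; field_simp
  have key : Real.exp (-(l * n)) * ((n : ℝ) + 1) ^ (m : ℝ) ≤
      Real.exp l * ((1 / l) ^ m * m.factorial) := by
    have h1 := Real.pow_div_factorial_le_exp (l * (n + 1)) (by positivity) m
    rw [div_le_iff₀ (by positivity), mul_pow] at h1
    have h2 : Real.exp (l * (n + 1)) = Real.exp (l * n) * Real.exp l := by
      rw [← Real.exp_add]; ring_nf
    rw [h2] at h1
    rw [Real.exp_neg, Real.rpow_natCast, inv_mul_le_iff₀ (by positivity), one_div, inv_pow]
    have : Real.exp (l * n) * (Real.exp l * ((l ^ m)⁻¹ * m.factorial)) =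
      (Real.exp (l * n) * Real.exp l * m.factorial) / l ^ m := by field_simp
    rw [this, le_div_iff₀ (by positivity)]
    linarith
  have key2 := Real.rpow_le_rpow (by positivity) key (show (0 : ℝ) ≤ 1 / k by positivity)
  rw [Real.mul_rpow (by positivity) (by positivity), ← hqn,
    Real.mul_rpow (by positivity) (by positivity),
    Real.mul_rpow (by positivity) (by positivity)] at key2
  have h3 : ((1 / l) ^ m) ^ (1 / k) = ((1 / l) ^ (1 / k)) ^ m := by
    rw [← Real.rpow_natCast, ← Real.rpow_natCast, ← Real.rpow_mul (by positivity),
      ← Real.rpow_mul (by positivity), mul_comm]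
  rw [h3] at key2
  rw [inv_radius_pow, ← hqq, mul_pow, mul_pow]
  have h4 := mul_le_mul_of_nonneg_left key2 (show (0 : ℝ) ≤ q ^ n * 2 ^ m by positivity)
  linarith

/-- The Taylor quotients at `0`: `h = h(0) + z (h(z) - h(0)) / z`, and so on. -/
noncomputable def quotient (h : ℂ → ℂ) : ℕ → ℂ → ℂ
  | 0 => h
  | p + 1 => dslope (quotient h p) 0

lemma quotient_expansion (h : ℂ → ℂ) (N : ℕ) (z : ℂ) :
    h z - ∑ p ∈ Finset.range N, quotient h p 0 * z ^ p = z ^ N * quotient h N z := by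
  induction N with
  | zero => simp [quotient]
  | succ N ih =>
    rw [Finset.sum_range_succ, ← sub_sub, ih]
    have h1 := sub_smul_dslope (quotient h N) 0 z
    rw [sub_zero, smul_eq_mul] at h1
    have h2 : quotient h (N + 1) z = dslope (quotient h N) 0 z := rfl
    rw [h2, pow_succ, mul_assoc, h1]; ring

lemma quotient_bound {k R η B : ℝ} {n : ℕ} {h : ℂ → ℂ}
    (hd : DifferentiableOn ℂ h (stage k R η n)) (hB : ∀ z ∈ stage k R η n, ‖h z‖ ≤ B) (p : ℕ) :
    DifferentiableOn ℂ (quotient h p) (stage k R η n) ∧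
      ∀ z ∈ stage k R η n, ‖quotient h p z‖ ≤ B * 2 ^ p * (radius k n ^ p)⁻¹ := by
  have hr := radius_pos k n
  have hmem : (0 : ℂ) ∈ stage k R η n := Or.inl (by simpa using hr)
  induction p with
  | zero => simpa [quotient] using ⟨hd, hB⟩
  | succ p ih =>
    obtain ⟨ih1, ih2⟩ := ih
    refine ⟨(Complex.differentiableOn_dslope ((isOpen_stage k R η n).mem_nhds hmem)).2 ih1, ?_⟩
    set B' := B * 2 ^ p * (radius k n ^ p)⁻¹ with hB'
    have hB'0 : 0 ≤ B' := (norm_nonneg _).trans (ih2 0 hmem)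
    have hdiff : ∀ z ∈ stage k R η n, ‖quotient h p z - quotient h p 0‖ ≤ 2 * B' := fun z hz =>
      (norm_sub_le _ _).trans (by linarith [ih2 z hz, ih2 0 hmem])
    have heq : B * 2 ^ (p + 1) * (radius k n ^ (p + 1))⁻¹ = 2 * B' / radius k n := by
      rw [hB', pow_succ, pow_succ, mul_inv]; field_simp
    intro z hz
    rw [heq]
    change ‖dslope (quotient h p) 0 z‖ ≤ _
    by_cases hzb : z ∈ Metric.ball (0 : ℂ) (radius k n)
    · refine Complex.norm_dslope_le_div_of_mapsTo_ball (ih1.mono Set.subset_union_left) ?_ hzb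
      intro w hw
      rw [Metric.mem_closedBall, dist_eq_norm]
      exact hdiff w (Or.inl hw)
    · have hzr : radius k n ≤ ‖z‖ := by simpa using hzb
      have hz0 : z ≠ 0 := norm_pos_iff.1 (hr.trans_le hzr)
      rw [dslope_of_ne _ hz0, slope_def_field, norm_div, sub_zero]
      exact div_le_div₀ (by positivity) (hdiff z hz) hr hzr

/-- A function with a representation of finite cost satisfies, on a smaller sector, all the
conditions that define the Gevrey functions of order `k`. -/
theorem mem_gevreyGerms_of_norm {k R ρ η : ℝ} (hk : 0 < k) (hα : IsAdmissible k R ρ η)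
    {f : ℂ → ℂ} (hf : gevreyNorm k R ρ η f ≠ ∞) : (f : SectorGerm k) ∈ gevreyGerms k := by
  obtain ⟨F, hF, hFc⟩ : ∃ F, ∃ _ : IsRepresentation k R η f F, cost k R ρ η F < ∞ := by
    simpa only [gevreyNorm, iInf_lt_iff] using lt_top_iff_ne_top.2 hf
  obtain ⟨hR, hρ, hρ1, hη, hang⟩ := hα
  obtain ⟨C₀, M₀, q, hC₀, hM₀, hq, hq1, hCM⟩ := exists_bound_radius hk hρ hρ1
  set c := (cost k R ρ η F).toReal with hc
  have hc0 : 0 ≤ c := ENNReal.toReal_nonneg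
  have hb : ∀ n, ∀ z ∈ stage k R η n, ‖F n z‖ ≤ c * ρ ^ n := fun n z hz =>
    norm_le_of_cost hρ hFc.ne n hz
  have hSo := isOpen_sector k R η
  have hgeo : Summable fun n : ℕ => q ^ n := summable_geometric_of_lt_one hq.le hq1
  -- holomorphy
  have hfd : DifferentiableOn ℂ f (sector k R η) := by
    have := Complex.differentiableOn_tsum_of_summable_norm
      ((summable_geometric_of_lt_one hρ.le hρ1).mul_left c)
      (fun n => (hF.1 n).mono Set.subset_union_right) hSo (fun n z hz => hb n z (Or.inr hz))
    exact this.congr fun z hz => (hF.2 z hz).tsum_eq.symm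
  -- the asymptotic expansion, on the whole sector
  set a : ℕ → ℂ := fun p => ∑' n, quotient (F n) p 0 with ha
  have hqb : ∀ (N n : ℕ), ∀ z ∈ stage k R η n, ‖quotient (F n) N z‖ ≤
      c * 2 ^ N * (C₀ * M₀ ^ N * (N.factorial : ℝ) ^ (1 / k)) * q ^ n := by
    intro N n z hz
    refine ((quotient_bound (hF.1 n) (hb n) N).2 z hz).trans ?_
    have := mul_le_mul_of_nonneg_left (hCM n N) (show 0 ≤ c * 2 ^ N by positivity)
    linarith
  have hasy : ∀ N : ℕ, ∀ z ∈ sector k R η, ‖f z - ∑ p ∈ Finset.range N, a p * z ^ p‖ ≤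
      (c * 2 ^ N * (C₀ * M₀ ^ N * (N.factorial : ℝ) ^ (1 / k)) * ∑' n, q ^ n) * ‖z‖ ^ N := by
    intro N z hz
    have h0 : ∀ p, HasSum (fun n => quotient (F n) p 0) (a p) := fun p =>
      (Summable.of_norm_bounded (hgeo.mul_left _)
        (fun n => hqb p n 0 (Or.inl (by simpa using radius_pos k n)))).hasSum
    have h1 : HasSum (fun n => F n z - ∑ p ∈ Finset.range N, quotient (F n) p 0 * z ^ p)
        (f z - ∑ p ∈ Finset.range N, a p * z ^ p) :=
      (hF.2 z hz).sub (hasSum_sum fun p _ => (h0 p).mul_right _)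
    rw [← h1.tsum_eq, ← tsum_mul_left, ← tsum_mul_right]
    refine tsum_of_norm_bounded ((hgeo.mul_left _).mul_right _).hasSum fun n => ?_
    rw [quotient_expansion, norm_mul, norm_pow, mul_comm]
    exact mul_le_mul_of_nonneg_right (hqb N n z (Or.inr hz)) (by positivity)
  -- the Gevrey estimates
  have hgev : ∀ R' η' : ℝ, 0 < R' → R' < R → 0 < η' → η' < η → ∃ C M : ℝ, 0 < C ∧ 0 < M ∧
      ∀ m : ℕ, ∀ z ∈ sector k R' η',
        ‖iteratedDeriv m f z / (m.factorial : ℂ)‖ ≤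
          C * M ^ m * (m.factorial : ℝ) ^ (1 / k) := by
    intro R' η' hR' hR'R hη' hη'η
    obtain ⟨δ, hδ, hδ1, hball⟩ := exists_ball_subset_sector (k := k) hR' hR'R hη'η
    have hVo := isOpen_sector k R' η'
    have hVS : sector k R' η' ⊆ sector k R η := sector_mono hR'R.le hη'η.le
    -- Cauchy's estimates on discs of radius proportional to that of `D_n`
    have hcau : ∀ m n : ℕ, ∀ z ∈ sector k R' η', ‖iteratedDeriv m (F n) z‖ ≤
        m.factorial * (c * (4 / δ) ^ m * (C₀ * M₀ ^ m * (m.factorial : ℝ) ^ (1 / k))) *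
          q ^ n := by
      intro m n z hz
      have hr := radius_pos k n
      have hs : 0 < δ / 4 * radius k n := by positivity
      have hsub : Metric.closedBall z (δ / 4 * radius k n) ⊆ stage k R η n := by
        intro w hw
        rw [Metric.mem_closedBall, dist_eq_norm] at hw
        by_cases hzr : ‖z‖ < radius k n / 2
        · left
          rw [mem_ball_zero_iff]
          have : ‖w‖ ≤ ‖z‖ + ‖w - z‖ := by
            simpa using norm_add_le z (w - z)
          nlinarith
        · right
          apply hball z hz
          rw [Metric.mem_ball, dist_eq_norm]
          refine hw.trans_lt ?_
          nlinarith [not_lt.1 hzr]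
      have h1 := Complex.norm_iteratedDeriv_le_of_forall_mem_sphere_norm_le m hs
        (((hF.1 n).mono hsub).diffContOnCl_ball subset_rfl)
        (fun w hw => hb n w (hsub (Metric.sphere_subset_closedBall hw)))
      refine h1.trans ?_
      have h2 := mul_le_mul_of_nonneg_left (hCM n m)
        (show 0 ≤ m.factorial * (c * (4 / δ) ^ m) by positivity)
      have h3 : (m.factorial : ℝ) * (c * ρ ^ n) / (δ / 4 * radius k n) ^ m =
          m.factorial * (c * (4 / δ) ^ m) * (ρ ^ n * (radius k n ^ m)⁻¹) := by
        rw [mul_pow, div_pow, div_pow]; field_simp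
      rw [h3]
      linarith
    have hder : ∀ m : ℕ, ∀ z ∈ sector k R' η',
        iteratedDeriv m f z = ∑' n, iteratedDeriv m (F n) z := by
      intro m
      induction m with
      | zero => intro z hz; simpa using (hF.2 z (hVS hz)).tsum_eq.symm
      | succ m ih =>
        intro z hz
        have h1 : iteratedDeriv m f =ᶠ[𝓝 z] fun w => ∑' n, iteratedDeriv m (F n) w := by
          filter_upwards [hVo.mem_nhds hz] with w hw using ih w hw
        rw [iteratedDeriv_succ, h1.deriv_eq]
        simp_rw [iteratedDeriv_succ]
        refine (Complex.hasSum_deriv_of_summable_norm (hgeo.mul_left _) (fun n => ?_) hVo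
          (fun n w hw => hcau m n w hw) hz).tsum_eq.symm
        rw [iteratedDeriv_eq_iterate]
        exact ((((hF.1 n).analyticOnNhd (isOpen_stage k R η n)).iterated_deriv m).mono
          (hVS.trans Set.subset_union_right)).differentiableOn
    refine ⟨(c + 1) * C₀ * ∑' n, q ^ n, 4 / δ * M₀, ?_, by positivity, fun m z hz => ?_⟩
    · have : 0 < ∑' n, q ^ n := hgeo.tsum_pos (fun n => by positivity) 0 (by simp)
      positivity
    have h0 : 0 ≤ ∑' n, q ^ n := tsum_nonneg fun n => by positivity
    have h1 : ‖iteratedDeriv m f z‖ ≤ m.factorial * (c * (4 / δ) ^ m *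
        (C₀ * M₀ ^ m * (m.factorial : ℝ) ^ (1 / k))) * ∑' n, q ^ n := by
      rw [hder m z hz, ← tsum_mul_left]
      exact tsum_of_norm_bounded (hgeo.mul_left _).hasSum fun n => hcau m n z hz
    rw [norm_div, Complex.norm_natCast, div_le_iff₀ (by positivity)]
    refine h1.trans ?_
    have h2 : 0 ≤ m.factorial * ((4 / δ) ^ m * (C₀ * M₀ ^ m * (m.factorial : ℝ) ^ (1 / k))) *
      ∑' n, q ^ n := by positivity
    rw [mul_pow]
    linarith
  -- a representative which is continuous on the closure of a smaller sector
  have hfg : ∀ z ∈ sector k R η, Function.update f 0 (a 0) z = f z := fun z hz =>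
    Function.update_of_ne (norm_pos_iff.1 hz.1) _ _
  refine ⟨R / 2, η / 2, Function.update f 0 (a 0), by positivity, by positivity, by linarith,
    ⟨?_, ?_, ⟨a, ?_⟩, ?_⟩, ?_⟩
  · exact (hfd.congr hfg).mono (sector_mono (by linarith) (by linarith))
  · intro z hz
    rcases closure_sector_subset (R := R) (η := η) (by linarith) (by linarith) hz with h | h
    · subst h
      have h1 : ∀ w ∈ closure (sector k (R / 2) (η / 2)),
          ‖Function.update f 0 (a 0) w - Function.update f 0 (a 0) 0‖ ≤
          (c * 2 ^ 1 * (C₀ * M₀ ^ 1 * (Nat.factorial 1 : ℝ) ^ (1 / k)) * ∑' n, q ^ n) *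
            ‖w‖ := by
        intro w hw
        rcases closure_sector_subset (R := R) (η := η) (by linarith) (by linarith) hw with h | h
        · rw [h]; simp
        · rw [hfg w h, Function.update_self]
          simpa using hasy 1 w h
      rw [ContinuousWithinAt, tendsto_iff_norm_sub_tendsto_zero]
      refine squeeze_zero' (Eventually.of_forall fun _ => norm_nonneg _)
        (eventually_nhdsWithin_of_forall h1) ?_
      refine Tendsto.mono_left ?_ nhdsWithin_le_nhds
      exact Continuous.tendsto' (by fun_prop) _ _ (by simp)
    · exact ((hfd.congr hfg).differentiableAt (hSo.mem_nhds h)).continuousAt.continuousWithinAt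
  · intro R' η' _ hR' _ hη' N
    refine ⟨c * 2 ^ N * (C₀ * M₀ ^ N * (N.factorial : ℝ) ^ (1 / k)) * ∑' n, q ^ n,
      fun z hz => ?_⟩
    have hz' : z ∈ sector k R η := sector_mono (by linarith) (by linarith) hz
    rw [hfg z hz']
    exact hasy N z hz'
  · intro R' η' h1 h2 h3 h4
    obtain ⟨C, M, hC, hM, hCM'⟩ := hgev R' η' h1 (by linarith) h3 (by linarith)
    refine ⟨C, M, hC, hM, fun m z hz => ?_⟩
    have hz' : z ∈ sector k R η := sector_mono (by linarith) (by linarith) hz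
    have : Function.update f 0 (a 0) =ᶠ[𝓝 z] f := by
      filter_upwards [hSo.mem_nhds hz'] with w hw using hfg w hw
    rw [this.iteratedDeriv_eq]
    exact hCM' m z hz
  · refine Germ.coe_eq.2 ?_
    filter_upwards [sector_mem hR hη] with z hz using (hfg z hz).symm

/-! ### The ring of Gevrey-analytic germs -/

lemma exists_isAdmissible {k : ℝ} (hk : 1 / 2 < k) : ∃ R ρ η : ℝ, IsAdmissible k R ρ η := by
  have h1 : Real.pi / (2 * k) < Real.pi := div_lt_self Real.pi_pos (by linarith)
  exact ⟨1, 1 / 2, (Real.pi - Real.pi / (2 * k)) / 2, by norm_num, by norm_num, by norm_num,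
    by linarith, by linarith⟩

lemma IsAdmissible.common {k R R' ρ ρ' η η' : ℝ} (h : IsAdmissible k R ρ η)
    (h' : IsAdmissible k R' ρ' η') : IsAdmissible k (min R R') (max ρ ρ') (min η η') :=
  ⟨lt_min h.1 h'.1, lt_max_of_lt_left h.2, max_lt h.3 h'.3, lt_min h.4 h'.4,
    (by gcongr; exact min_le_left _ _ : _ ≤ Real.pi / (2 * k) + η).trans_lt h.5⟩

lemma banachPiece_mono {k R R' ρ ρ' η η' μ μ' : ℝ} (hR : R' ≤ R) (hη : η' ≤ η) (hρ0 : 0 < ρ)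
    (hρ : ρ ≤ ρ') (hμ0 : 0 < μ') (hμ : μ' ≤ μ) (n : ℕ) :
    banachPiece k R ρ η μ n ⊆ banachPiece k R' ρ' η' μ' n := fun _ ⟨f, h1, h2, h3⟩ =>
  ⟨f, h1, h2, (seriesNorm_mono hR hη hρ0 hρ hμ0 hμ f).trans_lt h3⟩

lemma mem_banachPiece {k R ρ η μ : ℝ} (hk : 0 < k) (hα : IsAdmissible k R ρ η) (hμ : 0 < μ)
    {n : ℕ} {φ : MvPowerSeries (Fin n) (SectorGerm k)} (f : (Fin n →₀ ℕ) → ℂ → ℂ)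
    (h1 : ∀ ω, MvPowerSeries.coeff ω φ = (f ω : SectorGerm k))
    (h2 : seriesNorm k R ρ η μ f < ∞) : φ ∈ banachPiece k R ρ η μ n :=
  ⟨f, h1, fun ω => by
    rw [h1]; exact mem_gevreyGerms_of_norm hk hα (gevreyNorm_ne_top_of_series hμ h2 ω), h2⟩

lemma const_mem_banachPiece {k R ρ η μ : ℝ} (hk : 0 < k) (hα : IsAdmissible k R ρ η)
    (hμ : 0 < μ) (n : ℕ) (c : ℂ) :
    MvPowerSeries.C (σ := Fin n) ((fun _ => c : ℂ → ℂ) : SectorGerm k) ∈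
      banachPiece k R ρ η μ n := by
  classical
  refine mem_banachPiece hk hα hμ (fun ω _ => if ω = 0 then c else 0) (fun ω => ?_) ?_
  · rw [MvPowerSeries.coeff_C]
    split_ifs <;> rfl
  · rw [seriesNorm, tsum_eq_single 0]
    · refine ENNReal.mul_lt_top ((gevreyNorm_const_le _ _ _ _ _).trans_lt ?_) (by simp)
      simp
    · intro ω hω
      have := gevreyNorm_const_le k R ρ η 0
      rw [enorm_zero, nonpos_iff_eq_zero] at this
      simp [hω, this]

/-- The ring `𝒢{y_1, …, y_n}` of Gevrey-analytic germs of order `k`: the inductive limit (a directed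
union of rings of power series with coefficients in `𝒢_k`) of the Banach algebras
`𝒢_α{y_1, …, y_n}_μ` over `R > 0`, `0 < ρ < 1`, `η > 0` small and `μ > 0`. -/
def gevreyAnalytic (k : ℝ) (hk : 1 / 2 < k) (n : ℕ) :
    Subring (MvPowerSeries (Fin n) (SectorGerm k)) where
  carrier := {φ | ∃ R ρ η μ : ℝ, IsAdmissible k R ρ η ∧ 0 < μ ∧ φ ∈ banachPiece k R ρ η μ n}
  zero_mem' := by
    obtain ⟨R, ρ, η, hα⟩ := exists_isAdmissible hk
    refine ⟨R, ρ, η, 1, hα, one_pos, ?_⟩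
    have := const_mem_banachPiece (by linarith) hα one_pos n 0
    rwa [show ((fun _ => 0 : ℂ → ℂ) : SectorGerm k) = 0 from rfl, map_zero] at this
  one_mem' := by
    obtain ⟨R, ρ, η, hα⟩ := exists_isAdmissible hk
    refine ⟨R, ρ, η, 1, hα, one_pos, ?_⟩
    have := const_mem_banachPiece (by linarith) hα one_pos n 1
    rwa [show ((fun _ => 1 : ℂ → ℂ) : SectorGerm k) = 1 from rfl, map_one] at this
  neg_mem' := by
    rintro φ ⟨R, ρ, η, μ, hα, hμ, f, h1, -, h3⟩
    refine ⟨R, ρ, η, μ, hα, hμ, mem_banachPiece (by linarith) hα hμ (fun ω => -f ω)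
      (fun ω => ?_) (lt_of_le_of_lt ?_ h3)⟩
    · rw [map_neg, h1]; rfl
    · exact ENNReal.tsum_le_tsum fun ω => mul_le_mul' (gevreyNorm_neg_le _ _ _ _ _) le_rfl
  add_mem' := by
    rintro φ ψ ⟨R, ρ, η, μ, hα, hμ, hφ⟩ ⟨R', ρ', η', μ', hα', hμ', hψ⟩
    have hm := lt_min hμ hμ'
    obtain ⟨f, h1, -, h3⟩ := banachPiece_mono (min_le_left R R') (min_le_left η η') hα.2
      (le_max_left ρ ρ') hm (min_le_left μ μ') n hφ
    obtain ⟨g, g1, -, g3⟩ := banachPiece_mono (min_le_right R R') (min_le_right η η') hα'.2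
      (le_max_right ρ ρ') hm (min_le_right μ μ') n hψ
    refine ⟨_, _, _, _, hα.common hα', hm, mem_banachPiece (by linarith) (hα.common hα') hm
      (fun ω => f ω + g ω) (fun ω => ?_)
      ((seriesNorm_add_le _ _ _ _ _ _ _).trans_lt (ENNReal.add_lt_top.2 ⟨h3, g3⟩))⟩
    rw [map_add, h1, g1]; rfl
  mul_mem' := by
    rintro φ ψ ⟨R, ρ, η, μ, hα, hμ, hφ⟩ ⟨R', ρ', η', μ', hα', hμ', hψ⟩
    have hk0 : 0 < k := by linarith
    have hm := lt_min hμ hμ'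
    have hc := hα.common hα'
    obtain ⟨f, h1, -, h3⟩ := banachPiece_mono (min_le_left R R') (min_le_left η η') hα.2
      (le_max_left ρ ρ') hm (min_le_left μ μ') n hφ
    obtain ⟨g, g1, -, g3⟩ := banachPiece_mono (min_le_right R R') (min_le_right η η') hα'.2
      (le_max_right ρ ρ') hm (min_le_right μ μ') n hψ
    refine ⟨_, _, _, _, hc, hm, mem_banachPiece hk0 hc hm
      (fun ω => ∑ p ∈ Finset.HasAntidiagonal.antidiagonal ω, f p.1 * g p.2) (fun ω => ?_)
      ((seriesNorm_mul_le hk0 hc.2 hc.3 hm h3 g3).trans_lt (ENNReal.mul_lt_top h3 g3))⟩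
    rw [MvPowerSeries.coeff_mul]
    change _ = Germ.coeRingHom (sectorFilter k)
      (∑ p ∈ Finset.HasAntidiagonal.antidiagonal ω, f p.1 * g p.2)
    rw [map_sum]
    refine Finset.sum_congr rfl fun p _ => ?_
    rw [h1, g1]; rfl

end GevreyAnalytic

namespace GevreyAnalytic

open Filter Topology
open scoped ENNReal

/-! ### An injective multiplicative order on monomials -/

/-! The ring behaves like convergent power series in z and y, with the sector variable z as one more
parameter; the obstacle is that coefficients are only quasi-analytic, not convergent in z. What
replaces convergence is abstracted in `NormSystem`: complete norms decreasing in an index j, a value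
at z = 0, bounded division by z of elements of value 0 (at the price of a larger index), norms of z
tending to 0, and the fact that only 0 is divisible by all powers of z. For Gevrey germs this last
property is Watson's lemma (`eqOn_zero_of_flat`): the sectors have opening larger than π/k, so a
function flat of Gevrey order k vanishes, by Phragmén–Lindelöf.

Over such a system one proves a Hironaka-type division theorem (`exists_division`). Monomials are
ordered by the integers ∏ p_i^{ω_i}, an injective multiplicative index, and series are measured by ∑
‖f_ω‖_j M(ω)^{-t}. If the value of g_i has leading monomial y^{β_i}, the one of least index, with
coefficient 1, then y^{β_i} - g_i is small compared with M(β_i)^{-t}: large t makes the higher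
monomials negligible, and then large j does the same for the finitely many lower ones, whose
coefficients have value 0. Division by the g_i is thus a small perturbation of division by
monomials, and is solved by a Neumann series.

Division by a series with nonzero constant value shows that the ring is local; division by the
variables shows that z, y_1, …, y_n generate the maximal ideal, so the dimension is at most n + 1.
The prime ideals (y_1, …, y_d), followed by the maximal ideal, form a chain of length n + 1, which
gives the dimension and regularity.

For Noetherianity, by Cohen's theorem only a prime P matters. Dickson's lemma selects finitely many
elements of P whose leading exponents dominate all others; the remainder of any element of P is then
divisible by z. If z lies in P, it completes a generating set. If not, primality allows dividing by
z forever, and the remainder is 0 because no nonzero element is infinitely divisible by z. -/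

/-- The integer `∏ p_i ^ ω_i`, where `p_0, p_1, …` are the primes. It orders the monomials. -/
noncomputable def monomialIndex {n : ℕ} (ω : Fin n →₀ ℕ) : ℕ :=
  ω.prod fun i e => Nat.nth Nat.Prime i ^ e

lemma prime_nth (i : ℕ) : (Nat.nth Nat.Prime i).Prime :=
  Nat.nth_mem_of_infinite Nat.infinite_setOfPred_prime i

@[simp] lemma monomialIndex_zero {n : ℕ} : monomialIndex (0 : Fin n →₀ ℕ) = 1 := by
  simp [monomialIndex]

lemma monomialIndex_add {n : ℕ} (a b : Fin n →₀ ℕ) :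
    monomialIndex (a + b) = monomialIndex a * monomialIndex b :=
  Finsupp.prod_add_index' (by simp) (by intros; rw [pow_add])

lemma monomialIndex_pos {n : ℕ} (ω : Fin n →₀ ℕ) : 0 < monomialIndex ω :=
  Finset.prod_pos fun i _ => pow_pos (prime_nth i).pos _

/-- Unique factorization: the exponent of the i-th prime recovers ω_i. Injectivity makes the index a
strict total order on monomials, so leading monomials are unique. -/
lemma monomialIndex_injective {n : ℕ} : Function.Injective (monomialIndex (n := n)) := by
  let e : Fin n ↪ ℕ := ⟨fun i => Nat.nth Nat.Prime i, fun i j h => Fin.ext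
    (Nat.nth_injective Nat.infinite_setOfPred_prime h)⟩
  have h : ∀ ω : Fin n →₀ ℕ, (monomialIndex ω).factorization = ω.embDomain e := by
    intro ω
    have h1 : monomialIndex ω = (ω.embDomain e).prod (· ^ ·) := by
      rw [Finsupp.prod_embDomain]; rfl
    rw [h1]
    refine Nat.prod_pow_factorization_eq_self fun p hp => ?_
    rw [Finsupp.support_embDomain, Finset.mem_map] at hp
    obtain ⟨i, -, rfl⟩ := hp
    exact prime_nth i
  intro a b hab
  exact Finsupp.embDomain_injective e (by rw [← h, ← h, hab])

/-- Only finitely many monomials precede a given one. Their coefficients can therefore be made small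
simultaneously by increasing the index of the norm. -/
lemma finite_monomialIndex_le {n : ℕ} (B : ℕ) :
    {ω : Fin n →₀ ℕ | monomialIndex ω ≤ B}.Finite :=
  (Set.finite_Iic B).preimage monomialIndex_injective.injOn

lemma monomialIndex_eq_prod {n : ℕ} (ω : Fin n →₀ ℕ) :
    monomialIndex ω = ∏ i : Fin n, Nat.nth Nat.Prime i ^ ω i :=
  Finsupp.prod_fintype _ _ (by simp)

lemma degree_eq_univ_sum {n : ℕ} (ω : Fin n →₀ ℕ) : ω.degree = ∑ i, ω i := by
  rw [Finsupp.degree_eq_sum]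

lemma two_pow_degree_le {n : ℕ} (ω : Fin n →₀ ℕ) : 2 ^ ω.degree ≤ monomialIndex ω := by
  rw [monomialIndex_eq_prod, degree_eq_univ_sum, ← Finset.prod_pow_eq_pow_sum]
  exact Finset.prod_le_prod' fun i _ => Nat.pow_le_pow_left (prime_nth i).two_le _

lemma monomialIndex_le_pow_degree {n : ℕ} (ω : Fin n →₀ ℕ) :
    monomialIndex ω ≤ Nat.nth Nat.Prime n ^ ω.degree := by
  rw [monomialIndex_eq_prod, degree_eq_univ_sum, ← Finset.prod_pow_eq_pow_sum]
  exact Finset.prod_le_prod' fun i _ => Nat.pow_le_pow_left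
    (Nat.nth_monotone Nat.infinite_setOfPred_prime i.2.le) _

/-- The weight `M(ω)^{-t}` of a monomial. -/
noncomputable def weight (t : ℕ) {n : ℕ} (ω : Fin n →₀ ℕ) : ℝ≥0∞ :=
  (monomialIndex ω : ℝ≥0∞)⁻¹ ^ t

@[simp] lemma weight_zero (t n : ℕ) : weight t (0 : Fin n →₀ ℕ) = 1 := by simp [weight]

lemma weight_add (t : ℕ) {n : ℕ} (a b : Fin n →₀ ℕ) :
    weight t (a + b) = weight t a * weight t b := by
  rw [weight, weight, weight, ← mul_pow, monomialIndex_add, Nat.cast_mul,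
    ENNReal.mul_inv (Or.inr (by simp)) (Or.inl (by simp))]

lemma weight_ne_zero (t : ℕ) {n : ℕ} (ω : Fin n →₀ ℕ) : weight t ω ≠ 0 := by
  simp [weight]

lemma weight_ne_top (t : ℕ) {n : ℕ} (ω : Fin n →₀ ℕ) : weight t ω ≠ ∞ := by
  have := (monomialIndex_pos ω).ne'
  refine ENNReal.pow_ne_top ?_
  simpa using this

lemma weight_anti {n : ℕ} (ω : Fin n →₀ ℕ) {s t : ℕ} (h : s ≤ t) : weight t ω ≤ weight s ω := by
  refine pow_le_pow_right_of_le_one' (ENNReal.inv_le_one.2 ?_) h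
  exact_mod_cast monomialIndex_pos ω

/-! ### Rings with a decreasing sequence of complete norms -/

/-- A decreasing sequence of complete submultiplicative norms, with values in `[0, ∞]`, on a ring
`K`. The elements of finite norm have a value in the field `𝕜`, and those of value `0` are
divisible by a parameter whose norms tend to `0`, the division being bounded. -/
structure NormSystem (𝕜 K : Type*) [Field 𝕜] [CommRing K] where
  norm : ℕ → K → ℝ≥0∞
  scalar : 𝕜 →+* K
  eval : K → 𝕜
  param : K
  norm_anti : ∀ {i j : ℕ}, i ≤ j → ∀ a, norm j a ≤ norm i a
  norm_scalar : ∀ j c, norm j (scalar c) ≠ ∞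
  norm_zero : ∀ j, norm j 0 = 0
  norm_neg_le : ∀ j a, norm j (-a) ≤ norm j a
  norm_add_le : ∀ j a b, norm j (a + b) ≤ norm j a + norm j b
  norm_mul_le : ∀ {j a b}, norm j a ≠ ∞ → norm j b ≠ ∞ → norm j (a * b) ≤ norm j a * norm j b
  eq_zero_of_norm : ∀ {j a}, norm j a = 0 → a = 0
  complete : ∀ {j} {a : ℕ → K}, ∑' i, norm j (a i) ≠ ∞ →
    ∃ s, ∀ m, norm j (s - ∑ i ∈ Finset.range m, a i) ≤ ∑' i, norm j (a (i + m))
  eval_scalar : ∀ c, eval (scalar c) = c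
  eval_add : ∀ {j a b}, norm j a ≠ ∞ → norm j b ≠ ∞ → eval (a + b) = eval a + eval b
  eval_mul : ∀ {j a b}, norm j a ≠ ∞ → norm j b ≠ ∞ → eval (a * b) = eval a * eval b
  eval_param : eval param = 0
  norm_param : ∀ j, norm j param ≠ ∞
  param_mul_eq_zero : ∀ {a}, param * a = 0 → a = 0
  tendsto_norm_param : Tendsto (fun j => norm j param) atTop (𝓝 0)
  exists_div : ∀ j, ∃ (i : ℕ) (C : ℝ≥0∞), C ≠ ∞ ∧ ∀ a, norm j a ≠ ∞ → eval a = 0 →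
    ∃ b, a = param * b ∧ norm i b ≤ C * norm j a
  separated : ∀ {j a}, norm j a ≠ ∞ →
    (∀ m : ℕ, ∃ b i, norm i b ≠ ∞ ∧ a = param ^ m * b) → a = 0

namespace NormSystem

variable {𝕜 K : Type*} [Field 𝕜] [CommRing K] (N : NormSystem 𝕜 K) {n : ℕ}

lemma norm_neg (j : ℕ) (a : K) : N.norm j (-a) = N.norm j a :=
  le_antisymm (N.norm_neg_le j a) (by simpa using N.norm_neg_le j (-a))

lemma norm_sum_le (j : ℕ) {ι : Type*} (s : Finset ι) (a : ι → K) :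
    N.norm j (∑ i ∈ s, a i) ≤ ∑ i ∈ s, N.norm j (a i) := by
  classical
  induction s using Finset.induction_on with
  | empty => simp [N.norm_zero]
  | insert i s hi ih =>
    rw [Finset.sum_insert hi, Finset.sum_insert hi]
    exact (N.norm_add_le _ _ _).trans (add_le_add le_rfl ih)

lemma eval_zero : N.eval 0 = 0 := by simpa using N.eval_scalar 0

lemma eval_one : N.eval 1 = 1 := by simpa using N.eval_scalar 1

lemma norm_one (j : ℕ) : N.norm j 1 ≠ ∞ := by simpa using N.norm_scalar j 1

lemma eval_neg {j : ℕ} {a : K} (h : N.norm j a ≠ ∞) : N.eval (-a) = -N.eval a := by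
  have := N.eval_add h (by rwa [N.norm_neg] : N.norm j (-a) ≠ ∞)
  rw [add_neg_cancel, eval_zero] at this
  exact (neg_eq_of_add_eq_zero_right this.symm).symm

/-- An element of value 0 is z b with b of finite norm, and its norms are at most ‖z‖ ‖b‖, where the
first factor tends to 0 and the second stays bounded. -/
lemma tendsto_norm_of_eval {j : ℕ} {a : K} (ha : N.norm j a ≠ ∞) (h0 : N.eval a = 0) :
    Tendsto (fun j => N.norm j a) atTop (𝓝 0) := by
  obtain ⟨i, C, hC, h⟩ := N.exists_div j
  obtain ⟨b, rfl, hb⟩ := h a ha h0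
  have hb' : N.norm i b ≠ ∞ := ne_top_of_le_ne_top (ENNReal.mul_ne_top hC ha) hb
  have h1 : Tendsto (fun j => N.norm j N.param * N.norm i b) atTop (𝓝 0) := by
    simpa using ENNReal.Tendsto.mul_const N.tendsto_norm_param (Or.inr hb')
  refine tendsto_of_tendsto_of_tendsto_of_le_of_le' tendsto_const_nhds h1
    (Eventually.of_forall fun _ => zero_le) ?_
  filter_upwards [eventually_ge_atTop i] with l hl
  have h2 := N.norm_anti hl b
  exact (N.norm_mul_le (N.norm_param l) (ne_top_of_le_ne_top hb' h2)).trans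
    (mul_le_mul' le_rfl h2)

/-! ### Convergent power series -/

/-- The norm `∑ ‖φ_ω‖_j M(ω)^{-t}` of a power series. -/
noncomputable def wnorm (j t : ℕ) (φ : MvPowerSeries (Fin n) K) : ℝ≥0∞ :=
  ∑' ω, N.norm j (MvPowerSeries.coeff ω φ) * weight t ω

lemma wnorm_anti {i j s t : ℕ} (hij : i ≤ j) (hst : s ≤ t) (φ : MvPowerSeries (Fin n) K) :
    N.wnorm j t φ ≤ N.wnorm i s φ :=
  ENNReal.tsum_le_tsum fun ω => mul_le_mul' (N.norm_anti hij _) (weight_anti ω hst)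

lemma wnorm_add_le (j t : ℕ) (φ ψ : MvPowerSeries (Fin n) K) :
    N.wnorm j t (φ + ψ) ≤ N.wnorm j t φ + N.wnorm j t ψ := by
  rw [wnorm, wnorm, wnorm, ← ENNReal.tsum_add]
  refine ENNReal.tsum_le_tsum fun ω => ?_
  rw [← add_mul, map_add]
  exact mul_le_mul' (N.norm_add_le _ _ _) le_rfl

lemma wnorm_neg (j t : ℕ) (φ : MvPowerSeries (Fin n) K) : N.wnorm j t (-φ) = N.wnorm j t φ := by
  simp [wnorm, N.norm_neg]

@[simp] lemma wnorm_zero (j t : ℕ) : N.wnorm j t (0 : MvPowerSeries (Fin n) K) = 0 := by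
  simp [wnorm, N.norm_zero]

lemma wnorm_sum_le (j t : ℕ) {ι : Type*} (s : Finset ι) (a : ι → MvPowerSeries (Fin n) K) :
    N.wnorm j t (∑ i ∈ s, a i) ≤ ∑ i ∈ s, N.wnorm j t (a i) := by
  classical
  induction s using Finset.induction_on with
  | empty => simp
  | insert i s hi ih =>
    rw [Finset.sum_insert hi, Finset.sum_insert hi]
    exact (N.wnorm_add_le _ _ _ _).trans (add_le_add le_rfl ih)

lemma coeff_mul_weight_le (j t : ℕ) (φ : MvPowerSeries (Fin n) K) (ω : Fin n →₀ ℕ) :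
    N.norm j (MvPowerSeries.coeff ω φ) * weight t ω ≤ N.wnorm j t φ :=
  ENNReal.le_tsum ω

lemma norm_coeff_ne_top {j t : ℕ} {φ : MvPowerSeries (Fin n) K} (h : N.wnorm j t φ ≠ ∞)
    (ω : Fin n →₀ ℕ) : N.norm j (MvPowerSeries.coeff ω φ) ≠ ∞ := by
  intro h1
  have h2 := N.coeff_mul_weight_le j t φ ω
  rw [h1, ENNReal.top_mul (weight_ne_zero t ω), top_le_iff] at h2
  exact h h2

lemma eq_zero_of_wnorm {j t : ℕ} {φ : MvPowerSeries (Fin n) K} (h : N.wnorm j t φ = 0) :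
    φ = 0 := by
  ext ω
  have := N.coeff_mul_weight_le j t φ ω
  rw [h, nonpos_iff_eq_zero, mul_eq_zero] at this
  simpa using N.eq_zero_of_norm (this.resolve_right (weight_ne_zero t ω))

lemma wnorm_monomial (j t : ℕ) (β : Fin n →₀ ℕ) (a : K) :
    N.wnorm j t (MvPowerSeries.monomial β a) = N.norm j a * weight t β := by
  classical
  rw [wnorm, tsum_eq_single β]
  · rw [MvPowerSeries.coeff_monomial_same]
  · intro ω hω
    rw [MvPowerSeries.coeff_monomial_ne hω, N.norm_zero, zero_mul]

lemma wnorm_mul_le {j t : ℕ} {φ ψ : MvPowerSeries (Fin n) K} (hφ : N.wnorm j t φ ≠ ∞)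
    (hψ : N.wnorm j t ψ ≠ ∞) : N.wnorm j t (φ * ψ) ≤ N.wnorm j t φ * N.wnorm j t ψ := by
  classical
  set f := fun ω => N.norm j (MvPowerSeries.coeff ω φ) * weight t ω with hf
  set g := fun ω => N.norm j (MvPowerSeries.coeff ω ψ) * weight t ω with hg
  have h1 : N.wnorm j t φ * N.wnorm j t ψ = ∑' a, ∑' b, f a * g b := by
    simp_rw [ENNReal.tsum_mul_left, ENNReal.tsum_mul_right]; rfl
  rw [h1, ← ENNReal.tsum_prod (f := fun a b => f a * g b),
    ← Finset.HasAntidiagonal.sigmaAntidiagonalEquivProd.tsum_eq, ENNReal.tsum_sigma']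
  refine ENNReal.tsum_le_tsum fun ω => ?_
  rw [tsum_fintype, MvPowerSeries.coeff_mul]
  refine le_trans ?_ (le_of_eq (Finset.sum_coe_sort (Finset.HasAntidiagonal.antidiagonal ω)
    (fun p : (Fin n →₀ ℕ) × (Fin n →₀ ℕ) => f p.1 * g p.2)).symm)
  refine (mul_le_mul' (N.norm_sum_le _ _ _) le_rfl).trans ?_
  rw [Finset.sum_mul]
  refine Finset.sum_le_sum fun p hp => ?_
  refine (mul_le_mul' (N.norm_mul_le (N.norm_coeff_ne_top hφ _)
    (N.norm_coeff_ne_top hψ _)) le_rfl).trans (le_of_eq ?_)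
  rw [← Finset.HasAntidiagonal.mem_antidiagonal.1 hp, weight_add, hf, hg]
  ring

lemma wnorm_mul_ne_top {j t : ℕ} {φ ψ : MvPowerSeries (Fin n) K} (hφ : N.wnorm j t φ ≠ ∞)
    (hψ : N.wnorm j t ψ ≠ ∞) : N.wnorm j t (φ * ψ) ≠ ∞ :=
  ne_top_of_le_ne_top (ENNReal.mul_ne_top hφ hψ) (N.wnorm_mul_le hφ hψ)

lemma wnorm_sub_le (j t : ℕ) (φ ψ : MvPowerSeries (Fin n) K) :
    N.wnorm j t (φ - ψ) ≤ N.wnorm j t φ + N.wnorm j t ψ := by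
  rw [sub_eq_add_neg, ← N.wnorm_neg j t ψ]; exact N.wnorm_add_le _ _ _ _

/-- The power series all of whose coefficients are bounded in one norm, with a positive radius of
convergence. -/
noncomputable def convergent (n : ℕ) : Subring (MvPowerSeries (Fin n) K) where
  carrier := {φ | ∃ j t, N.wnorm j t φ ≠ ∞}
  zero_mem' := ⟨0, 0, by simp⟩
  one_mem' := ⟨0, 0, by
    rw [← MvPowerSeries.monomial_zero_one, wnorm_monomial]; simpa using N.norm_one 0⟩
  neg_mem' := fun ⟨j, t, h⟩ => ⟨j, t, by rwa [wnorm_neg]⟩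
  add_mem' := by
    rintro φ ψ ⟨j, t, h⟩ ⟨i, s, h'⟩
    refine ⟨max j i, max t s, ne_top_of_le_ne_top (ENNReal.add_ne_top.2 ⟨?_, ?_⟩)
      (N.wnorm_add_le _ _ _ _)⟩
    · exact ne_top_of_le_ne_top h (N.wnorm_anti (le_max_left _ _) (le_max_left _ _) φ)
    · exact ne_top_of_le_ne_top h' (N.wnorm_anti (le_max_right _ _) (le_max_right _ _) ψ)
  mul_mem' := by
    rintro φ ψ ⟨j, t, h⟩ ⟨i, s, h'⟩
    refine ⟨max j i, max t s, N.wnorm_mul_ne_top ?_ ?_⟩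
    · exact ne_top_of_le_ne_top h (N.wnorm_anti (le_max_left _ _) (le_max_left _ _) φ)
    · exact ne_top_of_le_ne_top h' (N.wnorm_anti (le_max_right _ _) (le_max_right _ _) ψ)

variable {N}

lemma eventually_wnorm_ne_top {φ : MvPowerSeries (Fin n) K} (h : φ ∈ N.convergent n) :
    ∀ᶠ t in atTop, ∀ᶠ j in atTop, N.wnorm j t φ ≠ ∞ := by
  obtain ⟨j, t, h⟩ := h
  filter_upwards [eventually_ge_atTop t] with t' ht
  filter_upwards [eventually_ge_atTop j] with j' hj
  exact ne_top_of_le_ne_top h (N.wnorm_anti hj ht φ)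

lemma monomial_mem (β : Fin n →₀ ℕ) {j : ℕ} {a : K} (ha : N.norm j a ≠ ∞) :
    MvPowerSeries.monomial β a ∈ N.convergent n :=
  ⟨j, 0, by rw [wnorm_monomial]; exact ENNReal.mul_ne_top ha (weight_ne_top _ _)⟩

lemma C_mem {j : ℕ} {a : K} (ha : N.norm j a ≠ ∞) :
    MvPowerSeries.C (σ := Fin n) a ∈ N.convergent n :=
  monomial_mem 0 ha

variable (N)

/-- Completeness of the space of power series of finite norm. -/
lemma wnorm_complete {j t : ℕ} {a : ℕ → MvPowerSeries (Fin n) K}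
    (h : ∑' i, N.wnorm j t (a i) ≠ ∞) : ∃ s, ∀ m,
      N.wnorm j t (s - ∑ i ∈ Finset.range m, a i) ≤ ∑' i, N.wnorm j t (a (i + m)) := by
  have h1 : ∀ ω, ∑' i, N.norm j (MvPowerSeries.coeff ω (a i)) ≠ ∞ := by
    intro ω h1
    have h2 : (∑' i, N.norm j (MvPowerSeries.coeff ω (a i))) * weight t ω ≤
        ∑' i, N.wnorm j t (a i) := by
      rw [← ENNReal.tsum_mul_right]
      exact ENNReal.tsum_le_tsum fun i => N.coeff_mul_weight_le j t (a i) ω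
    rw [h1, ENNReal.top_mul (weight_ne_zero t ω), top_le_iff] at h2
    exact h h2
  -- The limit is taken coefficient by coefficient; the tail estimates, summed over ω, give the
  -- estimate for the whole series after an exchange of sums.
  choose s hs using fun ω => N.complete (h1 ω)
  let φ : MvPowerSeries (Fin n) K := s
  have hφ : ∀ ω, MvPowerSeries.coeff ω φ = s ω := fun ω => rfl
  refine ⟨φ, fun m => ?_⟩
  unfold wnorm
  rw [ENNReal.tsum_comm]
  refine ENNReal.tsum_le_tsum fun ω => ?_
  rw [ENNReal.tsum_mul_right, map_sub, map_sum, hφ]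
  exact mul_le_mul' (hs ω m) le_rfl

/-- A perturbation of the identity by a contraction is surjective. -/
lemma exists_sub_contraction_eq {j t : ℕ}
    (T : MvPowerSeries (Fin n) K →+ MvPowerSeries (Fin n) K)
    (hT : ∀ φ, N.wnorm j t φ ≠ ∞ → N.wnorm j t (T φ) ≤ 2⁻¹ * N.wnorm j t φ)
    {f : MvPowerSeries (Fin n) K} (hf : N.wnorm j t f ≠ ∞) :
    ∃ F, N.wnorm j t F ≠ ∞ ∧ F - T F = f := by
  -- The solution is the Neumann series ∑ T^m f, dominated by a geometric series of ratio 1/2.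
  set a : ℕ → MvPowerSeries (Fin n) K := fun m => T^[m] f with ha
  have hsucc : ∀ m, a (m + 1) = T (a m) := fun m => Function.iterate_succ_apply' _ _ _
  have ha1 : ∀ m, N.wnorm j t (a m) ≤ 2⁻¹ ^ m * N.wnorm j t f := by
    intro m
    induction m with
    | zero => simp [ha]
    | succ m ih =>
      rw [hsucc, pow_succ', mul_assoc]
      refine (hT _ (ne_top_of_le_ne_top (ENNReal.mul_ne_top (by simp) hf) ih)).trans ?_
      gcongr
  have hsum : ∑' i, N.wnorm j t (a i) ≠ ∞ := by
    refine ne_top_of_le_ne_top ?_ (ENNReal.tsum_le_tsum ha1)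
    rw [ENNReal.tsum_mul_right, ENNReal.tsum_geometric]
    exact ENNReal.mul_ne_top (by simp) hf
  obtain ⟨F, hF⟩ := N.wnorm_complete hsum
  set S : ℕ → MvPowerSeries (Fin n) K := fun m => ∑ i ∈ Finset.range m, a i with hS
  have hSsucc : ∀ m, S (m + 1) = f + T (S m) := by
    intro m
    rw [hS]
    simp only
    rw [Finset.sum_range_succ', map_sum, add_comm]
    simp only [hsucc]
    rfl
  have htail : ∀ m, ∑' i, N.wnorm j t (a (i + m)) ≠ ∞ := fun m =>
    ne_top_of_le_ne_top hsum (ENNReal.tsum_comp_le_tsum_of_injective (add_left_injective m) _)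
  have h0 : Tendsto (fun m => ∑' i, N.wnorm j t (a (i + m))) atTop (𝓝 0) :=
    ENNReal.tendsto_sum_nat_add _ hsum
  refine ⟨F, ?_, ?_⟩
  · have := hF 0
    simp only [Finset.range_zero, Finset.sum_empty, sub_zero, add_zero] at this
    exact ne_top_of_le_ne_top hsum this
  rw [← sub_eq_zero]
  apply N.eq_zero_of_wnorm (j := j) (t := t)
  -- With S_m the partial sums and S_{m+1} = f + T S_m, the defect F - T F - f equals (F - S_{m+1})
  -- - T (F - S_m). Both terms are bounded by tails of a convergent series, so no continuity of T
  -- beyond the contraction bound is needed.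
  have key : ∀ m, N.wnorm j t (F - T F - f) ≤ ∑' i, N.wnorm j t (a (i + (m + 1))) +
      ∑' i, N.wnorm j t (a (i + m)) := by
    intro m
    have e : F - T F - f = (F - S (m + 1)) - T (F - S m) := by
      rw [hSsucc, map_sub]; abel
    rw [e]
    refine (N.wnorm_sub_le _ _ _ _).trans (add_le_add (hF _) ?_)
    refine (hT _ (ne_top_of_le_ne_top (htail m) (hF m))).trans ((mul_le_mul' ?_ (hF m)).trans
      (one_mul _).le)
    simp
  have hlim := (h0.comp (tendsto_add_atTop_nat 1)).add h0
  rw [add_zero] at hlim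
  exact nonpos_iff_eq_zero.1 (ge_of_tendsto' hlim key)

/-- Passing from the weight M(ω)^{-t} to M(ω)^{-(t+s)} gains at least (B+1)^{-s} on every monomial
of index greater than B, because the index is an integer. -/
lemma tsum_tail_le {h : MvPowerSeries (Fin n) K} {i j : ℕ} (hij : i ≤ j) (t s B : ℕ)
    {S : Finset (Fin n →₀ ℕ)} (hS : ∀ ω, ω ∉ S → B < monomialIndex ω) :
    ∑' ω : ((S : Set (Fin n →₀ ℕ))ᶜ : Set (Fin n →₀ ℕ)), N.norm j (MvPowerSeries.coeff ω.1 h) * weight (t + s) ω.1 ≤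
      N.wnorm i t h * ((B + 1 : ℕ) : ℝ≥0∞)⁻¹ ^ s := by
  have hterm : ∀ ω : ((S : Set (Fin n →₀ ℕ))ᶜ : Set (Fin n →₀ ℕ)), N.norm j (MvPowerSeries.coeff ω.1 h) * weight (t + s) ω.1 ≤
      N.norm i (MvPowerSeries.coeff ω.1 h) * weight t ω.1 * ((B + 1 : ℕ) : ℝ≥0∞)⁻¹ ^ s := by
    intro ω
    have h2 : B + 1 ≤ monomialIndex ω.1 := hS _ ω.2
    have h3 : weight (t + s) ω.1 = weight t ω.1 * weight s ω.1 := pow_add _ _ _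
    rw [h3, ← mul_assoc]
    refine mul_le_mul' (mul_le_mul' (N.norm_anti hij _) le_rfl) ?_
    exact pow_le_pow_left' (ENNReal.inv_le_inv.2 (Nat.cast_le.2 h2)) s
  refine (ENNReal.tsum_le_tsum hterm).trans ?_
  rw [ENNReal.tsum_mul_right]
  exact mul_le_mul' (ENNReal.tsum_comp_le_tsum_of_injective Subtype.val_injective
      (fun ω => N.norm i (MvPowerSeries.coeff ω h) * weight t ω)) le_rfl

/-- The gain (B+1)^{-s} of the tail beats the target B^{-(t+s)}, since (B/(B+1))^s tends to 0. This
is where the strict inequality between indices pays off. -/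
lemma eventually_tail_le {B : ℕ} (hB : 0 < B) (t : ℕ) {a δ : ℝ≥0∞} (ha : a ≠ ∞) (hδ : δ ≠ 0) :
    ∀ᶠ s in atTop, a * ((B + 1 : ℕ) : ℝ≥0∞)⁻¹ ^ s ≤ δ * (B : ℝ≥0∞)⁻¹ ^ (t + s) := by
  set q : ℝ≥0∞ := (B : ℝ≥0∞) * ((B + 1 : ℕ) : ℝ≥0∞)⁻¹ with hq
  have hq1 : q < 1 := by
    rw [hq, ← div_eq_mul_inv]
    refine ENNReal.div_lt_of_lt_mul ?_
    rw [one_mul]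
    exact_mod_cast Nat.lt_succ_self B
  have hlim : Tendsto (fun s : ℕ => q ^ s * ((B : ℝ≥0∞) ^ t * a)) atTop (𝓝 0) := by
    have := ENNReal.Tendsto.mul_const (ENNReal.tendsto_pow_atTop_nhds_zero_of_lt_one hq1)
      (b := (B : ℝ≥0∞) ^ t * a) (Or.inr (ENNReal.mul_ne_top (by simp) ha))
    rwa [zero_mul] at this
  filter_upwards [hlim.eventually (ge_mem_nhds (pos_iff_ne_zero.2 hδ))] with s hs
  refine le_trans (le_of_eq ?_) (mul_le_mul' hs le_rfl)
  have hBB : ∀ m : ℕ, (B : ℝ≥0∞) ^ m * (B : ℝ≥0∞)⁻¹ ^ m = 1 := fun m => by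
    rw [← mul_pow, ENNReal.mul_inv_cancel (by simpa using hB.ne') (by simp), one_pow]
  rw [hq, mul_pow, pow_add]
  calc _ = a * ((B + 1 : ℕ) : ℝ≥0∞)⁻¹ ^ s * 1 * 1 := by rw [mul_one, mul_one]
    _ = a * ((B + 1 : ℕ) : ℝ≥0∞)⁻¹ ^ s * ((B : ℝ≥0∞) ^ t * (B : ℝ≥0∞)⁻¹ ^ t) *
      ((B : ℝ≥0∞) ^ s * (B : ℝ≥0∞)⁻¹ ^ s) := by rw [hBB, hBB]
    _ = _ := by ring

/-- A series whose monomials of index at most `M(β)` have coefficients of value `0` is small with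
respect to `M(β)^{-t}`, if first `t` and then `j` is large. -/
lemma eventually_wnorm_le {h : MvPowerSeries (Fin n) K} (hh : h ∈ N.convergent n) {β : Fin n →₀ ℕ}
    (h0 : ∀ ω, monomialIndex ω ≤ monomialIndex β → N.eval (MvPowerSeries.coeff ω h) = 0)
    {δ : ℝ≥0∞} (hδ : δ ≠ 0) :
    ∀ᶠ t in atTop, ∀ᶠ j in atTop, N.wnorm j t h ≤ δ * weight t β := by
  obtain ⟨i, t₁, hfin⟩ := hh
  have hδ2 : δ / 2 ≠ 0 := by simpa using hδ
  obtain ⟨S, hS⟩ : ∃ S : Finset (Fin n →₀ ℕ), ∀ ω, ω ∈ S ↔ monomialIndex ω ≤ monomialIndex β :=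
    ⟨(finite_monomialIndex_le (monomialIndex β)).toFinset, fun ω => by simp⟩
  obtain ⟨s₀, hs₀⟩ := eventually_atTop.1
    (eventually_tail_le (monomialIndex_pos β) t₁ hfin hδ2)
  -- The exponent t is fixed first and controls the tail uniformly in large j; only then is j
  -- increased, to shrink the finite sum over indices at most M(β). Each part receives half of δ.
  filter_upwards [eventually_ge_atTop (t₁ + s₀)] with t ht
  obtain ⟨s, rfl⟩ : ∃ s, t = t₁ + s := ⟨t - t₁, by omega⟩
  have hfinite : Tendsto (fun j => ∑ ω ∈ S, N.norm j (MvPowerSeries.coeff ω h) *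
      weight (t₁ + s) ω) atTop (𝓝 (∑ ω ∈ S, 0 * weight (t₁ + s) ω)) :=
    tendsto_finsetSum _ fun ω hω => ENNReal.Tendsto.mul_const
      (N.tendsto_norm_of_eval (N.norm_coeff_ne_top hfin ω) (h0 ω ((hS ω).1 hω)))
      (Or.inr (weight_ne_top _ _))
  simp only [zero_mul, Finset.sum_const_zero] at hfinite
  have hpos : 0 < δ / 2 * weight (t₁ + s) β := ENNReal.mul_pos hδ2 (weight_ne_zero _ _)
  filter_upwards [eventually_ge_atTop i, hfinite.eventually (ge_mem_nhds hpos)] with j hj hj'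
  rw [wnorm, ← ENNReal.sum_add_tsum_compl S, ← ENNReal.add_halves δ, add_mul]
  exact add_le_add hj' ((N.tsum_tail_le hj t₁ s (monomialIndex β)
    fun ω hω => not_le.1 (mt (hS ω).2 hω)).trans (hs₀ s (by omega)))

end NormSystem

/-! ### Division with remainder by finitely many series. -/

namespace NormSystem

variable {𝕜 K : Type*} [Field 𝕜] [CommRing K] (N : NormSystem 𝕜 K) {n : ℕ}

open Classical in
/-- The part of a power series with exponents in `S`, divided by `y^β`. -/
noncomputable def partialQuotient (β : Fin n →₀ ℕ) (S : Set (Fin n →₀ ℕ)) :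
    MvPowerSeries (Fin n) K →+ MvPowerSeries (Fin n) K where
  toFun φ := fun ω => if ω + β ∈ S then MvPowerSeries.coeff (ω + β) φ else 0
  map_zero' := by
    ext ω
    change (if ω + β ∈ S then MvPowerSeries.coeff (ω + β) (0 : MvPowerSeries (Fin n) K) else 0) = 0
    simp
  map_add' φ ψ := by
    ext ω
    change (if ω + β ∈ S then MvPowerSeries.coeff (ω + β) (φ + ψ) else 0) =
      (if ω + β ∈ S then MvPowerSeries.coeff (ω + β) φ else 0) +
      (if ω + β ∈ S then MvPowerSeries.coeff (ω + β) ψ else 0)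
    split_ifs <;> simp

open Classical in
lemma coeff_partialQuotient (β : Fin n →₀ ℕ) (S : Set (Fin n →₀ ℕ)) (φ : MvPowerSeries (Fin n) K)
    (ω : Fin n →₀ ℕ) : MvPowerSeries.coeff ω (partialQuotient β S φ) =
      if ω + β ∈ S then MvPowerSeries.coeff (ω + β) φ else 0 := rfl

/-- Shifting exponents by β is injective and the weight is multiplicative, so division by y^β costs
exactly the factor M(β)^t. -/
lemma wnorm_partialQuotient_le (j t : ℕ) (β : Fin n →₀ ℕ) (S : Set (Fin n →₀ ℕ))
    (φ : MvPowerSeries (Fin n) K) :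
    N.wnorm j t (partialQuotient β S φ) * weight t β ≤ N.wnorm j t φ := by
  rw [wnorm, ← ENNReal.tsum_mul_right]
  refine le_trans (ENNReal.tsum_le_tsum fun ω => ?_) (ENNReal.tsum_comp_le_tsum_of_injective
    (add_left_injective β) (fun ω => N.norm j (MvPowerSeries.coeff ω φ) * weight t ω))
  rw [mul_assoc, ← weight_add, coeff_partialQuotient]
  split_ifs
  · rfl
  · simp [N.norm_zero]

lemma wnorm_partialQuotient_ne_top {j t : ℕ} {φ : MvPowerSeries (Fin n) K}
    (h : N.wnorm j t φ ≠ ∞) (β : Fin n →₀ ℕ) (S : Set (Fin n →₀ ℕ)) :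
    N.wnorm j t (partialQuotient β S φ) ≠ ∞ := by
  intro h1
  have := N.wnorm_partialQuotient_le j t β S φ
  rw [h1, ENNReal.top_mul (weight_ne_zero t β), top_le_iff] at this
  exact h this

/-- Division of a power series by the monomials `y^β_i`. -/
lemma exists_monomial_division {ι : Type*} [Fintype ι] (β : ι → Fin n →₀ ℕ) :
    ∃ S : ι → Set (Fin n →₀ ℕ), ∀ φ : MvPowerSeries (Fin n) K,
      φ = ∑ i, partialQuotient (β i) (S i) φ * MvPowerSeries.monomial (β i) 1 +
        partialQuotient 0 {ω | ∀ i, ¬ β i ≤ ω} φ := by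
  classical
  -- Each exponent dominating some β_i is assigned to one chosen such i. The chosen index does not
  -- depend on the proof of existence, so the sets are disjoint and each monomial is counted once.
  refine ⟨fun i => {ω | ∃ h : ∃ i, β i ≤ ω, h.choose = i}, fun φ => ?_⟩
  ext ω
  rw [map_add, map_sum, coeff_partialQuotient]
  have hterm : ∀ i, MvPowerSeries.coeff ω (partialQuotient (β i)
      {ω | ∃ h : ∃ i, β i ≤ ω, h.choose = i} φ * MvPowerSeries.monomial (β i) 1) =
      if ∃ h : ∃ i, β i ≤ ω, h.choose = i then MvPowerSeries.coeff ω φ else 0 := by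
    intro i
    rw [MvPowerSeries.coeff_mul_monomial, mul_one, coeff_partialQuotient]
    by_cases hi : β i ≤ ω
    · rw [if_pos hi, tsub_add_cancel_of_le hi]; congr
    · rw [if_neg hi, if_neg]
      rintro ⟨h, rfl⟩
      exact hi h.choose_spec
  simp_rw [hterm]
  by_cases h : ∃ i, β i ≤ ω
  · rw [Finset.sum_eq_single h.choose, if_pos ⟨h, rfl⟩, if_neg, add_zero]
    · simpa using h
    · intro i _ hi
      rw [if_neg]
      rintro ⟨h', rfl⟩
      exact hi rfl
    · simp
  · rw [Finset.sum_eq_zero, if_pos, zero_add, add_zero]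
    · simpa using h
    · intro i _
      rw [if_neg]
      rintro ⟨h', -⟩
      exact h h'

variable {N}

/-- Division with remainder in the ring of convergent power series. -/
theorem exists_division {ι : Type*} [Fintype ι] {β : ι → Fin n →₀ ℕ}
    {g : ι → MvPowerSeries (Fin n) K} (hg : ∀ i, g i ∈ N.convergent n)
    (hlead : ∀ i, N.eval (MvPowerSeries.coeff (β i) (g i)) = 1)
    (hlow : ∀ i ω, monomialIndex ω < monomialIndex (β i) →
      N.eval (MvPowerSeries.coeff ω (g i)) = 0)
    {f : MvPowerSeries (Fin n) K} (hf : f ∈ N.convergent n) :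
    ∃ (q : ι → MvPowerSeries (Fin n) K) (r : MvPowerSeries (Fin n) K),
      (∀ i, q i ∈ N.convergent n) ∧ r ∈ N.convergent n ∧ f = ∑ i, q i * g i + r ∧
      ∀ ω i, β i ≤ ω → MvPowerSeries.coeff ω r = 0 := by
  classical
  obtain ⟨S, hS⟩ := exists_monomial_division (K := K) β
  set h : ι → MvPowerSeries (Fin n) K := fun i => MvPowerSeries.monomial (β i) 1 - g i with hh
  have hmem : ∀ i, h i ∈ N.convergent n := fun i =>
    sub_mem (monomial_mem _ (N.norm_one 0)) (hg i)
  have h0 : ∀ i ω, monomialIndex ω ≤ monomialIndex (β i) →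
      N.eval (MvPowerSeries.coeff ω (h i)) = 0 := by
    intro i ω hω
    obtain ⟨j, t, hj⟩ := hg i
    have hgf := N.norm_coeff_ne_top hj ω
    rw [hh]
    simp only
    rw [map_sub, sub_eq_add_neg]
    by_cases e : ω = β i
    · subst e
      rw [MvPowerSeries.coeff_monomial_same, N.eval_add (N.norm_one j) (by rwa [N.norm_neg]),
        N.eval_neg hgf, hlead, N.eval_one, add_neg_cancel]
    · rw [MvPowerSeries.coeff_monomial_ne e, zero_add, N.eval_neg hgf, hlow, neg_zero]
      exact lt_of_le_of_ne hω fun e' => e (monomialIndex_injective e')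
  -- The sum of the δ over the divisors is at most 1/2, the contraction constant. The `+ 1` keeps δ
  -- finite for an empty family.
  set δ : ℝ≥0∞ := 2⁻¹ * ((Fintype.card ι + 1 : ℕ) : ℝ≥0∞)⁻¹ with hδ
  have hδ0 : δ ≠ 0 := by rw [hδ]; simp
  have hev : ∀ᶠ t in atTop, ∀ᶠ j in atTop, N.wnorm j t f ≠ ∞ ∧
      ∀ i, N.wnorm j t (h i) ≤ δ * weight t (β i) := by
    filter_upwards [eventually_wnorm_ne_top hf, eventually_all.2 fun i =>
      N.eventually_wnorm_le (hmem i) (h0 i) hδ0] with t ht1 ht2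
    filter_upwards [ht1, eventually_all.2 ht2] with j hj1 hj2 using ⟨hj1, hj2⟩
  obtain ⟨t, ht⟩ := hev.exists
  obtain ⟨j, hjf, hjh⟩ := ht.exists
  have hhfin : ∀ i, N.wnorm j t (h i) ≠ ∞ := fun i => ne_top_of_le_ne_top
    (ENNReal.mul_ne_top (by rw [hδ]; exact ENNReal.mul_ne_top (by simp) (by simp))
      (weight_ne_top _ _)) (hjh i)
  -- If Q_i are the monomial quotients, T φ = ∑ Q_i(φ) h_i. Since g_i = y^{β_i} - h_i, dividing f by
  -- the g_i amounts to solving F - T F = f and dividing F by the monomials.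
  let T : MvPowerSeries (Fin n) K →+ MvPowerSeries (Fin n) K :=
    ∑ i, (AddMonoidHom.mulRight (h i)).comp (partialQuotient (β i) (S i))
  have hT : ∀ φ, T φ = ∑ i, partialQuotient (β i) (S i) φ * h i := fun φ => by
    simp [T]
  have hTle : ∀ φ, N.wnorm j t φ ≠ ∞ → N.wnorm j t (T φ) ≤ 2⁻¹ * N.wnorm j t φ := by
    intro φ hφ
    rw [hT]
    have hterm : ∀ i ∈ Finset.univ, N.wnorm j t (partialQuotient (β i) (S i) φ * h i) ≤
        δ * N.wnorm j t φ := fun i _ => by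
      refine (N.wnorm_mul_le (N.wnorm_partialQuotient_ne_top hφ _ _) (hhfin i)).trans ?_
      refine (mul_le_mul' le_rfl (hjh i)).trans ?_
      rw [mul_left_comm]
      exact mul_le_mul' le_rfl (N.wnorm_partialQuotient_le j t _ _ φ)
    refine (N.wnorm_sum_le _ _ _ _).trans ((Finset.sum_le_sum hterm).trans ?_)
    rw [Finset.sum_const, nsmul_eq_mul, ← mul_assoc]
    refine mul_le_mul' ?_ le_rfl
    rw [hδ, mul_left_comm]
    refine (mul_le_mul' le_rfl ?_).trans (mul_one _).le
    rw [← div_eq_mul_inv]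
    refine ENNReal.div_le_of_le_mul ?_
    rw [one_mul, Finset.card_univ]
    exact_mod_cast Nat.le_succ _
  obtain ⟨F, hF, hFT⟩ := N.exists_sub_contraction_eq T hTle hjf
  refine ⟨fun i => partialQuotient (β i) (S i) F, partialQuotient 0 {ω | ∀ i, ¬ β i ≤ ω} F,
    fun i => ⟨j, t, N.wnorm_partialQuotient_ne_top hF _ _⟩,
    ⟨j, t, N.wnorm_partialQuotient_ne_top hF _ _⟩, ?_, fun ω i hi => ?_⟩
  · have e : ∀ i, partialQuotient (β i) (S i) F * g i =
        partialQuotient (β i) (S i) F * MvPowerSeries.monomial (β i) 1 -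
        partialQuotient (β i) (S i) F * h i := fun i => by
      rw [hh]; ring
    simp_rw [e]
    rw [Finset.sum_sub_distrib, sub_add_eq_add_sub, ← hS F, ← hT, hFT]
  · rw [coeff_partialQuotient, if_neg]
    intro hc
    rw [add_zero] at hc
    exact hc i hi

end NormSystem

namespace NormSystem

variable {𝕜 K : Type*} [Field 𝕜] [CommRing K] {N : NormSystem 𝕜 K} {n : ℕ}

/-! ### Algebraic properties of the ring of convergent power series -/

lemma exists_norm_coeff_ne_top (φ : N.convergent n) :
    ∃ j, ∀ ω, N.norm j (MvPowerSeries.coeff ω φ.1) ≠ ∞ := by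
  obtain ⟨φ, j, t, h⟩ := φ
  exact ⟨j, N.norm_coeff_ne_top h⟩

lemma exists_norm_coeff_ne_top₂ (φ ψ : N.convergent n) :
    ∃ j, (∀ ω, N.norm j (MvPowerSeries.coeff ω φ.1) ≠ ∞) ∧
      ∀ ω, N.norm j (MvPowerSeries.coeff ω ψ.1) ≠ ∞ := by
  obtain ⟨i, hi⟩ := exists_norm_coeff_ne_top φ
  obtain ⟨j, hj⟩ := exists_norm_coeff_ne_top ψ
  exact ⟨max i j, fun ω => ne_top_of_le_ne_top (hi ω) (N.norm_anti (le_max_left _ _) _),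
    fun ω => ne_top_of_le_ne_top (hj ω) (N.norm_anti (le_max_right _ _) _)⟩

variable (N n)

/-- The value of a convergent power series at the origin. -/
noncomputable def value : N.convergent n →+* 𝕜 where
  toFun φ := N.eval (MvPowerSeries.coeff 0 φ.1)
  map_zero' := by simp [N.eval_zero]
  map_one' := by simp [N.eval_one]
  map_add' φ ψ := by
    obtain ⟨j, h, h'⟩ := exists_norm_coeff_ne_top₂ φ ψ
    rw [Subring.coe_add, map_add, N.eval_add (h 0) (h' 0)]
  map_mul' φ ψ := by
    obtain ⟨j, h, h'⟩ := exists_norm_coeff_ne_top₂ φ ψ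
    rw [Subring.coe_mul]
    simp only [MvPowerSeries.coeff_zero_eq_constantCoeff_apply, map_mul]
    simp only [← MvPowerSeries.coeff_zero_eq_constantCoeff_apply]
    exact N.eval_mul (h 0) (h' 0)

/-- A constant of `𝕜`, as a convergent power series. -/
noncomputable def const (c : 𝕜) : N.convergent n :=
  ⟨MvPowerSeries.C (N.scalar c), C_mem (N.norm_scalar 0 c)⟩

/-- The parameter of the coefficient ring, as a convergent power series. -/
noncomputable def parameter : N.convergent n :=
  ⟨MvPowerSeries.C N.param, C_mem (N.norm_param 0)⟩

/-- The variables, as convergent power series. -/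
noncomputable def coordinate (i : Fin n) : N.convergent n :=
  ⟨MvPowerSeries.X i, monomial_mem _ (N.norm_one 0)⟩

variable {N n}

lemma value_apply (φ : N.convergent n) : N.value n φ = N.eval (MvPowerSeries.coeff 0 φ.1) := rfl

lemma coeff_parameter_mul (φ : N.convergent n) (ω : Fin n →₀ ℕ) :
    MvPowerSeries.coeff ω (N.parameter n * φ).1 = N.param * MvPowerSeries.coeff ω φ.1 :=
  MvPowerSeries.coeff_C_mul _ _ _

lemma eval_coeff_const_mul (c : 𝕜) (φ : N.convergent n) (ω : Fin n →₀ ℕ) :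
    N.eval (MvPowerSeries.coeff ω (N.const n c * φ).1) =
      c * N.eval (MvPowerSeries.coeff ω φ.1) := by
  obtain ⟨j, hj⟩ := exists_norm_coeff_ne_top φ
  have : MvPowerSeries.coeff ω (N.const n c * φ).1 = N.scalar c * MvPowerSeries.coeff ω φ.1 :=
    MvPowerSeries.coeff_C_mul _ _ _
  rw [this, N.eval_mul (N.norm_scalar j c) (hj ω), N.eval_scalar]

/-- Division with remainder, in terms of elements of the ring. -/
lemma exists_division_subtype {ι : Type*} [Fintype ι] {β : ι → Fin n →₀ ℕ}
    {g : ι → N.convergent n}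
    (hlead : ∀ i, N.eval (MvPowerSeries.coeff (β i) (g i).1) = 1)
    (hlow : ∀ i ω, monomialIndex ω < monomialIndex (β i) →
      N.eval (MvPowerSeries.coeff ω (g i).1) = 0) (f : N.convergent n) :
    ∃ (q : ι → N.convergent n) (r : N.convergent n), f = ∑ i, q i * g i + r ∧
      ∀ ω i, β i ≤ ω → MvPowerSeries.coeff ω r.1 = 0 := by
  obtain ⟨q, r, hq, hr, h1, h2⟩ := exists_division (fun i => (g i).2) hlead hlow f.2
  refine ⟨fun i => ⟨q i, hq i⟩, ⟨r, hr⟩, Subtype.ext ?_, h2⟩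
  rw [h1]
  simp

/-- Let c ≠ 0 be the value of φ. Dividing 1 by c⁻¹ φ with leading exponent 0 leaves no room for a
remainder, as every exponent dominates 0; the quotient provides an inverse of φ. -/
instance isLocalHom_value : IsLocalHom (N.value n) where
  map_nonunit φ hφ := by
    set c := N.value n φ with hc
    have hc0 : c ≠ 0 := hφ.ne_zero
    obtain ⟨q, r, h1, h2⟩ := exists_division_subtype (ι := Unit) (β := fun _ => 0)
      (g := fun _ => N.const n c⁻¹ * φ)
      (fun _ => by rw [eval_coeff_const_mul, ← value_apply, ← hc, inv_mul_cancel₀ hc0])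
      (fun _ ω hω => by
        have := monomialIndex_pos ω
        rw [monomialIndex_zero] at hω
        omega) (1 : N.convergent n)
    have hr : r = 0 := Subtype.ext (MvPowerSeries.ext fun ω => h2 ω () zero_le)
    rw [hr, add_zero, Fintype.sum_unique, ← mul_assoc] at h1
    exact IsUnit.of_mul_eq_one_right _ h1.symm

instance isLocalRing_convergent : IsLocalRing (N.convergent n) :=
  RingHom.domain_isLocalRing (N.value n)

lemma mem_maximalIdeal_iff {φ : N.convergent n} :
    φ ∈ IsLocalRing.maximalIdeal (N.convergent n) ↔ N.value n φ = 0 := by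
  rw [IsLocalRing.mem_maximalIdeal, mem_nonunits_iff, ← isUnit_map_iff (N.value n),
    isUnit_iff_ne_zero, not_not]

/-- A convergent power series whose coefficients all have the value `0` is divisible by the
parameter. -/
lemma exists_eq_parameter_mul {φ : N.convergent n}
    (h : ∀ ω, N.eval (MvPowerSeries.coeff ω φ.1) = 0) : ∃ ψ, φ = N.parameter n * ψ := by
  obtain ⟨φ, j, t, hφ⟩ := φ
  -- The index i and the constant C serve all coefficients at once, which is what makes the series
  -- of quotients convergent.
  obtain ⟨i, C, hC, hdiv⟩ := N.exists_div j
  choose b hb hbn using fun ω => hdiv _ (N.norm_coeff_ne_top hφ ω) (h ω)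
  let ψ : MvPowerSeries (Fin n) K := b
  have hψ : ∀ ω, MvPowerSeries.coeff ω ψ = b ω := fun _ => rfl
  refine ⟨⟨ψ, i, t, ?_⟩, Subtype.ext (MvPowerSeries.ext fun ω => ?_)⟩
  · refine ne_top_of_le_ne_top (ENNReal.mul_ne_top hC hφ) ?_
    rw [wnorm, wnorm, ← ENNReal.tsum_mul_left]
    refine ENNReal.tsum_le_tsum fun ω => ?_
    rw [hψ, ← mul_assoc]
    exact mul_le_mul' (hbn ω) le_rfl
  · rw [coeff_parameter_mul, hψ]
    exact hb ω

lemma coeff_parameter_pow_mul (m : ℕ) (φ : N.convergent n) (ω : Fin n →₀ ℕ) :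
    MvPowerSeries.coeff ω (N.parameter n ^ m * φ).1 =
      N.param ^ m * MvPowerSeries.coeff ω φ.1 := by
  induction m generalizing φ with
  | zero => simp
  | succ m ih => rw [pow_succ, mul_assoc, ih, coeff_parameter_mul, pow_succ, mul_assoc]

lemma eq_zero_of_parameter_pow_dvd {φ : N.convergent n}
    (h : ∀ m, ∃ ψ, φ = N.parameter n ^ m * ψ) : φ = 0 := by
  obtain ⟨j, hj⟩ := exists_norm_coeff_ne_top φ
  refine Subtype.ext (MvPowerSeries.ext fun ω => ?_)
  refine N.separated (hj ω) fun m => ?_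
  obtain ⟨ψ, hψ⟩ := h m
  obtain ⟨i, hi⟩ := exists_norm_coeff_ne_top ψ
  exact ⟨_, i, hi ω, by rw [hψ, coeff_parameter_pow_mul]⟩

/-! ### Noetherianity. -/

/-- Dickson's lemma: the minimal elements form an antichain in a well-quasi-order, hence a finite
set. -/
lemma exists_finite_minimal (E : Set (Fin n →₀ ℕ)) :
    ∃ B : Finset (Fin n →₀ ℕ), (∀ b ∈ B, b ∈ E) ∧ ∀ β ∈ E, ∃ b ∈ B, b ≤ β := by
  have hfin : {b | Minimal (· ∈ E) b}.Finite :=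
    WellQuasiOrderedLE.finite_of_isAntichain (setOfPred_minimal_antichain _)
  refine ⟨hfin.toFinset, fun b hb => ?_, fun β hβ => ?_⟩
  · exact ((Set.Finite.mem_toFinset _).1 hb).prop
  · obtain ⟨b, hb, hm⟩ := exists_minimal_le_of_wellFoundedLT (· ∈ E) β hβ
    exact ⟨b, (Set.Finite.mem_toFinset _).2 hm, hb⟩

lemma exists_minimal_index {p : (Fin n →₀ ℕ) → Prop} (h : ∃ ω, p ω) :
    ∃ ω, p ω ∧ ∀ ω', monomialIndex ω' < monomialIndex ω → ¬ p ω' := by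
  obtain ⟨ω, hω, hmin⟩ := (measure (monomialIndex (n := n))).wf.has_min {ω | p ω} h
  exact ⟨ω, hω, fun ω' h1 h2 => hmin ω' h2 h1⟩

/-- By Cohen's theorem prime ideals suffice, and primality is essential: when z is not in P, a
factor z can be cancelled from an element of P without leaving P. -/
instance isNoetherianRing_convergent : IsNoetherianRing (N.convergent n) := by
  refine IsNoetherianRing.of_prime fun P hP => ?_
  -- The set consists of the leading exponents of the values of the elements of P, where a leading
  -- exponent is the one of least index. The finite set B dominates it from below for the
  -- componentwise order.
  obtain ⟨B, hBE, hB⟩ := exists_finite_minimal {β | ∃ f ∈ P,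
    N.eval (MvPowerSeries.coeff β f.1) ≠ 0 ∧ ∀ ω, monomialIndex ω < monomialIndex β →
      N.eval (MvPowerSeries.coeff ω f.1) = 0}
  have hgen : ∀ b : B, ∃ g ∈ P, N.eval (MvPowerSeries.coeff b.1 g.1) = 1 ∧
      ∀ ω, monomialIndex ω < monomialIndex b.1 → N.eval (MvPowerSeries.coeff ω g.1) = 0 := by
    intro b
    obtain ⟨f, hf, h1, h2⟩ := hBE b.1 b.2
    refine ⟨N.const n (N.eval (MvPowerSeries.coeff b.1 f.1))⁻¹ * f, P.mul_mem_left _ hf, ?_, ?_⟩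
    · rw [eval_coeff_const_mul, inv_mul_cancel₀ h1]
    · intro ω hω
      rw [eval_coeff_const_mul, h2 ω hω, mul_zero]
  choose g hgP hlead hlow using hgen
  have hspan : Ideal.span (Set.range g) ≤ P := Ideal.span_le.2 (by rintro _ ⟨b, rfl⟩; exact hgP b)
  -- a remainder in `P` is divisible by the parameter
  have key : ∀ r ∈ P, (∀ ω (b : B), b.1 ≤ ω → MvPowerSeries.coeff ω r.1 = 0) →
      ∃ s, r = N.parameter n * s := by
    intro r hr hc
    refine exists_eq_parameter_mul ?_
    -- Otherwise the least exponent with nonzero value is a leading exponent of an element of P,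
    -- hence lies above some b in B, where the coefficients of r vanish.
    by_contra! hne
    obtain ⟨ω, h1, h2⟩ := exists_minimal_index hne
    obtain ⟨b, hb, hle⟩ := hB ω ⟨r, hr, h1, fun ω' h => not_not.1 (h2 ω' h)⟩
    rw [hc ω ⟨b, hb⟩ hle, N.eval_zero] at h1
    exact h1 rfl
  have hdivision : ∀ f ∈ P, ∃ r ∈ P, f - r ∈ Ideal.span (Set.range g) ∧
      ∀ ω (b : B), b.1 ≤ ω → MvPowerSeries.coeff ω r.1 = 0 := by
    intro f hf
    obtain ⟨q, r, h1, h2⟩ := exists_division_subtype hlead hlow f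
    have h3 : f - r ∈ Ideal.span (Set.range g) := by
      rw [h1, add_sub_cancel_right]
      exact sum_mem fun i _ => Ideal.mul_mem_left _ _ (Ideal.subset_span ⟨i, rfl⟩)
    refine ⟨r, ?_, h3, h2⟩
    have := P.sub_mem hf (hspan h3)
    rwa [sub_sub_cancel] at this
  by_cases hz : N.parameter n ∈ P
  · have hP' : P = Ideal.span (insert (N.parameter n) (Set.range g)) := by
      refine le_antisymm (fun f hf => ?_) (Ideal.span_le.2 (Set.insert_subset hz
        (by rintro _ ⟨b, rfl⟩; exact hgP b)))
      obtain ⟨r, hr, h1, h2⟩ := hdivision f hf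
      obtain ⟨s, rfl⟩ := key r hr h2
      have h3 := Ideal.add_mem _ (Ideal.span_mono (Set.subset_insert (N.parameter n) _) h1)
        (Ideal.mul_mem_right s _ (Ideal.subset_span (Set.mem_insert (N.parameter n) (Set.range g))))
      rwa [sub_add_cancel] at h3
    rw [hP']
    exact Submodule.fg_span ((Set.finite_range g).insert _)
  · have hP' : P = Ideal.span (Set.range g) := by
      refine le_antisymm (fun f hf => ?_) hspan
      obtain ⟨r, hr, h1, h2⟩ := hdivision f hf
      -- Dividing by z preserves both membership in P and the vanishing of the coefficients above B,
      -- the latter because z is not a zero divisor. So the argument repeats, and r is divisible by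
      -- every power of z.
      have h3 : ∀ m, ∃ s ∈ P, r = N.parameter n ^ m * s ∧
          ∀ ω (b : B), b.1 ≤ ω → MvPowerSeries.coeff ω s.1 = 0 := by
        intro m
        induction m with
        | zero => exact ⟨r, hr, by simp, h2⟩
        | succ m ih =>
          obtain ⟨s, hs, rfl, hc⟩ := ih
          obtain ⟨u, rfl⟩ := key s hs hc
          refine ⟨u, (hP.mem_or_mem hs).resolve_left hz, by rw [pow_succ, mul_assoc],
            fun ω b hb => ?_⟩
          have := hc ω b hb
          rw [coeff_parameter_mul] at this
          exact N.param_mul_eq_zero this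
      have hr0 : r = 0 := eq_zero_of_parameter_pow_dvd fun m => by
        obtain ⟨s, -, h, -⟩ := h3 m
        exact ⟨s, h⟩
      rwa [hr0, sub_zero] at h1
    rw [hP']
    exact Submodule.fg_span (Set.finite_range g)

/-! ### Dimension and regularity -/

/-- Division by the variables leaves a remainder with only a constant coefficient. For an element of
the maximal ideal this coefficient has value 0, so the remainder is a multiple of z. -/
lemma maximalIdeal_eq_span : IsLocalRing.maximalIdeal (N.convergent n) =
    Ideal.span (insert (N.parameter n) (Set.range (N.coordinate n))) := by
  refine le_antisymm (fun f hf => ?_) (Ideal.span_le.2 (Set.insert_subset ?_ ?_))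
  · obtain ⟨q, r, h1, h2⟩ := exists_division_subtype (N := N) (β := fun i => Finsupp.single i 1)
      (g := N.coordinate n)
      (fun i => by
        change N.eval (MvPowerSeries.coeff _ (MvPowerSeries.X i)) = 1
        rw [MvPowerSeries.coeff_index_single_self_X, N.eval_one])
      (fun i ω hω => by
        classical
        change N.eval (MvPowerSeries.coeff _ (MvPowerSeries.X i)) = 0
        rw [MvPowerSeries.coeff_X, if_neg, N.eval_zero]
        rintro rfl
        exact lt_irrefl _ hω) f
    have h3 : ∑ i, q i * N.coordinate n i ∈
        Ideal.span (insert (N.parameter n) (Set.range (N.coordinate n))) :=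
      sum_mem fun i _ => Ideal.mul_mem_left _ _ (Ideal.subset_span (Or.inr ⟨i, rfl⟩))
    have h4 : ∑ i, q i * N.coordinate n i ∈ IsLocalRing.maximalIdeal (N.convergent n) := by
      refine sum_mem fun i _ => Ideal.mul_mem_left _ _ ?_
      rw [mem_maximalIdeal_iff, value_apply]
      change N.eval (MvPowerSeries.coeff 0 (MvPowerSeries.X i)) = 0
      rw [MvPowerSeries.coeff_zero_X, N.eval_zero]
    have h5 : N.value n r = 0 := by
      rw [← mem_maximalIdeal_iff]
      have := Ideal.sub_mem _ hf h4
      rwa [h1, add_sub_cancel_left] at this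
    obtain ⟨s, rfl⟩ : ∃ s, r = N.parameter n * s := by
      refine exists_eq_parameter_mul fun ω => ?_
      by_cases hω : ω = 0
      · rw [hω]; exact h5
      · obtain ⟨i, hi⟩ := Finsupp.ne_iff.1 hω
        rw [h2 ω i (Finsupp.single_le_iff.2 (Nat.one_le_iff_ne_zero.2 hi)), N.eval_zero]
    rw [h1]
    exact Ideal.add_mem _ h3 (Ideal.mul_mem_right _ _ (Ideal.subset_span (Or.inl rfl)))
  · rw [SetLike.mem_coe, mem_maximalIdeal_iff, value_apply]
    change N.eval (MvPowerSeries.coeff 0 (MvPowerSeries.C N.param)) = 0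
    rw [MvPowerSeries.coeff_zero_C, N.eval_param]
  · rintro _ ⟨i, rfl⟩
    rw [SetLike.mem_coe, mem_maximalIdeal_iff, value_apply]
    change N.eval (MvPowerSeries.coeff 0 (MvPowerSeries.X i)) = 0
    rw [MvPowerSeries.coeff_zero_X, N.eval_zero]

lemma spanFinrank_maximalIdeal_le :
    (IsLocalRing.maximalIdeal (N.convergent n)).spanFinrank ≤ n + 1 := by
  rw [maximalIdeal_eq_span]
  refine (Submodule.spanFinrank_span_le_ncard_of_finite ((Set.finite_range _).insert _)).trans ?_
  refine (Set.ncard_insert_le _ _).trans (Nat.succ_le_succ ?_)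
  rw [← Set.image_univ]
  refine (Set.ncard_image_le Set.finite_univ).trans ?_
  simp

/-! ### Absence of zero divisors, and a chain of prime ideals. -/

/-- As long as the value is 0, one can divide by z again; a process that never stops would make a
divisible by all powers of z, hence 0. This provides a z-adic order for nonzero elements of finite
norm. -/
lemma exists_eq_param_pow_mul {j : ℕ} {a : K} (ha : N.norm j a ≠ ∞) (h0 : a ≠ 0) :
    ∃ m b i, N.norm i b ≠ ∞ ∧ N.eval b ≠ 0 ∧ a = N.param ^ m * b := by
  by_contra! hc
  refine h0 (N.separated ha fun m => ?_)
  induction m with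
  | zero => exact ⟨a, j, ha, by simp⟩
  | succ m ih =>
    obtain ⟨b, i, hb, h⟩ := ih
    obtain ⟨l, C, hC, hdiv⟩ := N.exists_div i
    obtain ⟨u, hu, hun⟩ := hdiv b hb (by_contra fun h' => hc m b i hb h' h)
    exact ⟨u, l, ne_top_of_le_ne_top (ENNReal.mul_ne_top hC hb) hun, by
      rw [h, hu, pow_succ, mul_assoc]⟩

lemma param_pow_mul_eq_zero {m : ℕ} {a : K} (h : N.param ^ m * a = 0) : a = 0 := by
  induction m with
  | zero => simpa using h
  | succ m ih => exact ih (N.param_mul_eq_zero (by rw [← mul_assoc, ← pow_succ', h]))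

/-- After extracting powers of z, both cofactors have nonzero values, and values multiply in the
field. -/
lemma mul_ne_zero_of_norm {j : ℕ} {a b : K} (ha : N.norm j a ≠ ∞) (hb : N.norm j b ≠ ∞)
    (ha0 : a ≠ 0) (hb0 : b ≠ 0) : a * b ≠ 0 := by
  obtain ⟨m, u, i, hu, hu0, rfl⟩ := exists_eq_param_pow_mul ha ha0
  obtain ⟨l, v, i', hv, hv0, rfl⟩ := exists_eq_param_pow_mul hb hb0
  intro h
  rw [mul_mul_mul_comm, ← pow_add] at h
  have h1 := param_pow_mul_eq_zero h
  have h2 := N.eval_mul (ne_top_of_le_ne_top hu (N.norm_anti (le_max_left i i') _))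
    (ne_top_of_le_ne_top hv (N.norm_anti (le_max_right i i') _))
  rw [h1, N.eval_zero] at h2
  exact mul_ne_zero hu0 hv0 h2.symm

variable (N n)

/-- The ideal of the power series in which every monomial contains one of the first `d`
variables. -/
noncomputable def variableIdeal (d : ℕ) : Ideal (N.convergent n) where
  carrier := {φ | ∀ ω : Fin n →₀ ℕ, (∀ i : Fin n, i.1 < d → ω i = 0) →
    MvPowerSeries.coeff ω φ.1 = 0}
  zero_mem' := fun ω _ => by simp
  add_mem' := fun {φ ψ} h h' ω hω => by rw [Subring.coe_add, map_add, h ω hω, h' ω hω, add_zero]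
  smul_mem' := fun φ ψ h ω hω => by
    classical
    rw [smul_eq_mul, Subring.coe_mul, MvPowerSeries.coeff_mul]
    refine Finset.sum_eq_zero fun p hp => ?_
    rw [h p.2, mul_zero]
    intro i hi
    have h1 := DFunLike.congr_fun (Finset.HasAntidiagonal.mem_antidiagonal.1 hp) i
    rw [Finsupp.add_apply, hω i hi] at h1
    omega

variable {N n}

lemma mem_variableIdeal {d : ℕ} {φ : N.convergent n} : φ ∈ N.variableIdeal n d ↔
    ∀ ω : Fin n →₀ ℕ, (∀ i : Fin n, i.1 < d → ω i = 0) → MvPowerSeries.coeff ω φ.1 = 0 := Iff.rfl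

lemma one_notMem_variableIdeal (d : ℕ) : (1 : N.convergent n) ∉ N.variableIdeal n d := by
  intro h
  have h1 := mem_variableIdeal.1 h 0 (by simp)
  rw [Subring.coe_one, MvPowerSeries.coeff_zero_one] at h1
  have h2 := N.eval_one
  rw [h1, N.eval_zero] at h2
  exact zero_ne_one h2

lemma eq_left_of_mul_eq {a b p q : ℕ} (h : p * q = a * b) (hp : a ≤ p) (hq : b ≤ q) (hb : 0 < b) :
    p = a :=
  le_antisymm (Nat.le_of_mul_le_mul_right ((Nat.mul_le_mul_left _ hq).trans h.le) hb) hp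

/-- Strict multiplicativity of the monomial order: a + b has only one decomposition into exponents
that do not precede a and b respectively. A product of two leading terms therefore cannot be
cancelled. -/
lemma eq_left_of_monomialIndex_le {a b p q : Fin n →₀ ℕ} (h : p + q = a + b)
    (hp : monomialIndex a ≤ monomialIndex p) (hq : monomialIndex b ≤ monomialIndex q) : p = a :=
  monomialIndex_injective (eq_left_of_mul_eq
    (by rw [← monomialIndex_add, h, monomialIndex_add]) hp hq (monomialIndex_pos b))

/-- Set the first d variables to 0 and take the nonzero terms of least index of φ and ψ, at a and b.
In the coefficient of the product at a + b only φ_a ψ_b survives, and it is nonzero because elements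
of finite norm have no zero divisors. -/
lemma isPrime_variableIdeal (d : ℕ) : (N.variableIdeal n d).IsPrime := by
  classical
  refine Ideal.isPrime_iff.2 ⟨(Ideal.ne_top_iff_one _).2 (one_notMem_variableIdeal d), ?_⟩
  intro φ ψ h
  by_contra! hc
  obtain ⟨j, hj, hj'⟩ := exists_norm_coeff_ne_top₂ φ ψ
  have hmin : ∀ χ : N.convergent n, χ ∉ N.variableIdeal n d → ∃ ω : Fin n →₀ ℕ,
      ((∀ i : Fin n, i.1 < d → ω i = 0) ∧ MvPowerSeries.coeff ω χ.1 ≠ 0) ∧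
      ∀ ω', monomialIndex ω' < monomialIndex ω →
        ¬ ((∀ i : Fin n, i.1 < d → ω' i = 0) ∧ MvPowerSeries.coeff ω' χ.1 ≠ 0) := by
    intro χ hχ
    apply exists_minimal_index
    rw [mem_variableIdeal] at hχ
    push Not at hχ
    exact hχ
  obtain ⟨a, ⟨ha, ha0⟩, hamin⟩ := hmin φ hc.1
  obtain ⟨b, ⟨hb, hb0⟩, hbmin⟩ := hmin ψ hc.2
  have hab := mem_variableIdeal.1 h (a + b) fun i hi => by
    rw [Finsupp.add_apply, ha i hi, hb i hi]
  rw [Subring.coe_mul, MvPowerSeries.coeff_mul, Finset.sum_eq_single (a, b)] at hab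
  · exact mul_ne_zero_of_norm (hj a) (hj' b) ha0 hb0 hab
  · rintro ⟨p, q⟩ hpq hne
    have hpq := Finset.HasAntidiagonal.mem_antidiagonal.1 hpq
    simp only at hpq
    have hvan : ∀ i : Fin n, i.1 < d → p i = 0 ∧ q i = 0 := by
      intro i hi
      have h1 := DFunLike.congr_fun hpq i
      rw [Finsupp.add_apply, Finsupp.add_apply, ha i hi, hb i hi] at h1
      omega
    by_contra h0
    have hp : monomialIndex a ≤ monomialIndex p := not_lt.1 fun hlt =>
      hamin p hlt ⟨fun i hi => (hvan i hi).1, left_ne_zero_of_mul h0⟩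
    have hq : monomialIndex b ≤ monomialIndex q := not_lt.1 fun hlt =>
      hbmin q hlt ⟨fun i hi => (hvan i hi).2, right_ne_zero_of_mul h0⟩
    have hpa := eq_left_of_monomialIndex_le hpq hp hq
    subst hpa
    exact hne (Prod.ext rfl (add_left_cancel hpq))
  · intro hn
    refine absurd ?_ hn
    rw [Finset.HasAntidiagonal.mem_antidiagonal]

lemma variableIdeal_lt {c d : ℕ} (hcd : c < d) (hd : d ≤ n) :
    N.variableIdeal n c < N.variableIdeal n d := by
  classical
  refine lt_of_le_of_ne (fun φ h ω hω => h ω fun i hi => hω i (hi.trans hcd)) fun h => ?_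
  have h1 : N.coordinate n ⟨c, hcd.trans_le hd⟩ ∈ N.variableIdeal n d := by
    intro ω hω
    change MvPowerSeries.coeff ω (MvPowerSeries.X _) = 0
    rw [MvPowerSeries.coeff_X, if_neg]
    rintro rfl
    have := hω ⟨c, hcd.trans_le hd⟩ hcd
    simp at this
  rw [← h] at h1
  have h2 := h1 (Finsupp.single ⟨c, hcd.trans_le hd⟩ 1) fun i hi => by
    rw [Finsupp.single_apply, if_neg]
    rintro rfl
    simp at hi
  change MvPowerSeries.coeff _ (MvPowerSeries.X _) = 0 at h2
  rw [MvPowerSeries.coeff_index_single_self_X] at h2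
  have h3 := N.eval_one
  rw [h2, N.eval_zero] at h3
  exact zero_ne_one h3

lemma variableIdeal_lt_maximalIdeal (d : ℕ) :
    N.variableIdeal n d < IsLocalRing.maximalIdeal (N.convergent n) := by
  refine lt_of_le_of_ne (IsLocalRing.le_maximalIdeal (isPrime_variableIdeal d).ne_top) fun h => ?_
  have h1 : N.parameter n ∈ N.variableIdeal n d := by
    rw [h, maximalIdeal_eq_span]
    exact Ideal.subset_span (Or.inl rfl)
  have h2 := h1 0 (by simp)
  change MvPowerSeries.coeff 0 (MvPowerSeries.C N.param) = 0 at h2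
  rw [MvPowerSeries.coeff_zero_C] at h2
  have h3 := N.param_mul_eq_zero (a := 1) (by rw [h2, zero_mul])
  have h4 := N.eval_one
  rw [h3, N.eval_zero] at h4
  exact zero_ne_one h4

/-- The n + 1 ideals for d = 0, …, n increase strictly, and z lies in the maximal ideal but in none
of them; adding the maximal ideal gives length n + 1. -/
lemma le_ringKrullDim_convergent : (n : WithBot ℕ∞) + 1 ≤ ringKrullDim (N.convergent n) := by
  let s : LTSeries (PrimeSpectrum (N.convergent n)) := LTSeries.mk n
    (fun i => ⟨N.variableIdeal n i.1, isPrime_variableIdeal i.1⟩)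
    (fun i j hij => variableIdeal_lt hij (Nat.le_of_lt_succ j.2))
  have h : s.last < IsLocalRing.closedPoint (N.convergent n) := variableIdeal_lt_maximalIdeal n
  exact Order.LTSeries.length_le_krullDim (s.snoc _ h)

lemma ringKrullDim_convergent : ringKrullDim (N.convergent n) = (n : WithBot ℕ∞) + 1 :=
  le_antisymm ((ringKrullDim_le_spanFinrank_maximalIdeal _).trans
    (by exact_mod_cast spanFinrank_maximalIdeal_le)) le_ringKrullDim_convergent

lemma isRegularLocalRing_convergent : IsRegularLocalRing (N.convergent n) := by
  refine IsRegularLocalRing.of_spanFinrank_maximalIdeal_le _ ?_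
  rw [ringKrullDim_convergent]
  exact_mod_cast spanFinrank_maximalIdeal_le

end NormSystem

/-! ### Sectors -/

lemma log_exp_arg {z : ℂ} (h : |z.im| < Real.pi) : (Complex.exp z).arg = z.im := by
  rw [← Complex.log_im, Complex.log_exp (abs_lt.1 h).1 (abs_lt.1 h).2.le]

/-- In the logarithmic coordinate a sector of half-angle below π is a convex half-strip, which
yields its connectedness. -/
lemma sector_eq_image {k R η : ℝ} (hR : 0 < R) (hang : Real.pi / (2 * k) + η < Real.pi) :
    sector k R η = Complex.exp '' {w : ℂ | w.re < Real.log R ∧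
      |w.im| < Real.pi / (2 * k) + η} := by
  ext z
  constructor
  · rintro ⟨h1, h2, h3⟩
    refine ⟨Complex.log z, ⟨?_, by rwa [Complex.log_im]⟩, Complex.exp_log (norm_pos_iff.1 h1)⟩
    rw [Complex.log_re]
    exact Real.log_lt_log h1 h2
  · rintro ⟨w, ⟨h1, h2⟩, rfl⟩
    refine ⟨by rw [Complex.norm_exp]; positivity, ?_, ?_⟩
    · rw [Complex.norm_exp]
      exact (Real.lt_log_iff_exp_lt hR).1 h1
    · rwa [log_exp_arg (h2.trans hang)]

lemma isPreconnected_sector {k R η : ℝ} (hR : 0 < R)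
    (hang : Real.pi / (2 * k) + η < Real.pi) : IsPreconnected (sector k R η) := by
  rw [sector_eq_image hR hang]
  refine IsPreconnected.image (Convex.isPreconnected ?_) _ Complex.continuous_exp.continuousOn
  have h1 : Convex ℝ {w : ℂ | w.re < Real.log R} := convex_halfSpace_re_lt _
  have h2 : Convex ℝ {w : ℂ | w.im < Real.pi / (2 * k) + η} := convex_halfSpace_im_lt _
  have h3 : Convex ℝ {w : ℂ | -(Real.pi / (2 * k) + η) < w.im} := convex_halfSpace_im_gt _
  have h4 : {w : ℂ | w.re < Real.log R ∧ |w.im| < Real.pi / (2 * k) + η} =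
      {w : ℂ | w.re < Real.log R} ∩ ({w : ℂ | -(Real.pi / (2 * k) + η) < w.im} ∩
        {w : ℂ | w.im < Real.pi / (2 * k) + η}) := by
    ext w
    exact and_congr_right fun _ => abs_lt
  rw [h4]
  exact h1.inter (h3.inter h2)

lemma ofReal_mem_sector {k R η : ℝ} (hk : 0 < k) (hη : 0 < η) {x : ℝ} (h0 : 0 < x) (hx : x < R) :
    (x : ℂ) ∈ sector k R η := by
  refine ⟨by simpa using h0.ne', by rwa [Complex.norm_of_nonneg h0.le], ?_⟩
  rw [Complex.arg_ofReal_of_nonneg h0.le, abs_zero]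
  have := Real.pi_pos
  positivity

lemma hasBasis_sectorFilter (k : ℝ) : (sectorFilter k).HasBasis
    (fun p : ℝ × ℝ => 0 < p.1 ∧ 0 < p.2) (fun p => sector k p.1 p.2) := by
  have h : sectorFilter k = ⨅ p ∈ {p : ℝ × ℝ | 0 < p.1 ∧ 0 < p.2}, 𝓟 (sector k p.1 p.2) := by
    refine le_antisymm (le_iInf₂ fun p hp => ?_) (le_iInf₂ fun R hR => le_iInf₂ fun η hη => ?_)
    · exact (iInf₂_le p.1 hp.1).trans (iInf₂_le p.2 hp.2)
    · exact iInf₂_le (f := fun (p : ℝ × ℝ) (_ : p ∈ {p : ℝ × ℝ | 0 < p.1 ∧ 0 < p.2}) =>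
        𝓟 (sector k p.1 p.2)) (R, η) ⟨hR, hη⟩
  constructor
  intro t
  rw [h, mem_biInf_of_directed]
  · simp
  · intro p hp q hq
    refine ⟨(min p.1 q.1, min p.2 q.2), ⟨lt_min hp.1 hq.1, lt_min hp.2 hq.2⟩, ?_, ?_⟩
    · exact principal_mono.2 (sector_mono (min_le_left _ _) (min_le_left _ _))
    · exact principal_mono.2 (sector_mono (min_le_right _ _) (min_le_right _ _))
  · exact ⟨(1, 1), one_pos, one_pos⟩

lemma neBot_sectorFilter {k : ℝ} (hk : 0 < k) : (sectorFilter k).NeBot := by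
  refine (hasBasis_sectorFilter k).neBot_iff.2 fun {p} hp => ?_
  exact ⟨_, ofReal_mem_sector hk hp.2 (half_pos hp.1) (half_lt_self hp.1)⟩

lemma sectorFilter_le_nhds (k : ℝ) : sectorFilter k ≤ 𝓝 0 := by
  rw [Metric.nhds_basis_ball.ge_iff]
  intro r hr
  filter_upwards [sector_mem hr one_pos] with z hz
  simpa using hz.2.1

lemma eventually_ne_zero (k : ℝ) : ∀ᶠ z in sectorFilter k, z ≠ 0 := by
  filter_upwards [sector_mem one_pos one_pos] with z hz using norm_pos_iff.1 hz.1

/-- The identity theorem on a sector. -/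
lemma eqOn_of_germ_eq {k R η : ℝ} (hk : 0 < k) (hR : 0 < R) (hη : 0 < η)
    (hang : Real.pi / (2 * k) + η < Real.pi) {f g : ℂ → ℂ}
    (hf : DifferentiableOn ℂ f (sector k R η)) (hg : DifferentiableOn ℂ g (sector k R η))
    (h : f =ᶠ[sectorFilter k] g) : Set.EqOn f g (sector k R η) := by
  obtain ⟨⟨R', η'⟩, ⟨hR', hη'⟩, hsub⟩ := (hasBasis_sectorFilter k).mem_iff.1 h
  have hx : 0 < min R R' / 2 := by positivity
  have hlt : min R R' / 2 < min R R' := half_lt_self (lt_min hR hR')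
  refine (hf.analyticOnNhd (isOpen_sector k R η)).eqOn_of_preconnected_of_eventuallyEq
    (hg.analyticOnNhd (isOpen_sector k R η)) (isPreconnected_sector hR hang)
    (ofReal_mem_sector hk hη hx (hlt.trans_le (min_le_left _ _))) ?_
  filter_upwards [(isOpen_sector k R' η').mem_nhds
    (ofReal_mem_sector hk hη' hx (hlt.trans_le (min_le_right _ _)))] with z hz using hsub hz

/-! ### Flat functions vanish -/

/-- A function that is `O(M^N (N!)^{1/k} |z|^N)` for all `N`, uniformly in `N`, is exponentially
small. -/
lemma rpow_mul_exp_le {k C x y : ℝ} (hk : 0 < k) (hC : 0 ≤ C) (hx : 0 < x) (hy : 0 ≤ y)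
    (h : ∀ N : ℕ, y ≤ C * x ^ N * (N.factorial : ℝ) ^ (1 / k)) :
    y ^ k * Real.exp (1 / (2 * x ^ k)) ≤ 2 * C ^ k := by
  have hxk : 0 < x ^ k := Real.rpow_pos_of_pos hx k
  -- Raised to the power k, the N-th bound reads y^k ≤ C^k (x^k)^N N!. Multiplying by s^N / N! with
  -- x^k s = 1/2 and summing over N turns the left side into an exponential and the right side into
  -- a geometric series of sum 2 C^k.
  set s := 1 / (2 * x ^ k) with hs
  have h1 : HasSum (fun N : ℕ => y ^ k * (s ^ N / N.factorial)) (y ^ k * Real.exp s) := by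
    have := (NormedSpace.expSeries_div_hasSum_exp (𝔸 := ℝ) s).mul_left (y ^ k)
    rwa [← Real.exp_eq_exp_ℝ] at this
  have h2 : HasSum (fun N : ℕ => C ^ k * (1 / 2 : ℝ) ^ N) (2 * C ^ k) := by
    rw [mul_comm]
    exact hasSum_geometric_two.mul_left _
  refine hasSum_le (fun N => ?_) h1 h2
  have h3 : y ^ k ≤ C ^ k * (x ^ k) ^ N * N.factorial := by
    have := Real.rpow_le_rpow hy (h N) hk.le
    rw [Real.mul_rpow (by positivity) (by positivity), Real.mul_rpow hC (by positivity),
      ← Real.rpow_mul (by positivity), one_div_mul_cancel hk.ne', Real.rpow_one] at this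
    rwa [← Real.rpow_natCast (x ^ k), ← Real.rpow_mul hx.le, mul_comm k, Real.rpow_mul hx.le,
      Real.rpow_natCast]
  have hN : (0 : ℝ) < N.factorial := by positivity
  calc y ^ k * (s ^ N / N.factorial)
      ≤ C ^ k * (x ^ k) ^ N * N.factorial * (s ^ N / N.factorial) := by gcongr
    _ = C ^ k * (x ^ k * s) ^ N := by rw [mul_pow]; field_simp
    _ = C ^ k * (1 / 2) ^ N := by
      congr 2
      rw [hs]; field_simp

/-- The exponent is -x (c x^{p-1} - n). With p = e k > 1 this yields the superexponential decay
required by Phragmén–Lindelöf. -/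
lemma tendsto_exp_sub_rpow {p c : ℝ} (hp : 1 < p) (hc : 0 < c) (n : ℝ) :
    Tendsto (fun x : ℝ => Real.exp (n * x - c * x ^ p)) atTop (𝓝 0) := by
  refine Real.tendsto_exp_atBot.comp ?_
  have h1 : Tendsto (fun x : ℝ => c * x ^ (p - 1) - n) atTop atTop :=
    tendsto_atTop_add_const_right _ _ ((tendsto_rpow_atTop (by linarith)).const_mul_atTop hc)
  have h2 := tendsto_neg_atTop_atBot.comp (tendsto_id.atTop_mul_atTop₀ h1)
  refine h2.congr' ?_
  filter_upwards [eventually_gt_atTop 0] with x hx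
  have : x ^ p = x * x ^ (p - 1) := by
    rw [← Real.rpow_one_add' hx.le (by linarith)]; congr 1; ring
  simp only [Function.comp, id]
  rw [this]; ring

/-- The conformal map `w ↦ (w + A)^{-e}` of the right half plane into a sector. -/
noncomputable def sectorMap (e A : ℝ) (w : ℂ) : ℂ := Complex.exp (-(e : ℂ) * Complex.log (w + A))

lemma norm_sectorMap {e A : ℝ} {w : ℂ} (h : w + A ≠ 0) : ‖sectorMap e A w‖ = ‖w + A‖ ^ (-e) := by
  rw [sectorMap, Complex.norm_exp, ← Complex.ofReal_neg, Complex.re_ofReal_mul, Complex.log_re,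
    Real.rpow_def_of_pos (norm_pos_iff.2 h), mul_comm]

lemma sectorMap_ofReal {e A x : ℝ} (h : 0 < x + A) :
    sectorMap e A x = (((x + A) ^ (-e) : ℝ) : ℂ) := by
  rw [sectorMap, Real.rpow_def_of_pos h, ← Complex.ofReal_add, ← Complex.ofReal_log h.le]
  push_cast
  congr 1; ring

lemma add_re_pos {A : ℝ} (hA : 0 < A) {w : ℂ} (hw : 0 ≤ w.re) : 0 < (w + A).re := by
  rw [Complex.add_re, Complex.ofReal_re]; linarith

lemma le_norm_add {A : ℝ} {w : ℂ} (hw : 0 ≤ w.re) : A ≤ ‖w + A‖ := by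
  refine le_trans ?_ (Complex.re_le_norm _)
  rw [Complex.add_re, Complex.ofReal_re]; linarith

/-- The argument of w + A is less than π/2 in absolute value and is multiplied by -e, while |w + A|
≥ A makes the modulus at most A^{-e}. -/
lemma sectorMap_mem {k R η e A : ℝ} (he : 0 < e) (hA : 0 < A) (hAR : A ^ (-e) < R)
    (heη : e * (Real.pi / 2) < Real.pi / (2 * k) + η)
    (hang : Real.pi / (2 * k) + η < Real.pi) {w : ℂ} (hw : 0 ≤ w.re) :
    sectorMap e A w ∈ sector k R η := by
  have h1 := add_re_pos hA hw
  have h0 : w + A ≠ 0 := fun h => by rw [h] at h1; simp at h1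
  have h2 : |(w + A).arg| < Real.pi / 2 := Complex.abs_arg_lt_pi_div_two_iff.2 (Or.inl h1)
  have h3 : |(-(e : ℂ) * Complex.log (w + A)).im| < Real.pi / (2 * k) + η := by
    rw [← Complex.ofReal_neg, Complex.im_ofReal_mul, Complex.log_im, abs_mul, abs_neg,
      abs_of_pos he]
    exact (mul_lt_mul_of_pos_left h2 he).trans heη
  refine ⟨?_, ?_, ?_⟩
  · rw [norm_sectorMap h0]
    have := norm_pos_iff.2 h0
    positivity
  · rw [norm_sectorMap h0]
    exact (Real.rpow_le_rpow_of_nonpos hA (le_norm_add hw) (by linarith)).trans_lt hAR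
  · rw [sectorMap, log_exp_arg (h3.trans hang)]
    exact h3

lemma differentiableAt_sectorMap {e A : ℝ} (hA : 0 < A) {w : ℂ} (hw : 0 ≤ w.re) :
    DifferentiableAt ℂ (sectorMap e A) w := by
  have : w + A ∈ Complex.slitPlane := Or.inl (add_re_pos hA hw)
  unfold sectorMap
  fun_prop (disch := assumption)

/-- Watson's lemma: a holomorphic function on a sector of opening more than `π / k` that is flat of
Gevrey order `k` vanishes. -/
theorem eqOn_zero_of_flat {k R η C M : ℝ} (hk : 0 < k) (hR : 0 < R) (hη : 0 < η)
    (hang : Real.pi / (2 * k) + η < Real.pi) (hC : 0 ≤ C) (hM : 0 < M) {f : ℂ → ℂ}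
    (hf : DifferentiableOn ℂ f (sector k R η))
    (hflat : ∀ N : ℕ, ∀ z ∈ sector k R η,
      ‖f z‖ ≤ C * M ^ N * (N.factorial : ℝ) ^ (1 / k) * ‖z‖ ^ N) :
    Set.EqOn f 0 (sector k R η) := by
  have hpi := Real.pi_pos
  -- The half-plane is mapped to half-angle e π/2 = π/(2k) + η/2, strictly inside the sector, while
  -- e k > 1. The excess opening η is what allows both.
  set e : ℝ := 1 / k + η / Real.pi with he
  have he0 : 0 < e := by positivity
  have heη : e * (Real.pi / 2) < Real.pi / (2 * k) + η := by
    have : e * (Real.pi / 2) = Real.pi / (2 * k) + η / 2 := by rw [he]; field_simp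
    linarith
  have hek : 1 < e * k := by
    have : e * k = 1 + η / Real.pi * k := by rw [he]; field_simp
    rw [this]
    have : 0 < η / Real.pi * k := by positivity
    linarith
  obtain ⟨A, hA, hAR⟩ : ∃ A : ℝ, 0 < A ∧ A ^ (-e) < R := by
    have := (tendsto_rpow_neg_atTop he0).eventually (gt_mem_nhds hR)
    obtain ⟨A, h1, h2⟩ := (this.and (eventually_gt_atTop 0)).exists
    exact ⟨A, h2, h1⟩
  have hmem : ∀ w : ℂ, 0 ≤ w.re → sectorMap e A w ∈ sector k R η := fun w hw =>
    sectorMap_mem he0 hA hAR heη hang hw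
  have hbound : ∀ z ∈ sector k R η, ‖f z‖ ≤ C := fun z hz => by
    simpa using hflat 0 z hz
  have hzero : Set.EqOn (f ∘ sectorMap e A) 0 {z : ℂ | 0 ≤ z.re} := by
    refine PhragmenLindelof.eq_zero_on_right_half_plane_of_superexponential_decay ?_ ?_ ?_ ?_
    · refine DifferentiableOn.diffContOnCl fun w hw => ?_
      rw [Complex.closure_setOfPred_lt_re] at hw
      exact ((hf.differentiableAt ((isOpen_sector k R η).mem_nhds (hmem w hw))).comp w
        (differentiableAt_sectorMap hA hw)).differentiableWithinAt
    · refine ⟨1, by norm_num, 0, Asymptotics.IsBigO.of_bound C ?_⟩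
      filter_upwards [mem_inf_of_right (mem_principal_self _)] with w hw
      have hw : 0 < w.re := hw
      simpa using hbound _ (hmem w hw.le)
    · intro n
      set c : ℝ := 1 / (2 * M ^ k) with hc
      have hc0 : 0 < c := by positivity
      have hlim : Tendsto (fun x : ℝ => (2 * C ^ k) ^ (1 / k) *
          Real.exp (n * x - c / k * x ^ (e * k))) atTop (𝓝 0) := by
        simpa using (tendsto_exp_sub_rpow hek (div_pos hc0 hk) n).const_mul ((2 * C ^ k) ^ (1 / k))
      refine squeeze_zero' (Eventually.of_forall fun x => by positivity) ?_ hlim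
      filter_upwards [eventually_gt_atTop 0] with x hx
      have hxA : 0 < x + A := by linarith
      have hz := hmem (x : ℂ) (by simpa using hx.le)
      have hzn : ‖sectorMap e A x‖ = (x + A) ^ (-e) := by
        rw [sectorMap_ofReal hxA, Complex.norm_of_nonneg (by positivity)]
      set y := ‖(f ∘ sectorMap e A) x‖ with hy
      -- On the positive axis |z| = (x + A)^{-e}, so flatness gives decay like exp(-(c/k) x^{ek}),
      -- faster than any exp(-n x).
      have h1 := rpow_mul_exp_le (y := y) (x := M * (x + A) ^ (-e)) hk hC (by positivity)
        (norm_nonneg _) (fun N => by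
          have := hflat N _ hz
          rw [hzn] at this
          rw [mul_pow]
          refine this.trans (le_of_eq ?_)
          ring)
      have h2 : 1 / (2 * (M * (x + A) ^ (-e)) ^ k) = c * (x + A) ^ (e * k) := by
        rw [Real.mul_rpow hM.le (by positivity), ← Real.rpow_mul hxA.le, neg_mul,
          Real.rpow_neg hxA.le, hc]
        field_simp
      rw [h2] at h1
      have h3 : y ^ k ≤ 2 * C ^ k * Real.exp (-(c * x ^ (e * k))) := by
        rw [Real.exp_neg, ← div_eq_mul_inv, le_div_iff₀ (Real.exp_pos _)]
        refine le_trans ?_ h1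
        gcongr
        linarith
      have h4 := Real.rpow_le_rpow (by positivity) h3 (show (0 : ℝ) ≤ 1 / k by positivity)
      rw [← Real.rpow_mul (norm_nonneg _), mul_one_div_cancel hk.ne', Real.rpow_one,
        Real.mul_rpow (by positivity) (by positivity), ← Real.exp_mul] at h4
      have h5 : Real.exp (n * x - c / k * x ^ (e * k)) =
          Real.exp x ^ n * Real.exp (-(c * x ^ (e * k)) * (1 / k)) := by
        rw [← Real.exp_nat_mul, ← Real.exp_add]
        congr 1; ring
      rw [h5, mul_left_comm]
      gcongr
    · refine ⟨C, fun x => hbound _ (hmem _ ?_)⟩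
      simp
  -- The image of the half-plane contains the real segment (0, A^{-e}): r is the image of r^{-1/e} -
  -- A > 0. The identity theorem on the connected sector then finishes.
  have hreal : ∀ r : ℝ, 0 < r → r < A ^ (-e) → f r = 0 := by
    intro r hr hrA
    have hx : A < r ^ (-(1 / e)) := by
      have := Real.rpow_lt_rpow_of_neg hr hrA (show -(1 / e) < 0 by
        have : 0 < 1 / e := by positivity
        linarith)
      rwa [← Real.rpow_mul hA.le, neg_mul_neg, mul_one_div_cancel he0.ne', Real.rpow_one] at this
    have h1 := hzero (x := ((r ^ (-(1 / e)) - A : ℝ) : ℂ)) (by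
      change 0 ≤ (((r ^ (-(1 / e)) - A : ℝ) : ℂ)).re
      rw [Complex.ofReal_re]; linarith)
    rw [Function.comp_apply, sectorMap_ofReal (by linarith), sub_add_cancel,
      ← Real.rpow_mul hr.le, neg_mul_neg, one_div_mul_cancel he0.ne', Real.rpow_one] at h1
    exact h1
  have hr0 : 0 < A ^ (-e) := by positivity
  have hlt : A ^ (-e) / 2 < A ^ (-e) := half_lt_self hr0
  refine (hf.analyticOnNhd (isOpen_sector k R η)).eqOn_zero_of_preconnected_of_frequently_eq_zero
    (isPreconnected_sector hR hang)
    (ofReal_mem_sector hk hη (half_pos hr0) (hlt.trans hAR)) ?_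
  have ht : Tendsto (fun x : ℝ => (x : ℂ)) (𝓝[≠] (A ^ (-e) / 2))
      (𝓝[≠] ((A ^ (-e) / 2 : ℝ) : ℂ)) :=
    Complex.continuous_ofReal.continuousAt.continuousWithinAt.tendsto_nhdsWithin
      fun x hx h => hx (Complex.ofReal_injective h)
  refine ht.frequently (Eventually.frequently ?_)
  filter_upwards [nhdsWithin_le_nhds (lt_mem_nhds (half_pos hr0)),
    nhdsWithin_le_nhds (gt_mem_nhds hlt)] with x h1 h2 using hreal x h1 h2

/-! ### Functions of finite norm -/

lemma exists_representation {k R ρ η : ℝ} {f : ℂ → ℂ} {c : ℝ≥0∞} (hf : gevreyNorm k R ρ η f < c) :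
    ∃ F, IsRepresentation k R η f F ∧ cost k R ρ η F < c := by
  simpa only [gevreyNorm, iInf_lt_iff, exists_prop] using hf

lemma gevreyNorm_congr {k R ρ η : ℝ} {f g : ℂ → ℂ} (h : Set.EqOn f g (sector k R η)) :
    gevreyNorm k R ρ η f = gevreyNorm k R ρ η g := by
  have : ∀ {f g : ℂ → ℂ}, Set.EqOn f g (sector k R η) →
      gevreyNorm k R ρ η f ≤ gevreyNorm k R ρ η g := fun h =>
    le_iInf₂ fun F hF => iInf₂_le F ⟨hF.1, fun z hz => by rw [h hz]; exact hF.2 z hz⟩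
  exact le_antisymm (this h) (this h.symm)

/-- A representation of finite cost converges uniformly on the sector, being dominated by a multiple
of ∑ ρ^n. -/
lemma differentiableOn_of_gevreyNorm {k R ρ η : ℝ} (hα : IsAdmissible k R ρ η) {f : ℂ → ℂ}
    (hf : gevreyNorm k R ρ η f ≠ ∞) : DifferentiableOn ℂ f (sector k R η) := by
  obtain ⟨F, hF, hFc⟩ := exists_representation (lt_top_iff_ne_top.2 hf)
  have := Complex.differentiableOn_tsum_of_summable_norm
    ((summable_geometric_of_lt_one hα.2.le hα.3).mul_left (cost k R ρ η F).toReal)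
    (fun n => (hF.1 n).mono Set.subset_union_right) (isOpen_sector k R η)
    (fun n z hz => norm_le_of_cost hα.2 hFc.ne n (Or.inr hz))
  exact this.congr fun z hz => (hF.2 z hz).tsum_eq.symm

lemma one_le_ofReal_inv_pow {ρ : ℝ} (hρ : 0 < ρ) (hρ1 : ρ ≤ 1) (n : ℕ) :
    1 ≤ ENNReal.ofReal (ρ⁻¹ ^ n) :=
  ENNReal.one_le_ofReal.2 (one_le_pow₀ ((one_le_inv₀ hρ).2 hρ1))

lemma supNorm_le_term {k R ρ η : ℝ} (hρ : 0 < ρ) (hρ1 : ρ ≤ 1) (F : ℕ → ℂ → ℂ) (n : ℕ) :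
    supNorm (stage k R η n) (F n) ≤
      supNorm (stage k R η n) (F n) * ENNReal.ofReal (ρ⁻¹ ^ n) :=
  le_mul_of_one_le_right' (one_le_ofReal_inv_pow hρ hρ1 n)

lemma supNorm_sector_le {k R ρ η : ℝ} (hα : IsAdmissible k R ρ η) (f : ℂ → ℂ) :
    supNorm (sector k R η) f ≤ gevreyNorm k R ρ η f := by
  refine le_iInf₂ fun F hF => iSup₂_le fun z hz => ?_
  rw [← (hF.2 z hz).tsum_eq]
  refine enorm_tsum_le_tsum_enorm.trans (ENNReal.tsum_le_tsum fun n => ?_)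
  exact (enorm_le_supNorm _ (Or.inr hz)).trans (supNorm_le_term hα.2 hα.3.le F n)

/-- A function of finite norm has a limit at `0`. -/
lemma exists_tendsto_of_representation {k R ρ η : ℝ} (hα : IsAdmissible k R ρ η)
    {f : ℂ → ℂ} {F : ℕ → ℂ → ℂ} (hF : IsRepresentation k R η f F) (hFc : cost k R ρ η F ≠ ∞) :
    Tendsto f (sectorFilter k) (𝓝 (∑' n, F n 0)) := by
  have h1 : Tendsto (fun z => ∑' n, F n z) (sectorFilter k) (𝓝 (∑' n, F n 0)) := by
    refine tendsto_tsum_of_dominated_convergence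
      ((summable_geometric_of_lt_one hα.2.le hα.3).mul_left (cost k R ρ η F).toReal)
      (fun n => ?_) ?_
    · have h0 : (0 : ℂ) ∈ stage k R η n := Or.inl (by simpa using radius_pos k n)
      exact ((hF.1 n).differentiableAt ((isOpen_stage k R η n).mem_nhds h0)).continuousAt.tendsto.comp
        (sectorFilter_le_nhds k)
    · filter_upwards [sector_mem hα.1 hα.4] with z hz n
      exact norm_le_of_cost hα.2 hFc n (Or.inr hz)
  refine h1.congr' ?_
  filter_upwards [sector_mem hα.1 hα.4] with z hz using (hF.2 z hz).tsum_eq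

/-- Countable subadditivity of the norm. -/
lemma gevreyNorm_tsum_le {k R ρ η : ℝ} (hα : IsAdmissible k R ρ η) (f : ℕ → ℂ → ℂ)
    (hf : ∑' i, gevreyNorm k R ρ η (f i) ≠ ∞) :
    gevreyNorm k R ρ η (fun z => ∑' i, f i z) ≤ ∑' i, gevreyNorm k R ρ η (f i) := by
  refine ENNReal.le_of_forall_pos_le_add fun ε hε _ => ?_
  -- Almost optimal representations with errors summing to less than ε are added stage by stage;
  -- finiteness of the total cost justifies the exchange of sums.
  obtain ⟨δ, hδ, hδε⟩ := ENNReal.exists_pos_sum_of_countable (ENNReal.coe_ne_zero.2 hε.ne') ℕ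
  have hne : ∀ i, gevreyNorm k R ρ η (f i) ≠ ∞ := fun i =>
    ne_top_of_le_ne_top hf (ENNReal.le_tsum i)
  choose F hF hFc using fun i => exists_representation
    (ENNReal.lt_add_right (hne i) (ENNReal.coe_ne_zero.2 (hδ i).ne'))
  have hcost : ∑' i, cost k R ρ η (F i) ≤ ∑' i, gevreyNorm k R ρ η (f i) + ε := by
    refine (ENNReal.tsum_le_tsum fun i => (hFc i).le).trans ?_
    rw [ENNReal.tsum_add]
    gcongr
  have hcost' : ∑' i, cost k R ρ η (F i) ≠ ∞ :=
    ne_top_of_le_ne_top (ENNReal.add_ne_top.2 ⟨hf, ENNReal.coe_ne_top⟩) hcost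
  have hstage : ∀ n, ∑' i, supNorm (stage k R η n) (F i n) ≠ ∞ := fun n => by
    refine ne_top_of_le_ne_top hcost' (ENNReal.tsum_le_tsum fun i => ?_)
    exact (supNorm_le_term hα.2 hα.3.le (F i) n).trans (ENNReal.le_tsum n)
  have hrep : IsRepresentation k R η (fun z => ∑' i, f i z) (fun n z => ∑' i, F i n z) := by
    refine ⟨fun n => ?_, fun z hz => ?_⟩
    · refine Complex.differentiableOn_tsum_of_summable_norm (ENNReal.summable_toReal (hstage n))
        (fun i => (hF i).1 n) (isOpen_stage k R η n) fun i w hw => ?_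
      rw [← toReal_enorm]
      exact ENNReal.toReal_mono (ne_top_of_le_ne_top (hstage n) (ENNReal.le_tsum i))
        (enorm_le_supNorm _ hw)
    · have hs : Summable fun p : ℕ × ℕ => F p.1 p.2 z := by
        refine Summable.of_norm (tsum_enorm_ne_top_iff_summable_norm.1 ?_)
        rw [ENNReal.tsum_prod (f := fun i n => ‖F i n z‖ₑ)]
        refine ne_top_of_le_ne_top hcost' (ENNReal.tsum_le_tsum fun i =>
          ENNReal.tsum_le_tsum fun n => ?_)
        exact (enorm_le_supNorm _ (Or.inr hz)).trans (supNorm_le_term hα.2 hα.3.le (F i) n)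
      have h1 := hs.hasSum.prod_fiberwise fun i => (hF i).2 z hz
      have h2 : HasSum (fun p : ℕ × ℕ => F p.2 p.1 z) (∑' p : ℕ × ℕ, F p.1 p.2 z) :=
        (Equiv.prodComm ℕ ℕ).hasSum_iff.2 hs.hasSum
      rw [h1.tsum_eq]
      exact h2.prod_fiberwise fun n => (h2.summable.prod_factor n).hasSum
  refine (iInf₂_le _ hrep).trans (le_trans ?_ hcost)
  unfold cost
  rw [ENNReal.tsum_comm]
  refine ENNReal.tsum_le_tsum fun n => ?_
  rw [ENNReal.tsum_mul_right]
  refine mul_le_mul' (iSup₂_le fun z hz => enorm_tsum_le_tsum_enorm.trans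
    (ENNReal.tsum_le_tsum fun i => enorm_le_supNorm _ hz)) le_rfl

/-- The norm of the identity function is at most `max (|D_m|, R) ρ^{-m}`, for every `m`. -/
lemma gevreyNorm_id_le (k ρ η : ℝ) {R : ℝ} (m : ℕ) :
    gevreyNorm k R ρ η id ≤
      ENNReal.ofReal (max (radius k m) R) * ENNReal.ofReal (ρ⁻¹ ^ m) := by
  have hrep : IsRepresentation k R η id (fun n z => if n = m then z else 0) := by
    refine ⟨fun n => ?_, fun z _ => hasSum_ite_eq m z⟩
    by_cases h : n = m
    · simp only [h, if_true]
      exact differentiableOn_id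
    · simp [h]
  refine (iInf₂_le _ hrep).trans ?_
  rw [cost, tsum_eq_single m]
  · refine mul_le_mul' (iSup₂_le fun z hz => ?_) le_rfl
    simp only [if_true]
    rw [← ofReal_norm]
    refine ENNReal.ofReal_le_ofReal ?_
    rcases hz with hz | hz
    · exact (mem_ball_zero_iff.1 hz).le.trans (le_max_left _ _)
    · exact hz.2.1.le.trans (le_max_right _ _)
  · intro n hn
    simp [hn, supNorm]

/-- Division by `z` of the functions that vanish at `0` is bounded, if `ρ` is increased. -/
lemma exists_gevreyNorm_div_le {k R ρ ρ' η : ℝ} (hk : 0 < k) (hα : IsAdmissible k R ρ η)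
    (hρ : ρ < ρ') : ∃ C : ℝ≥0∞, C ≠ ∞ ∧ ∀ f : ℂ → ℂ, gevreyNorm k R ρ η f ≠ ∞ →
      Tendsto f (sectorFilter k) (𝓝 0) →
      gevreyNorm k R ρ' η (fun z => f z / z) ≤ C * gevreyNorm k R ρ η f := by
  have hρ0 := hα.2
  have hρ'0 : 0 < ρ' := hρ0.trans hρ
  have := neBot_sectorFilter hk
  -- Dividing the stage n by z costs the inverse radius of D_n, which is of size (n+1)^{1/k}. The
  -- ratio (ρ/ρ')^n absorbs it: the general estimate is used with m = 1 and ρ/ρ' in place of ρ.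
  obtain ⟨C₀, M₀, q, hC₀, hM₀, hq, hq1, hCM⟩ := exists_bound_radius hk
    (div_pos hρ0 hρ'0) ((div_lt_one hρ'0).2 hρ)
  have hrad : ∀ n, (radius k n)⁻¹ * ρ'⁻¹ ^ n ≤ C₀ * M₀ * ρ⁻¹ ^ n := by
    intro n
    have h1 := hCM n 1
    simp only [pow_one, Nat.factorial_one, Nat.cast_one, Real.one_rpow, mul_one] at h1
    have h2 : (ρ / ρ') ^ n * (radius k n)⁻¹ ≤ C₀ * M₀ :=
      h1.trans (mul_le_of_le_one_right (by positivity) (pow_le_one₀ hq.le hq1.le))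
    have h3 : (radius k n)⁻¹ * ρ'⁻¹ ^ n = (ρ / ρ') ^ n * (radius k n)⁻¹ * ρ⁻¹ ^ n := by
      rw [div_pow, inv_pow, inv_pow]; field_simp
    rw [h3]
    gcongr
  refine ⟨ENNReal.ofReal (2 * (C₀ * M₀)), ENNReal.ofReal_ne_top, fun f hf h0 => ?_⟩
  have key : ∀ F, IsRepresentation k R η f F → cost k R ρ η F ≠ ∞ →
      gevreyNorm k R ρ' η (fun z => f z / z) ≤ ENNReal.ofReal (2 * (C₀ * M₀)) * cost k R ρ η F := by
    intro F hF hFc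
    -- The individual F_n need not vanish at 0. Since their values there sum to the limit of f,
    -- subtracting F_n(0) from each stage does not change the sum.
    have hsum0 : ∑' n, F n 0 = 0 :=
      tendsto_nhds_unique (exists_tendsto_of_representation hα hF hFc) h0
    have h0s : ∀ n, (0 : ℂ) ∈ stage k R η n := fun n => Or.inl (by simpa using radius_pos k n)
    have hsummable : Summable fun n => F n 0 :=
      Summable.of_norm_bounded ((summable_geometric_of_lt_one hα.2.le hα.3).mul_left
        (cost k R ρ η F).toReal) fun n => norm_le_of_cost hα.2 hFc n (h0s n)
    have hfin : ∀ n, supNorm (stage k R η n) (F n) ≠ ∞ := fun n =>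
      ne_top_of_le_ne_top hFc ((supNorm_le_term hα.2 hα.3.le F n).trans (ENNReal.le_tsum n))
    have hquot : ∀ n, DifferentiableOn ℂ (quotient (F n) 1) (stage k R η n) ∧
        ∀ z ∈ stage k R η n, ‖quotient (F n) 1 z‖ ≤
          (supNorm (stage k R η n) (F n)).toReal * 2 ^ 1 * (radius k n ^ 1)⁻¹ := fun n =>
      quotient_bound (hF.1 n) (fun z hz => by
        rw [← toReal_enorm]
        exact ENNReal.toReal_mono (hfin n) (enorm_le_supNorm _ hz)) 1
    have hrep : IsRepresentation k R η (fun z => f z / z) (fun n => quotient (F n) 1) := by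
      refine ⟨fun n => (hquot n).1, fun z hz => ?_⟩
      have hz0 : z ≠ 0 := norm_pos_iff.1 hz.1
      have h1 := ((hF.2 z hz).sub hsummable.hasSum).div_const z
      rw [hsum0, sub_zero] at h1
      have e : (fun n => quotient (F n) 1 z) = fun n => (F n z - F n 0) / z := by
        funext n
        have := quotient_expansion (F n) 1 z
        simp only [Finset.range_one, Finset.sum_singleton, pow_zero, mul_one, pow_one] at this
        rw [eq_div_iff hz0, mul_comm, ← this]
        rfl
      change HasSum (fun n => quotient (F n) 1 z) (f z / z)
      rw [e]
      exact h1
    refine (iInf₂_le _ hrep).trans ?_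
    unfold cost
    rw [← ENNReal.tsum_mul_left]
    refine ENNReal.tsum_le_tsum fun n => ?_
    set B := (supNorm (stage k R η n) (F n)).toReal with hB
    have h1 : supNorm (stage k R η n) (quotient (F n) 1) ≤
        ENNReal.ofReal (B * 2 * (radius k n)⁻¹) := iSup₂_le fun z hz => by
      rw [← ofReal_norm]
      refine ENNReal.ofReal_le_ofReal ?_
      simpa using (hquot n).2 z hz
    have hr := radius_pos k n
    have hB0 : 0 ≤ B := ENNReal.toReal_nonneg
    refine (mul_le_mul' h1 le_rfl).trans ?_
    rw [← ENNReal.ofReal_toReal (hfin n), ← hB, ← ENNReal.ofReal_mul (by positivity),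
      ← ENNReal.ofReal_mul hB0, ← ENNReal.ofReal_mul (by positivity)]
    refine ENNReal.ofReal_le_ofReal ?_
    have := mul_le_mul_of_nonneg_left (hrad n) (show 0 ≤ 2 * B by positivity)
    linarith
  refine le_of_forall_gt fun c hc => ?_
  by_cases hC : ENNReal.ofReal (2 * (C₀ * M₀)) = 0
  · exfalso
    rw [ENNReal.ofReal_eq_zero] at hC
    have : 0 < 2 * (C₀ * M₀) := by positivity
    linarith
  have h1 : gevreyNorm k R ρ η f < c / ENNReal.ofReal (2 * (C₀ * M₀)) :=
    (ENNReal.lt_div_iff_mul_lt (Or.inl hC) (Or.inl ENNReal.ofReal_ne_top)).2 (by rwa [mul_comm])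
  by_cases hct : c = ∞
  · obtain ⟨F, hF, hFc⟩ := exists_representation (lt_top_iff_ne_top.2 hf)
    rw [hct]
    exact (key F hF hFc.ne).trans_lt (ENNReal.mul_lt_top ENNReal.ofReal_lt_top hFc)
  obtain ⟨F, hF, hFc⟩ := exists_representation h1
  refine (key F hF hFc.ne_top).trans_lt ?_
  rw [mul_comm]
  exact (ENNReal.lt_div_iff_mul_lt (Or.inl hC) (Or.inl ENNReal.ofReal_ne_top)).1 hFc

/-- The remainders of the asymptotic expansion of a function of finite norm satisfy Gevrey
estimates. -/
lemma exists_gevrey_expansion {k R ρ η : ℝ} (hk : 0 < k) (hα : IsAdmissible k R ρ η)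
    {f : ℂ → ℂ} (hf : gevreyNorm k R ρ η f ≠ ∞) : ∃ (a : ℕ → ℂ) (C M : ℝ), 0 ≤ C ∧ 0 < M ∧
      ∀ N : ℕ, ∀ z ∈ sector k R η, ‖f z - ∑ p ∈ Finset.range N, a p * z ^ p‖ ≤
        C * M ^ N * (N.factorial : ℝ) ^ (1 / k) * ‖z‖ ^ N := by
  obtain ⟨F, hF, hFc⟩ := exists_representation (lt_top_iff_ne_top.2 hf)
  obtain ⟨C₀, M₀, q, hC₀, hM₀, hq, hq1, hCM⟩ := exists_bound_radius hk hα.2 hα.3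
  set c := (cost k R ρ η F).toReal with hc
  have hc0 : 0 ≤ c := ENNReal.toReal_nonneg
  have hb : ∀ n, ∀ z ∈ stage k R η n, ‖F n z‖ ≤ c * ρ ^ n := fun n z hz =>
    norm_le_of_cost hα.2 hFc.ne n hz
  have hgeo : Summable fun n : ℕ => q ^ n := summable_geometric_of_lt_one hq.le hq1
  have hqb : ∀ (N n : ℕ), ∀ z ∈ stage k R η n, ‖quotient (F n) N z‖ ≤
      c * 2 ^ N * (C₀ * M₀ ^ N * (N.factorial : ℝ) ^ (1 / k)) * q ^ n := by
    intro N n z hz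
    refine ((quotient_bound (hF.1 n) (hb n) N).2 z hz).trans ?_
    have := mul_le_mul_of_nonneg_left (hCM n N) (show 0 ≤ c * 2 ^ N by positivity)
    linarith
  refine ⟨fun p => ∑' n, quotient (F n) p 0, c * C₀ * ∑' n, q ^ n, 2 * M₀,
    mul_nonneg (by positivity) (tsum_nonneg fun n => by positivity), by positivity,
    fun N z hz => ?_⟩
  have h0 : ∀ p, HasSum (fun n => quotient (F n) p 0) (∑' n, quotient (F n) p 0) := fun p =>
    (Summable.of_norm_bounded (hgeo.mul_left _)
      (fun n => hqb p n 0 (Or.inl (by simpa using radius_pos k n)))).hasSum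
  have h1 : HasSum (fun n => F n z - ∑ p ∈ Finset.range N, quotient (F n) p 0 * z ^ p)
      (f z - ∑ p ∈ Finset.range N, (∑' n, quotient (F n) p 0) * z ^ p) :=
    (hF.2 z hz).sub (hasSum_sum fun p _ => (h0 p).mul_right _)
  have h2 : c * C₀ * (∑' n, q ^ n) * (2 * M₀) ^ N * (N.factorial : ℝ) ^ (1 / k) * ‖z‖ ^ N =
      (c * 2 ^ N * (C₀ * M₀ ^ N * (N.factorial : ℝ) ^ (1 / k)) * ∑' n, q ^ n) * ‖z‖ ^ N := by
    rw [mul_pow]; ring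
  rw [← h1.tsum_eq, h2, ← tsum_mul_left, ← tsum_mul_right]
  refine tsum_of_norm_bounded ((hgeo.mul_left _).mul_right _).hasSum fun n => ?_
  rw [quotient_expansion, norm_mul, norm_pow, mul_comm]
  exact mul_le_mul_of_nonneg_right (hqb N n z (Or.inr hz)) (by positivity)

/-- A function of finite norm that is `O(z^m)` for all `m` vanishes. -/
lemma eqOn_zero_of_isBigO_pow {k R ρ η : ℝ} (hk : 0 < k) (hα : IsAdmissible k R ρ η)
    {f : ℂ → ℂ} (hf : gevreyNorm k R ρ η f ≠ ∞)
    (h : ∀ m : ℕ, f =O[sectorFilter k] fun z => z ^ m) : Set.EqOn f 0 (sector k R η) := by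
  have := neBot_sectorFilter hk
  obtain ⟨a, C, M, hC, hM, hexp⟩ := exists_gevrey_expansion hk hα hf
  -- If the lower coefficients vanish, a_p z^p is O(z^{p+1}), which forces a_p = 0. The Gevrey
  -- remainder bounds then become the flatness hypothesis of Watson's lemma.
  have ha : ∀ p, a p = 0 := by
    intro p
    induction p using Nat.strong_induction_on with
    | _ p ih =>
      have h1 : (fun z => f z - a p * z ^ p) =O[sectorFilter k] fun z => z ^ (p + 1) := by
        refine Asymptotics.IsBigO.of_bound
          (C * M ^ (p + 1) * ((p + 1).factorial : ℝ) ^ (1 / k)) ?_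
        filter_upwards [sector_mem hα.1 hα.4] with z hz
        have h2 := hexp (p + 1) z hz
        rwa [Finset.sum_range_succ, Finset.sum_eq_zero (fun i hi => by
          rw [ih i (Finset.mem_range.1 hi), zero_mul]), zero_add, ← norm_pow] at h2
      have h3 : (fun z => a p * z ^ p) =O[sectorFilter k] fun z => z ^ (p + 1) := by
        have := (h (p + 1)).sub h1
        simpa using this
      have h4 : (fun _ => a p) =O[sectorFilter k] fun z : ℂ => z := by
        obtain ⟨c, hc⟩ := h3.bound
        refine Asymptotics.IsBigO.of_bound c ?_
        filter_upwards [hc, eventually_ne_zero k] with z hz hz0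
        have hzp : 0 < ‖z‖ ^ p := pow_pos (norm_pos_iff.2 hz0) _
        rw [norm_mul, norm_pow, norm_pow, pow_succ', ← mul_assoc] at hz
        exact le_of_mul_le_mul_right hz hzp
      exact tendsto_nhds_unique tendsto_const_nhds
        (h4.trans_tendsto (sectorFilter_le_nhds k))
  refine eqOn_zero_of_flat hk hα.1 hα.4 hα.5 hC hM (differentiableOn_of_gevreyNorm hα hf) ?_
  intro N z hz
  simpa [ha] using hexp N z hz

/-! ### The norms on germs -/

/-- The norm of a germ: the infimum of the norms of its representatives. -/
noncomputable def germNorm (k R ρ η : ℝ) (a : SectorGerm k) : ℝ≥0∞ :=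
  ⨅ (f : ℂ → ℂ) (_ : (f : SectorGerm k) = a), gevreyNorm k R ρ η f

lemma germNorm_coe_le (k R ρ η : ℝ) (f : ℂ → ℂ) :
    germNorm k R ρ η (f : SectorGerm k) ≤ gevreyNorm k R ρ η f :=
  iInf₂_le (f := fun (g : ℂ → ℂ) (_ : (g : SectorGerm k) = f) => gevreyNorm k R ρ η g) f rfl

/-- Representatives of finite norm are holomorphic on the connected sector, so any two of the same
germ coincide there; the infimum thus has only one finite candidate. -/
lemma germNorm_coe {k R ρ η : ℝ} (hk : 0 < k) (hα : IsAdmissible k R ρ η) {f : ℂ → ℂ}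
    (hf : gevreyNorm k R ρ η f ≠ ∞) :
    germNorm k R ρ η (f : SectorGerm k) = gevreyNorm k R ρ η f := by
  refine le_antisymm (germNorm_coe_le _ _ _ _ f) (le_iInf₂ fun g hg => ?_)
  by_cases hgt : gevreyNorm k R ρ η g = ∞
  · rw [hgt]; exact le_top
  · exact (gevreyNorm_congr (eqOn_of_germ_eq hk hα.1 hα.4 hα.5
      (differentiableOn_of_gevreyNorm hα hf) (differentiableOn_of_gevreyNorm hα hgt)
      (Germ.coe_eq.1 hg.symm))).le

lemma exists_germNorm_eq {k R ρ η : ℝ} (hk : 0 < k) (hα : IsAdmissible k R ρ η)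
    {a : SectorGerm k} (ha : germNorm k R ρ η a ≠ ∞) :
    ∃ f : ℂ → ℂ, (f : SectorGerm k) = a ∧ gevreyNorm k R ρ η f = germNorm k R ρ η a := by
  obtain ⟨f, hf, hlt⟩ : ∃ f : ℂ → ℂ, (f : SectorGerm k) = a ∧ gevreyNorm k R ρ η f < ∞ := by
    simpa only [germNorm, iInf_lt_iff, exists_prop] using lt_top_iff_ne_top.2 ha
  exact ⟨f, hf, by rw [← hf, germNorm_coe hk hα hlt.ne]⟩

lemma germNorm_mono {k R R' ρ ρ' η η' : ℝ} (hR : R' ≤ R) (hη : η' ≤ η) (hρ0 : 0 < ρ)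
    (hρ : ρ ≤ ρ') (a : SectorGerm k) : germNorm k R' ρ' η' a ≤ germNorm k R ρ η a :=
  iInf₂_mono fun f _ => gevreyNorm_mono hR hη hρ0 hρ f

lemma germNorm_neg_le (k R ρ η : ℝ) (a : SectorGerm k) :
    germNorm k R ρ η (-a) ≤ germNorm k R ρ η a := by
  refine le_iInf₂ fun f hf => ?_
  rw [← hf]
  exact (germNorm_coe_le k R ρ η (-f)).trans (gevreyNorm_neg_le k R ρ η f)

lemma germNorm_add_le (k R ρ η : ℝ) (a b : SectorGerm k) :
    germNorm k R ρ η (a + b) ≤ germNorm k R ρ η a + germNorm k R ρ η b := by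
  refine ENNReal.le_iInf₂_add_iInf₂ fun f hf g hg => ?_
  rw [← hf, ← hg]
  exact (germNorm_coe_le k R ρ η (f + g)).trans (gevreyNorm_add_le k R ρ η f g)

lemma germNorm_mul_le {k R ρ η : ℝ} (hk : 0 < k) (hα : IsAdmissible k R ρ η) {a b : SectorGerm k}
    (ha : germNorm k R ρ η a ≠ ∞) (hb : germNorm k R ρ η b ≠ ∞) :
    germNorm k R ρ η (a * b) ≤ germNorm k R ρ η a * germNorm k R ρ η b := by
  obtain ⟨f, rfl, hf⟩ := exists_germNorm_eq hk hα ha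
  obtain ⟨g, rfl, hg⟩ := exists_germNorm_eq hk hα hb
  rw [← hf] at ha ⊢
  rw [← hg] at hb ⊢
  exact (germNorm_coe_le k R ρ η (f * g)).trans (gevreyNorm_mul_le hk hα.2 hα.3 ha hb)

lemma eq_zero_of_germNorm {k R ρ η : ℝ} (hk : 0 < k) (hα : IsAdmissible k R ρ η)
    {a : SectorGerm k} (ha : germNorm k R ρ η a = 0) : a = 0 := by
  obtain ⟨f, rfl, hf⟩ := exists_germNorm_eq hk hα (by rw [ha]; exact ENNReal.zero_ne_top)
  have h := supNorm_sector_le hα f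
  rw [hf, ha, nonpos_iff_eq_zero] at h
  refine Germ.coe_eq.2 ?_
  filter_upwards [sector_mem hα.1 hα.4] with z hz
  have := enorm_le_supNorm f hz
  rw [h, nonpos_iff_eq_zero, enorm_eq_zero] at this
  exact this

/-- Representatives realizing the norms converge absolutely at each point of the sector. The tail of
their sum is controlled by countable subadditivity of the norm. -/
lemma germNorm_complete {k R ρ η : ℝ} (hk : 0 < k) (hα : IsAdmissible k R ρ η)
    {a : ℕ → SectorGerm k} (ha : ∑' i, germNorm k R ρ η (a i) ≠ ∞) :
    ∃ s, ∀ m, germNorm k R ρ η (s - ∑ i ∈ Finset.range m, a i) ≤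
      ∑' i, germNorm k R ρ η (a (i + m)) := by
  choose f hfa hf using fun i => exists_germNorm_eq hk hα
    (ne_top_of_le_ne_top ha (ENNReal.le_tsum i))
  refine ⟨((fun z => ∑' i, f i z : ℂ → ℂ) : SectorGerm k), fun m => ?_⟩
  have hsum : ∀ z ∈ sector k R η, Summable fun i => f i z := fun z hz => by
    refine Summable.of_norm (tsum_enorm_ne_top_iff_summable_norm.1
      (ne_top_of_le_ne_top ha (ENNReal.tsum_le_tsum fun i => ?_)))
    rw [← hf i]
    exact (enorm_le_supNorm _ hz).trans (supNorm_sector_le hα _)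
  have hgerm : ((fun z => ∑' i, f i z : ℂ → ℂ) : SectorGerm k) - ∑ i ∈ Finset.range m, a i =
      ((fun z => ∑' i, f (i + m) z : ℂ → ℂ) : SectorGerm k) := by
    have h1 : ∑ i ∈ Finset.range m, a i =
        ((∑ i ∈ Finset.range m, f i : ℂ → ℂ) : SectorGerm k) := by
      change _ = Germ.coeRingHom (sectorFilter k) (∑ i ∈ Finset.range m, f i)
      rw [map_sum]
      exact Finset.sum_congr rfl fun i _ => (hfa i).symm
    rw [h1, sub_eq_iff_eq_add, ← Germ.coe_add]
    refine Germ.coe_eq.2 ?_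
    filter_upwards [sector_mem hα.1 hα.4] with z hz
    rw [Pi.add_apply, Finset.sum_apply, add_comm]
    exact ((hsum z hz).sum_add_tsum_nat_add m).symm
  have htail : ∑' i, gevreyNorm k R ρ η (f (i + m)) = ∑' i, germNorm k R ρ η (a (i + m)) :=
    tsum_congr fun i => hf (i + m)
  rw [hgerm, ← htail]
  refine (germNorm_coe_le _ _ _ _ _).trans (gevreyNorm_tsum_le hα _ ?_)
  rw [htail]
  exact ne_top_of_le_ne_top ha (ENNReal.tsum_comp_le_tsum_of_injective (add_left_injective m) _)

open Classical in
/-- The limit of a germ at `0`, if it exists. -/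
noncomputable def germValue {k : ℝ} (a : SectorGerm k) : ℂ :=
  if h : ∃ c, a.Tendsto (𝓝 c) then h.choose else 0

lemma germValue_coe {k : ℝ} (hk : 0 < k) {f : ℂ → ℂ} {c : ℂ}
    (h : Tendsto f (sectorFilter k) (𝓝 c)) : germValue (f : SectorGerm k) = c := by
  have := neBot_sectorFilter hk
  have h1 : ∃ c, (f : SectorGerm k).Tendsto (𝓝 c) := ⟨c, h⟩
  rw [germValue, dif_pos h1]
  exact tendsto_nhds_unique (Germ.coe_tendsto.1 h1.choose_spec) h

lemma tendsto_germValue {k R ρ η : ℝ} (hk : 0 < k) (hα : IsAdmissible k R ρ η) {f : ℂ → ℂ}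
    (hf : germNorm k R ρ η (f : SectorGerm k) ≠ ∞) :
    Tendsto f (sectorFilter k) (𝓝 (germValue (f : SectorGerm k))) := by
  obtain ⟨g, hg, hgn⟩ := exists_germNorm_eq hk hα hf
  obtain ⟨F, hF, hFc⟩ := exists_representation (lt_top_iff_ne_top.2 (hgn.trans_ne hf))
  have h := (exists_tendsto_of_representation hα hF hFc.ne).congr' (Germ.coe_eq.1 hg)
  rwa [germValue_coe hk h]

lemma exists_eq_id_mul {k R ρ ρ' η : ℝ} (hk : 0 < k) (hα : IsAdmissible k R ρ η) (hρ : ρ < ρ') :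
    ∃ C : ℝ≥0∞, C ≠ ∞ ∧ ∀ a : SectorGerm k, germNorm k R ρ η a ≠ ∞ → germValue a = 0 →
      ∃ b, a = ((id : ℂ → ℂ) : SectorGerm k) * b ∧
        germNorm k R ρ' η b ≤ C * germNorm k R ρ η a := by
  obtain ⟨C, hC, h⟩ := exists_gevreyNorm_div_le hk hα hρ
  refine ⟨C, hC, fun a ha h0 => ?_⟩
  obtain ⟨f, rfl, hf⟩ := exists_germNorm_eq hk hα ha
  have ht := tendsto_germValue hk hα ha
  rw [h0] at ht
  refine ⟨((fun z => f z / z : ℂ → ℂ) : SectorGerm k), ?_, ?_⟩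
  · rw [← Germ.coe_mul]
    refine Germ.coe_eq.2 ?_
    filter_upwards [eventually_ne_zero k] with z hz
    exact (mul_div_cancel₀ _ hz).symm
  · rw [← hf]
    exact (germNorm_coe_le _ _ _ _ _).trans (h f (hf.trans_ne ha) ht)

/-- A germ of finite norm that is divisible by all powers of `z` vanishes. -/
lemma eq_zero_of_forall_eq_id_pow_mul {k R ρ η : ℝ} (hk : 0 < k) (hα : IsAdmissible k R ρ η)
    {a : SectorGerm k} (ha : germNorm k R ρ η a ≠ ∞)
    (h : ∀ m : ℕ, ∃ (b : SectorGerm k) (R' ρ' η' : ℝ), IsAdmissible k R' ρ' η' ∧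
      germNorm k R' ρ' η' b ≠ ∞ ∧ a = ((id : ℂ → ℂ) : SectorGerm k) ^ m * b) : a = 0 := by
  obtain ⟨f, rfl, hf⟩ := exists_germNorm_eq hk hα ha
  have hzero := eqOn_zero_of_isBigO_pow hk hα (hf.trans_ne ha) fun m => by
    obtain ⟨b, R', ρ', η', hα', hb, hfb⟩ := h m
    obtain ⟨g, rfl, -⟩ := exists_germNorm_eq hk hα' hb
    -- The quotient b has a limit at 0, hence is bounded near 0, even though its parameters vary
    -- with m. So the germ is O(z^m) for every m.
    have h1 := (tendsto_germValue hk hα' hb).isBigO_one ℂ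
    rw [← Germ.coe_pow, ← Germ.coe_mul] at hfb
    have h2 := (Asymptotics.isBigO_refl (fun z : ℂ => z ^ m) (sectorFilter k)).mul h1
    simp only [mul_one] at h2
    exact (Germ.coe_eq.1 hfb).trans_isBigO h2
  refine Germ.coe_eq.2 ?_
  filter_upwards [sector_mem hα.1 hα.4] with z hz using hzero hz

/-! ### A cofinal sequence of parameters -/

/-- Half of the room between the angle `π / (2k)` and `π`. -/
noncomputable def angleRoom (k : ℝ) : ℝ := (Real.pi - Real.pi / (2 * k)) / 2

/-- The parameter `R` of a cofinal sequence; `η` is a multiple of it. -/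
noncomputable def seqR (j : ℕ) : ℝ := 1 / ((j : ℝ) + 1)

/-- The parameter `ρ` of a cofinal sequence. -/
noncomputable def seqρ (j : ℕ) : ℝ := 1 - 1 / ((j : ℝ) + 2)

lemma angleRoom_pos {k : ℝ} (hk : 1 / 2 < k) : 0 < angleRoom k := by
  have h1 : Real.pi / (2 * k) < Real.pi := div_lt_self Real.pi_pos (by linarith)
  unfold angleRoom; linarith

lemma seqR_pos (j : ℕ) : 0 < seqR j := by unfold seqR; positivity

lemma seqR_anti {i j : ℕ} (h : i ≤ j) : seqR j ≤ seqR i := by unfold seqR; gcongr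

lemma seqρ_mono {i j : ℕ} (h : i ≤ j) : seqρ i ≤ seqρ j := by unfold seqρ; gcongr

lemma tendsto_seqR : Tendsto seqR atTop (𝓝 0) := tendsto_one_div_add_atTop_nhds_zero_nat

lemma tendsto_seqρ : Tendsto seqρ atTop (𝓝 1) := by
  have h := (tendsto_seqR.comp (tendsto_add_atTop_nat 1)).const_sub 1
  rw [sub_zero] at h
  refine h.congr fun j => ?_
  simp only [Function.comp, seqR, seqρ]
  push_cast
  ring_nf

lemma seqρ_pos (j : ℕ) : 0 < seqρ j := by
  unfold seqρ
  rw [sub_pos, div_lt_one (by positivity)]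
  have : (0 : ℝ) ≤ j := by positivity
  linarith

lemma isAdmissible_seq {k : ℝ} (hk : 1 / 2 < k) (j : ℕ) :
    IsAdmissible k (seqR j) (seqρ j) (angleRoom k * seqR j) := by
  have h0 := angleRoom_pos hk
  have h1 : seqR j ≤ 1 := by
    have := seqR_anti (Nat.zero_le j)
    simpa [seqR] using this
  refine ⟨seqR_pos j, seqρ_pos j, ?_, mul_pos h0 (seqR_pos j), ?_⟩
  · unfold seqρ
    have : 0 < 1 / ((j : ℝ) + 2) := by positivity
    linarith
  · have h2 : angleRoom k * seqR j ≤ angleRoom k := mul_le_of_le_one_right h0.le h1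
    have h3 : Real.pi / (2 * k) + 2 * angleRoom k = Real.pi := by unfold angleRoom; ring
    linarith

/-- The sequence has R and η tending to 0 and ρ tending to 1, so a single index replaces the
directed set of parameters. -/
lemma exists_seq_le {k R ρ η : ℝ} (hα : IsAdmissible k R ρ η) :
    ∃ j, seqR j ≤ R ∧ ρ ≤ seqρ j ∧ angleRoom k * seqR j ≤ η := by
  have h1 := tendsto_seqR.eventually (gt_mem_nhds hα.1)
  have h2 := tendsto_seqρ.eventually (lt_mem_nhds hα.3)
  have h3 : Tendsto (fun j => angleRoom k * seqR j) atTop (𝓝 0) := by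
    simpa using tendsto_seqR.const_mul (angleRoom k)
  obtain ⟨j, h1, h2, h3⟩ := (h1.and (h2.and (h3.eventually (gt_mem_nhds hα.4)))).exists
  exact ⟨j, h1.le, h2.le, h3.le⟩

/-- The norm of index `j` in the cofinal sequence. -/
noncomputable def seqNorm (k : ℝ) (j : ℕ) (a : SectorGerm k) : ℝ≥0∞ :=
  germNorm k (seqR j) (seqρ j) (angleRoom k * seqR j) a

lemma seqNorm_anti {k : ℝ} (hk : 1 / 2 < k) {i j : ℕ} (h : i ≤ j) (a : SectorGerm k) :
    seqNorm k j a ≤ seqNorm k i a :=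
  germNorm_mono (seqR_anti h) (mul_le_mul_of_nonneg_left (seqR_anti h) (angleRoom_pos hk).le)
    (seqρ_pos i) (seqρ_mono h) a

lemma tendsto_radius {k : ℝ} (hk : 0 < k) : Tendsto (radius k) atTop (𝓝 0) := by
  have h1 : Tendsto (fun n : ℕ => (n : ℝ) + 1) atTop atTop :=
    tendsto_atTop_add_const_right _ _ tendsto_natCast_atTop_atTop
  have h2 := ((tendsto_rpow_neg_atTop (show 0 < 1 / k by positivity)).comp h1).const_mul (1 / 2)
  rw [mul_zero] at h2
  exact h2

lemma tendsto_seqNorm_id {k : ℝ} (hk : 0 < k) :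
    Tendsto (fun j => seqNorm k j ((id : ℂ → ℂ) : SectorGerm k)) atTop (𝓝 0) := by
  rw [ENNReal.tendsto_nhds_zero]
  intro ε hε
  obtain ⟨δ, hδ, hδε⟩ : ∃ δ : ℝ, 0 < δ ∧ ENNReal.ofReal (δ * 2) ≤ ε := by
    obtain ⟨δ, hδ, h⟩ := ENNReal.lt_iff_exists_nnreal_btwn.1 hε
    refine ⟨δ / 2, by simpa using hδ, ?_⟩
    rw [div_mul_cancel₀ _ two_ne_zero, ENNReal.ofReal_coe_nnreal]
    exact h.le
  -- Placing z at stage 0 would not give small norms, since D_0 is fixed. One first chooses a stage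
  -- m with D_m small, then j large enough that R is small and ρ^{-m} < 2.
  obtain ⟨m, hm⟩ := ((tendsto_radius hk).eventually (gt_mem_nhds hδ)).exists
  have h1 : Tendsto (fun j => (seqρ j)⁻¹ ^ m) atTop (𝓝 1) := by
    simpa using (tendsto_seqρ.inv₀ one_ne_zero).pow m
  filter_upwards [tendsto_seqR.eventually (gt_mem_nhds hδ),
    h1.eventually (gt_mem_nhds one_lt_two)] with j hj1 hj2
  refine ((germNorm_coe_le _ _ _ _ _).trans (gevreyNorm_id_le _ _ _ m)).trans ?_
  rw [← ENNReal.ofReal_mul (le_max_of_le_left (radius_pos k m).le)]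
  refine (ENNReal.ofReal_le_ofReal ?_).trans hδε
  exact mul_le_mul (max_le hm.le hj1.le) hj2.le
    (pow_nonneg (inv_nonneg.2 (seqρ_pos j).le) m) hδ.le

/-! ### The germs as a norm system. -/

/-- The sequence of norms on the germs. -/
noncomputable def gevreySystem (k : ℝ) (hk : 1 / 2 < k) : NormSystem ℂ (SectorGerm k) :=
  have hk0 : 0 < k := by linarith
  { norm := seqNorm k
    scalar := (Germ.coeRingHom (sectorFilter k)).comp (Pi.constRingHom ℂ ℂ)
    eval := germValue
    param := ((id : ℂ → ℂ) : SectorGerm k)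
    norm_anti := fun h a => seqNorm_anti hk h a
    norm_scalar := fun j c => ne_top_of_le_ne_top enorm_ne_top
      ((germNorm_coe_le _ _ _ _ _).trans (gevreyNorm_const_le _ _ _ _ c))
    norm_zero := fun j => by
      have := (germNorm_coe_le k (seqR j) (seqρ j) (angleRoom k * seqR j) (fun _ => 0)).trans
        (gevreyNorm_const_le _ _ _ _ 0)
      rw [enorm_zero, nonpos_iff_eq_zero] at this
      exact this
    norm_neg_le := fun j a => germNorm_neg_le _ _ _ _ a
    norm_add_le := fun j a b => germNorm_add_le _ _ _ _ a b
    norm_mul_le := fun {j _ _} ha hb => germNorm_mul_le hk0 (isAdmissible_seq hk j) ha hb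
    eq_zero_of_norm := fun {j _} ha => eq_zero_of_germNorm hk0 (isAdmissible_seq hk j) ha
    complete := fun {j _} ha => germNorm_complete hk0 (isAdmissible_seq hk j) ha
    eval_scalar := fun c => germValue_coe hk0 tendsto_const_nhds
    eval_add := fun {j a b} => Germ.inductionOn₂ a b fun f g hf hg =>
      germValue_coe hk0 ((tendsto_germValue hk0 (isAdmissible_seq hk j) hf).add
        (tendsto_germValue hk0 (isAdmissible_seq hk j) hg))
    eval_mul := fun {j a b} => Germ.inductionOn₂ a b fun f g hf hg =>
      germValue_coe hk0 ((tendsto_germValue hk0 (isAdmissible_seq hk j) hf).mul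
        (tendsto_germValue hk0 (isAdmissible_seq hk j) hg))
    eval_param := germValue_coe hk0 (sectorFilter_le_nhds k)
    norm_param := fun j => ne_top_of_le_ne_top
      (ENNReal.mul_ne_top ENNReal.ofReal_ne_top ENNReal.ofReal_ne_top)
      ((germNorm_coe_le _ _ _ _ _).trans (gevreyNorm_id_le _ _ _ 0))
    param_mul_eq_zero := fun {a} => Germ.inductionOn a fun f hf => by
      rw [← Germ.coe_mul] at hf
      refine Germ.coe_eq.2 ?_
      filter_upwards [Germ.coe_eq.1 hf, eventually_ne_zero k] with z h1 h2
      exact (mul_eq_zero.1 h1).resolve_left h2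
    tendsto_norm_param := tendsto_seqNorm_id hk0
    -- One step in the index suffices, because ρ increases strictly along the sequence.
    exists_div := fun j => by
      obtain ⟨C, hC, h⟩ := exists_eq_id_mul hk0 (isAdmissible_seq hk j)
        (show seqρ j < seqρ (j + 1) by
          unfold seqρ
          push_cast
          gcongr
          linarith)
      refine ⟨j + 1, C, hC, fun a ha h0 => ?_⟩
      obtain ⟨b, hb, hle⟩ := h a ha h0
      refine ⟨b, hb, le_trans ?_ hle⟩
      exact germNorm_mono (seqR_anti j.le_succ) (mul_le_mul_of_nonneg_left
        (seqR_anti j.le_succ) (angleRoom_pos hk).le) (seqρ_pos _) le_rfl b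
    separated := fun {j a} ha h => eq_zero_of_forall_eq_id_pow_mul hk0 (isAdmissible_seq hk j) ha
      fun m => by
        obtain ⟨b, i, hb, hab⟩ := h m
        exact ⟨b, _, _, _, isAdmissible_seq hk i, hb, hab⟩ }

/-! ### Weights of monomials against powers of μ. -/

/-- The index lies between 2^{|ω|} and p_n^{|ω|}, so weights M(ω)^{-t} and powers μ^{|ω|} dominate
each other after a change of parameter: both families define the same convergent series. -/
lemma ofReal_pow_degree_le_weight {n : ℕ} (t : ℕ) (ω : Fin n →₀ ℕ) :
    ENNReal.ofReal ((((Nat.nth Nat.Prime n : ℕ) : ℝ)⁻¹ ^ t) ^ ω.degree) ≤ weight t ω := by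
  have hp : (0 : ℝ) < (Nat.nth Nat.Prime n : ℕ) := by exact_mod_cast (prime_nth n).pos
  rw [pow_right_comm, ENNReal.ofReal_pow (by positivity), ENNReal.ofReal_pow (by positivity),
    ENNReal.ofReal_inv_of_pos hp, ENNReal.ofReal_natCast, weight, ← ENNReal.inv_pow]
  refine pow_le_pow_left' (ENNReal.inv_le_inv.2 ?_) t
  exact_mod_cast monomialIndex_le_pow_degree ω

lemma weight_le_ofReal_pow_degree {n t : ℕ} {μ : ℝ} (hμ : (2 : ℝ)⁻¹ ^ t ≤ μ)
    (ω : Fin n →₀ ℕ) : weight t ω ≤ ENNReal.ofReal (μ ^ ω.degree) := by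
  have h1 : weight t ω ≤ ENNReal.ofReal (((2 : ℝ)⁻¹ ^ t) ^ ω.degree) := by
    rw [pow_right_comm, ENNReal.ofReal_pow (by positivity), ENNReal.ofReal_pow (by positivity),
      ENNReal.ofReal_inv_of_pos two_pos, ENNReal.ofReal_ofNat, weight, ← ENNReal.inv_pow (a := 2)]
    refine pow_le_pow_left' (ENNReal.inv_le_inv.2 ?_) t
    exact_mod_cast two_pow_degree_le ω
  refine h1.trans (ENNReal.ofReal_le_ofReal ?_)
  gcongr

/-- The ring of Gevrey-analytic germs consists of the convergent power series for the sequence of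
norms. -/
theorem gevreyAnalytic_eq_convergent (k : ℝ) (hk : 1 / 2 < k) (n : ℕ) :
    gevreyAnalytic k hk n = (gevreySystem k hk).convergent n := by
  have hk0 : 0 < k := by linarith
  ext φ
  constructor
  · rintro ⟨R, ρ, η, μ, hα, hμ, f, h1, -, h3⟩
    obtain ⟨j, hR, hρ, hη⟩ := exists_seq_le hα
    obtain ⟨t, ht⟩ := exists_pow_lt_of_lt_one hμ (show (2 : ℝ)⁻¹ < 1 by norm_num)
    refine ⟨j, t, ne_top_of_le_ne_top h3.ne (ENNReal.tsum_le_tsum fun ω =>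
      mul_le_mul' ?_ (weight_le_ofReal_pow_degree ht.le ω))⟩
    rw [h1]
    exact (germNorm_coe_le _ _ _ _ _).trans (gevreyNorm_mono hR hη hα.2 hρ _)
  · rintro ⟨j, t, h⟩
    have hp : (0 : ℝ) < (Nat.nth Nat.Prime n : ℕ) := by exact_mod_cast (prime_nth n).pos
    have hα := isAdmissible_seq hk j
    choose f hfa hf using fun ω => exists_germNorm_eq hk0 hα
      ((gevreySystem k hk).norm_coeff_ne_top h ω)
    have hμ : 0 < ((Nat.nth Nat.Prime n : ℕ) : ℝ)⁻¹ ^ t := by positivity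
    -- That the coefficients are Gevrey germs needs no separate argument: it follows from finiteness
    -- of their norms.
    refine ⟨_, _, _, _, hα, hμ, mem_banachPiece hk0 hα hμ f (fun ω => (hfa ω).symm) ?_⟩
    refine lt_of_le_of_lt (ENNReal.tsum_le_tsum fun ω => ?_) (lt_top_iff_ne_top.2 h)
    rw [hf]
    exact mul_le_mul' le_rfl (ofReal_pow_degree_le_weight t ω)

end GevreyAnalytic

/-- For every order `k > 1/2`, the ring `𝒢{y_1, …, y_n}` is Noetherian, local and regular, of Krull
dimension `n + 1`. -/
theorem mainTheorem5 (k : ℝ) (hk : 1 / 2 < k) (n : ℕ) :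
    IsNoetherianRing (GevreyAnalytic.gevreyAnalytic k hk n) ∧
      IsLocalRing (GevreyAnalytic.gevreyAnalytic k hk n) ∧
      IsRegularLocalRing (GevreyAnalytic.gevreyAnalytic k hk n) ∧
      ringKrullDim (GevreyAnalytic.gevreyAnalytic k hk n) = (n : WithBot ℕ∞) + 1 := by
  rw [GevreyAnalytic.gevreyAnalytic_eq_convergent]
  exact ⟨inferInstance, inferInstance, GevreyAnalytic.NormSystem.isRegularLocalRing_convergent,
    GevreyAnalytic.NormSystem.ringKrullDim_convergent⟩
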